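/- For $n\ge 0$ let $\mathbb{CP}^n=(\mathbb C^{n+1}\setminus\{0\})/\mathbb C^*$ carry its standard complex structure (affine charts $z_k/z_i$), with multiplication by $i$ on tangent spaces written $J$. Let $g$ be the Fubini–Study metric: in the affine chart $t$, $$g_t(v,w)=\operatorname{Re}\frac{(1+|t|^2)\langle v,w\rangle-\langle v,t\rangle\langle t,w\rangle}{(1+|t|^2)^2}.$$ 0. The projection $q:S^{2n+1}\to\mathbb{CP}^n$, $z\mapsto[z]$, of the unit sphere is a Riemannian submersion for $g$: for each $z\in S^{2n+1}$, $dq_z$ vanishes on $iz$ and maps the space $H_z$ of vectors orthogonal to $z$ and $iz$ isometrically onto $T_{[z]}\mathbb{CP}^n$. 1. Let $n\ge 2$. Then $\mathbb{CP}^n$ is a (Hausdorff, second countable) complex manifold and $g$ is a Kähler metric on it: $g$ is a smooth Riemannian metric, $g(J\cdot,J\cdot)=g$, and the form $g(J\cdot,\cdot)$ is closed. The Levi-Civita connection of $g$ equals its Chern connection. The metric is Einstein with positive constant: $\mathrm{Ric}=c\,g$ for some $c>0$. If $u,w\in T_p\mathbb{CP}^n$ are unit vectors with $w\perp u$ and $w\perp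 Ju$, then for all $s\in\mathbb R$ the sectional curvature satisfies $$K(u,\cos s\, w+\sin s\, Ju)=1+3\sin^2 s .$$ The sectional curvature of $g$ is not constant, $(\mathbb{CP}^n,g)$ is not locally conformally flat, and $\mathbb{CP}^n$ is orientable. (Locally conformally flat means that every point has an open neighbourhood with a smooth function $f$ on it such that $e^{2f}g$ has zero curvature there.) 2. $(\mathbb{CP}^1,4g)$ is isometric to the unit sphere $S^2\subset\mathbb R^3$ with its round metric (that is, $(\mathbb{CP}^1,g)$ is isometric to the round sphere of radius $1/2$). In particular $(\mathbb{CP}^1,g)$ has constant sectional curvature ($=4$), and it is locally conformally flat. 3. Let $n\ge 1$, $G=SU(n+1)$ and $H=S(U(1)\times U(n))$ (block diagonal matrices in $G$), and let $G/H$ carry its smooth structure of homogeneous space, for which $G\to G/H$ is a smooth submersion; such a structure exists. Then $F:G/H\to\mathbb{CP}^n$, $F([x])=[x\cdot(1,0,\dots,0)]$, is a diffeomorphism, there is a $G$-invariant smooth Riemannian metric on $G/H$, and for every such metric $h$ there is $\mu>0$ with $F^*g=\mu h$. -/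

import Mathlib

open scoped Manifold ContDiff LinearAlgebra.Projectivization

set_option maxSynthPendingDepth 3

noncomputable section

namespace FubiniStudy

/-- The Hermitian space `ℂⁿ`. -/
abbrev Cn (n : ℕ) : Type := EuclideanSpace ℂ (Fin n)

/-- Complex projective space: the complex lines of `ℂⁿ⁺¹`. -/
abbrev CP (n : ℕ) : Type := ℙ ℂ (Cn (n + 1))

/-- The quotient topology of `ℂⁿ⁺¹ ∖ {0}`. -/
instance instTopologicalSpaceCP (n : ℕ) : TopologicalSpace (CP n) :=
  inferInstanceAs (TopologicalSpace (Quotient (projectivizationSetoid ℂ (Cn (n + 1)))))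

theorem isQuotientMap_mk' (n : ℕ) :
    Topology.IsQuotientMap (Projectivization.mk' ℂ : {v : Cn (n + 1) // v ≠ 0} → CP n) :=
  isQuotientMap_quot_mk

/-- The inclusion `ℂⁿ → ℂⁿ⁺¹` that inserts a `0` at position `i`. -/
def slot {n : ℕ} (i : Fin (n + 1)) : Cn n →L[ℂ] Cn (n + 1) :=
  LinearMap.toContinuousLinearMap
    { toFun := fun v => WithLp.toLp 2 (i.insertNth (α := fun _ => ℂ) 0 (fun j => v j))
      map_add' := fun v w => by
        ext k
        refine Fin.succAboveCases i ?_ (fun j => ?_) k <;> simp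
      map_smul' := fun c v => by
        ext k
        refine Fin.succAboveCases i ?_ (fun j => ?_) k <;> simp }

@[simp]
theorem slot_same {n : ℕ} (i : Fin (n + 1)) (v : Cn n) : slot i v i = 0 := by
  simp [slot]

@[simp]
theorem slot_succAbove {n : ℕ} (i : Fin (n + 1)) (v : Cn n) (j : Fin n) :
    slot i v (i.succAbove j) = v j := by
  simp [slot]

/-- The affine section `t ↦ (t₀, …, 1, …, tₙ₋₁)` with the `1` at position `i`. -/
def affineLift {n : ℕ} (i : Fin (n + 1)) (t : Cn n) : Cn (n + 1) :=
  EuclideanSpace.single i 1 + slot i t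

@[simp]
theorem affineLift_same {n : ℕ} (i : Fin (n + 1)) (t : Cn n) : affineLift i t i = 1 := by
  simp [affineLift]

@[simp]
theorem affineLift_succAbove {n : ℕ} (i : Fin (n + 1)) (t : Cn n) (j : Fin n) :
    affineLift i t (i.succAbove j) = t j := by
  simp [affineLift, Fin.succAbove_ne]

theorem affineLift_ne_zero {n : ℕ} (i : Fin (n + 1)) (t : Cn n) : affineLift i t ≠ 0 := by
  intro h
  have := affineLift_same i t
  simp [h] at this

/-- The affine coordinates `(z_k / z_i)_{k ≠ i}`. -/
def affineCoord {n : ℕ} (i : Fin (n + 1)) (z : Cn (n + 1)) : Cn n :=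
  WithLp.toLp 2 fun j => z (i.succAbove j) / z i

/-- The affine coordinates as a function on projective space. -/
def affineMap {n : ℕ} (i : Fin (n + 1)) : CP n → Cn n :=
  Projectivization.lift (fun v => affineCoord i v.1) (by
    intro a b t h
    have ht : t ≠ 0 := by
      rintro rfl
      exact a.2 (by simpa using h)
    ext j
    simp [affineCoord, h, mul_div_mul_left _ _ ht])

/-- The open set `z_i ≠ 0`. -/
def affineSet {n : ℕ} (i : Fin (n + 1)) : Set (CP n) := {p | p.rep i ≠ 0}

theorem mk_mem_affineSet {n : ℕ} (i : Fin (n + 1)) (z : Cn (n + 1)) (hz : z ≠ 0) :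
    Projectivization.mk ℂ z hz ∈ affineSet i ↔ z i ≠ 0 := by
  obtain ⟨a, ha⟩ := Projectivization.exists_smul_eq_mk_rep ℂ z hz
  show (Projectivization.mk ℂ z hz).rep i ≠ 0 ↔ _
  rw [← ha]
  simp [Units.smul_def]

theorem isOpen_affineSet {n : ℕ} (i : Fin (n + 1)) : IsOpen (affineSet (n := n) i) := by
  rw [← (isQuotientMap_mk' n).isOpen_preimage]
  have : (Projectivization.mk' ℂ : {v : Cn (n + 1) // v ≠ 0} → CP n) ⁻¹' affineSet i
      = {v | v.1 i ≠ 0} := by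
    ext v
    exact mk_mem_affineSet i v.1 v.2
  rw [this]
  exact isOpen_ne_fun (by fun_prop) continuous_const

theorem continuous_affineLift {n : ℕ} (i : Fin (n + 1)) :
    Continuous (affineLift (n := n) i) := by
  unfold affineLift
  fun_prop

theorem continuousOn_affineMap {n : ℕ} (i : Fin (n + 1)) :
    ContinuousOn (affineMap (n := n) i) (affineSet i) := by
  rw [(isQuotientMap_mk' n).continuousOn_isOpen_iff (isOpen_affineSet i)]
  have : (affineMap (n := n) i) ∘ (Projectivization.mk' ℂ) = fun v => affineCoord i v.1 := rfl
  rw [this]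
  have h : ∀ v ∈ (Projectivization.mk' ℂ : {v : Cn (n + 1) // v ≠ 0} → CP n) ⁻¹' affineSet i,
      v.1 i ≠ 0 := fun v hv => (mk_mem_affineSet i v.1 v.2).1 hv
  unfold affineCoord
  refine (PiLp.continuous_toLp 2 _).comp_continuousOn (continuousOn_pi.2 fun j => ?_)
  exact ContinuousOn.div (by fun_prop) (by fun_prop) h

/-- The affine chart `[z] ↦ (z_k / z_i)_{k ≠ i}` on the open set `z_i ≠ 0`. -/
def affineChart {n : ℕ} (i : Fin (n + 1)) : OpenPartialHomeomorph (CP n) (Cn n) where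
  toFun := affineMap i
  invFun t := Projectivization.mk ℂ (affineLift i t) (affineLift_ne_zero i t)
  source := affineSet i
  target := Set.univ
  map_source' _ _ := Set.mem_univ _
  map_target' t _ := (mk_mem_affineSet i _ _).2 (by simp)
  left_inv' p hp := by
    induction p using Projectivization.ind with
    | h z hz =>
      have hi : z i ≠ 0 := (mk_mem_affineSet i z hz).1 hp
      refine (Projectivization.mk_eq_mk_iff' ℂ _ _ _ _).2 ⟨(z i)⁻¹, ?_⟩
      ext k
      refine Fin.succAboveCases i ?_ (fun j => ?_) k
      · simp [hi]
      · simp [affineMap, affineCoord, div_eq_inv_mul]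
  right_inv' t _ := by
    ext j
    simp [affineMap, affineCoord]
  open_source := isOpen_affineSet i
  open_target := isOpen_univ
  continuousOn_toFun := continuousOn_affineMap i
  continuousOn_invFun := by
    refine Continuous.continuousOn ?_
    exact (isQuotientMap_mk' n).continuous.comp
      ((continuous_affineLift i).subtype_mk (affineLift_ne_zero i))

theorem exists_mem_affineSet {n : ℕ} (p : CP n) : ∃ i, p ∈ affineSet i := by
  by_contra! h
  refine p.rep_nonzero ?_
  ext i
  simpa [affineSet] using h i

/-- An index of an affine chart around `p`. -/
def chartIndex {n : ℕ} (p : CP n) : Fin (n + 1) := (exists_mem_affineSet p).choose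

/-- The atlas of the `n + 1` affine charts. -/
instance instChartedSpaceCP (n : ℕ) : ChartedSpace (Cn n) (CP n) where
  atlas := Set.range affineChart
  chartAt p := affineChart (chartIndex p)
  mem_chart_source p := (exists_mem_affineSet p).choose_spec
  chart_mem_atlas _ := Set.mem_range_self _

theorem affineChart_trans_eq {n : ℕ} (i k : Fin (n + 1)) (t : Cn n) :
    affineChart k ((affineChart i).symm t) = affineCoord k (affineLift i t) := rfl

theorem mem_affineChart_trans_source {n : ℕ} (i k : Fin (n + 1)) (t : Cn n)
    (ht : t ∈ ((affineChart (n := n) i).symm.trans (affineChart k)).source) :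
    affineLift i t k ≠ 0 := by
  have h2 : (affineChart (n := n) i).symm t ∈ affineSet k := by
    rw [OpenPartialHomeomorph.trans_source] at ht
    exact ht.2
  exact (mk_mem_affineSet k (affineLift i t) (affineLift_ne_zero i t)).1 h2

theorem contDiffOn_affineChart_trans {n : ℕ} (i k : Fin (n + 1)) :
    ContDiffOn ℂ ω (fun t : Cn n => affineCoord k (affineLift i t))
      {t | affineLift i t k ≠ 0} := by
  have hl : ContDiff ℂ ω (affineLift (n := n) i) := by
    unfold affineLift
    fun_prop
  have hc : ∀ m : Fin (n + 1), ContDiff ℂ ω (fun t : Cn n => affineLift i t m) := fun m =>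
    (EuclideanSpace.proj (𝕜 := ℂ) m : Cn (n + 1) →L[ℂ] ℂ).contDiff.comp hl
  rw [contDiffOn_piLp]
  intro j
  exact (hc _).contDiffOn.div (hc k).contDiffOn fun t ht => ht

/-- Projective space is a complex manifold. -/
instance instIsManifoldComplexCP (n : ℕ) : IsManifold 𝓘(ℂ, Cn n) ω (CP n) := by
  apply isManifold_of_contDiffOn
  rintro _ _ ⟨i, rfl⟩ ⟨k, rfl⟩
  refine (contDiffOn_affineChart_trans i k).congr_mono (fun t _ => rfl) ?_
  rintro t ht
  exact mem_affineChart_trans_source i k t (by simpa using ht)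

/-- Projective space is a smooth real manifold. -/
instance instIsManifoldRealCP (n : ℕ) : IsManifold 𝓘(ℝ, Cn n) ∞ (CP n) := by
  apply isManifold_of_contDiffOn
  rintro _ _ ⟨i, rfl⟩ ⟨k, rfl⟩
  refine (((contDiffOn_affineChart_trans i k).restrict_scalars ℝ).of_le le_top).congr_mono
    (fun t _ => rfl) ?_
  rintro t ht
  exact mem_affineChart_trans_source i k t (by simpa using ht)

/-! ### Riemannian geometry in charts -/

section Riemannian

variable {E : Type*} [NormedAddCommGroup E] [NormedSpace ℝ E]

/-- The covariant Christoffel symbols `(u, v, w) ↦ (D_u G (v, w) + D_v G (u, w) - D_w G (u, v)) / 2`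
of a metric `G` on an open subset of `E`. -/
def koszul (G : E → E →L[ℝ] E →L[ℝ] ℝ) (y : E) : E →L[ℝ] E →L[ℝ] E →L[ℝ] ℝ :=
  (1 / 2 : ℝ) • (fderiv ℝ G y + (fderiv ℝ G y).flip
    - (ContinuousLinearMap.flipₗᵢ ℝ E E ℝ).toContinuousLinearEquiv.toContinuousLinearMap ∘L
        (fderiv ℝ G y).flip)

theorem koszul_apply (G : E → E →L[ℝ] E →L[ℝ] ℝ) (y u v w : E) :
    koszul G y u v w =
      (fderiv ℝ G y u v w + fderiv ℝ G y v u w - fderiv ℝ G y w u v) / 2 := by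
  simp [koszul]
  ring

/-- The Christoffel symbols of the Levi-Civita connection: `Γ(u, v)` is the vector with
`G (Γ(u, v), w) = (D_u G (v, w) + D_v G (u, w) - D_w G (u, v)) / 2` for all `w`. -/
def christoffel (G : E → E →L[ℝ] E →L[ℝ] ℝ) (y : E) : E →L[ℝ] E →L[ℝ] E :=
  (ContinuousLinearMap.compL ℝ E (E →L[ℝ] ℝ) E (G y).inverse) ∘L koszul G y

theorem christoffel_apply (G : E → E →L[ℝ] E →L[ℝ] ℝ) (y u v : E) :
    christoffel G y u v = (G y).inverse (koszul G y u v) := rfl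

/-- Auxiliary term `(u, v, w) ↦ (D_u Γ)(v, w) + Γ(u, Γ(v, w))` of the curvature. -/
def curvatureAux (G : E → E →L[ℝ] E →L[ℝ] ℝ) (y : E) : E →L[ℝ] E →L[ℝ] E →L[ℝ] E :=
  fderiv ℝ (christoffel G) y +
    (ContinuousLinearMap.compL ℝ E E E).bilinearComp (christoffel G y) (christoffel G y)

/-- The curvature tensor `R(u, v) w = ∇_u ∇_v w - ∇_v ∇_u w - ∇_[u,v] w` in coordinates. -/
def coordCurvature (G : E → E →L[ℝ] E →L[ℝ] ℝ) (y : E) : E →L[ℝ] E →L[ℝ] E →L[ℝ] E :=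
  curvatureAux G y - (curvatureAux G y).flip

theorem coordCurvature_apply (G : E → E →L[ℝ] E →L[ℝ] ℝ) (y u v w : E) :
    coordCurvature G y u v w =
      (fderiv ℝ (christoffel G) y u v w + christoffel G y u (christoffel G y v w))
      - (fderiv ℝ (christoffel G) y v u w + christoffel G y v (christoffel G y u w)) := rfl

variable {M : Type*} [TopologicalSpace M] [ChartedSpace E M]

variable (E M) in
/-- A field of bilinear forms on the tangent spaces of `M`. -/
abbrev TensorField : Type _ :=
  ∀ p : M, TangentSpace 𝓘(ℝ, E) p →L[ℝ] TangentSpace 𝓘(ℝ, E) p →L[ℝ] ℝ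

/-- `g` is a smooth Riemannian metric. -/
def IsSmoothMetric [IsManifold 𝓘(ℝ, E) ∞ M] (g : TensorField E M) : Prop :=
  ∃ g' : Bundle.ContMDiffRiemannianMetric 𝓘(ℝ, E) ∞ E (fun p : M => TangentSpace 𝓘(ℝ, E) p),
    g'.inner = g

/-- The expression of `g` in the preferred chart at `p`, a function on the model space. -/
def coordMetric (g : TensorField E M) (p : M) (y : E) : E →L[ℝ] E →L[ℝ] ℝ :=
  let D : TangentSpace 𝓘(ℝ, E) y →L[ℝ] TangentSpace 𝓘(ℝ, E) ((chartAt E p).symm y) :=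
    mfderiv 𝓘(ℝ, E) 𝓘(ℝ, E) (chartAt E p).symm y
  ContinuousLinearMap.precomp ℝ D ∘L g ((chartAt E p).symm y) ∘L D

theorem coordMetric_apply (g : TensorField E M) (p : M) (y u v : E) :
    coordMetric g p y u v = g ((chartAt E p).symm y)
      (mfderiv 𝓘(ℝ, E) 𝓘(ℝ, E) (chartAt E p).symm y u)
      (mfderiv 𝓘(ℝ, E) 𝓘(ℝ, E) (chartAt E p).symm y v) := rfl

/-- The Christoffel symbols at `p` of the Levi-Civita connection, in the preferred chart at `p`. -/
def leviCivita (g : TensorField E M) (p : M) : E →L[ℝ] E →L[ℝ] E :=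
  christoffel (coordMetric g p) (chartAt E p p)

/-- The Riemann curvature tensor of `g` at `p`, computed in the preferred chart at `p`, through
which the tangent space at `p` is identified with `E`. -/
def riemann (g : TensorField E M) (p : M) :
    TangentSpace 𝓘(ℝ, E) p →L[ℝ] TangentSpace 𝓘(ℝ, E) p →L[ℝ]
      TangentSpace 𝓘(ℝ, E) p →L[ℝ] TangentSpace 𝓘(ℝ, E) p :=
  (coordCurvature (coordMetric g p) (chartAt E p p) : E →L[ℝ] E →L[ℝ] E →L[ℝ] E)

/-- The Ricci curvature `Ric(v, w) = tr (u ↦ R(u, v) w)`. -/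
def ricci (g : TensorField E M) (p : M) (v w : TangentSpace 𝓘(ℝ, E) p) : ℝ :=
  LinearMap.trace ℝ (TangentSpace 𝓘(ℝ, E) p)
    { toFun := fun u => riemann g p u v w
      map_add' := fun a b => by simp
      map_smul' := fun c a => by simp }

/-- The sectional curvature of the plane spanned by `u` and `v`. -/
def sectional (g : TensorField E M) (p : M) (u v : TangentSpace 𝓘(ℝ, E) p) : ℝ :=
  g p (riemann g p u v v) u / (g p u u * g p v v - g p u v ^ 2)

/-- `g` is Einstein with constant `c`. -/
def IsEinstein (g : TensorField E M) (c : ℝ) : Prop :=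
  ∀ (p : M) (v w : TangentSpace 𝓘(ℝ, E) p), ricci g p v w = c * g p v w

/-- All planes at all points have sectional curvature `c`. -/
def HasConstantSectionalCurvature (g : TensorField E M) (c : ℝ) : Prop :=
  ∀ (p : M) (u v : TangentSpace 𝓘(ℝ, E) p), LinearIndependent ℝ ![u, v] → sectional g p u v = c

/-- Every point has an open neighbourhood on which some conformal metric `e^{2f} g` is flat. -/
def IsLocallyConformallyFlat (g : TensorField E M) : Prop :=
  ∀ p : M, ∃ U : Set M, IsOpen U ∧ p ∈ U ∧ ∃ f : M → ℝ,
    ContMDiffOn 𝓘(ℝ, E) 𝓘(ℝ, ℝ) ∞ f U ∧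
      ∀ q ∈ U, riemann (fun x => Real.exp (2 * f x) • g x : TensorField E M) q = 0

variable (E M) in
/-- `M` is covered by smooth charts whose transition maps have positive Jacobian determinants. -/
def IsOrientable : Prop :=
  ∃ A ⊆ IsManifold.maximalAtlas 𝓘(ℝ, E) ∞ M, (∀ p : M, ∃ e ∈ A, p ∈ e.source) ∧
    ∀ e ∈ A, ∀ e' ∈ A, ∀ y ∈ (e.symm.trans e').source,
      0 < (fderiv ℝ (fun x => e' (e.symm x)) y).det

/-- The pull-back `f^* g'` of a field of bilinear forms. -/
def pullback {E' M' : Type*} [NormedAddCommGroup E'] [NormedSpace ℝ E'] [TopologicalSpace M']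
    [ChartedSpace E' M'] (f : M → M') (g' : TensorField E' M') : TensorField E M :=
  fun p => ContinuousLinearMap.precomp ℝ (mfderiv 𝓘(ℝ, E) 𝓘(ℝ, E') f p) ∘L g' (f p) ∘L
    mfderiv 𝓘(ℝ, E) 𝓘(ℝ, E') f p

theorem pullback_apply {E' M' : Type*} [NormedAddCommGroup E'] [NormedSpace ℝ E']
    [TopologicalSpace M'] [ChartedSpace E' M'] (f : M → M') (g' : TensorField E' M') (p : M)
    (u v : TangentSpace 𝓘(ℝ, E) p) :
    pullback f g' p u v =
      g' (f p) (mfderiv 𝓘(ℝ, E) 𝓘(ℝ, E') f p u) (mfderiv 𝓘(ℝ, E) 𝓘(ℝ, E') f p v) := rfl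

end Riemannian

/-! ### Hermitian geometry on complex manifolds -/

section Kahler

variable {E : Type*} [NormedAddCommGroup E] [NormedSpace ℝ E] [NormedSpace ℂ E]
  [IsScalarTower ℝ ℂ E] {M : Type*} [TopologicalSpace M] [ChartedSpace E M]

/-- The complex structure of the tangent spaces: multiplication by `i` in holomorphic charts. -/
def complexStructure (p : M) : TangentSpace 𝓘(ℝ, E) p →L[ℝ] TangentSpace 𝓘(ℝ, E) p :=
  ((Complex.I • ContinuousLinearMap.id ℂ E).restrictScalars ℝ : E →L[ℝ] E)

/-- The fundamental form `ω(v, w) = g(i v, w)` in the preferred holomorphic chart at `p`. -/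
def fundamentalForm (g : TensorField E M) (p : M) (y v w : E) : ℝ :=
  coordMetric g p y (Complex.I • v) w

/-- Kähler metrics on a complex manifold: smooth Hermitian metrics whose fundamental form is
closed. -/
structure IsKahler [IsManifold 𝓘(ℂ, E) ω M] [IsManifold 𝓘(ℝ, E) ∞ M] (g : TensorField E M) :
    Prop where
  smooth : IsSmoothMetric g
  hermitian : ∀ (p : M) (u v : TangentSpace 𝓘(ℝ, E) p),
    g p (complexStructure p u) (complexStructure p v) = g p u v
  closed : ∀ (p : M) (u v w : E),
    fderiv ℝ (fun y => fundamentalForm g p y v w) (chartAt E p p) u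
      + fderiv ℝ (fun y => fundamentalForm g p y w u) (chartAt E p p) v
      + fderiv ℝ (fun y => fundamentalForm g p y u v) (chartAt E p p) w = 0

/-- `A` is the connection form at `p`, in the preferred holomorphic chart at `p`, of the Chern
connection of the Hermitian metric `g`: the unique connection that is complex linear, has
`∂̄` as its `(0, 1)`-part (so that `A` is of type `(1, 0)`) and is compatible with the metric. -/
structure IsChernConnection (g : TensorField E M) (p : M) (A : E →L[ℝ] E →L[ℝ] E) : Prop where
  complex_linear : ∀ u v : E, A u (Complex.I • v) = Complex.I • A u v
  type_one_zero : ∀ u v : E, A (Complex.I • u) v = Complex.I • A u v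
  metric : ∀ u v w : E, fderiv ℝ (coordMetric g p) (chartAt E p p) u v w =
    coordMetric g p (chartAt E p p) (A u v) w + coordMetric g p (chartAt E p p) v (A u w)

end Kahler

/-! ### The Fubini-Study metric -/

/-- The horizontal lift at the unit vector `z = σ / ‖σ‖`, where `σ = affineLift i t`, of the tangent
vector with affine coordinates `v`: the component of `slot i v / ‖σ‖` orthogonal to the complex
line of `z`, that is, orthogonal to `z` and `i z`. -/
def horizontalLift {n : ℕ} (i : Fin (n + 1)) (t : Cn n) : Cn n →L[ℝ] Cn (n + 1) :=
  ((‖affineLift i t‖⁻¹ : ℂ) •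
    ((Submodule.span ℂ {affineLift i t})ᗮ.starProjection ∘L slot i)).restrictScalars ℝ

/-- The Fubini-Study metric: the metric for which horizontal lifts are isometric. -/
def fubiniStudy (n : ℕ) : TensorField (Cn n) (CP n) := fun p =>
  ((innerSL ℝ : Cn (n + 1) →L[ℝ] Cn (n + 1) →L[ℝ] ℝ).bilinearComp
    (horizontalLift (chartIndex p) (affineMap (chartIndex p) p))
    (horizontalLift (chartIndex p) (affineMap (chartIndex p) p)) : Cn n →L[ℝ] Cn n →L[ℝ] ℝ)

/-- The projection `z ↦ [z]`, with an arbitrary value at `z = 0`. -/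
def proj (n : ℕ) (z : Cn (n + 1)) : CP n :=
  if h : z = 0 then Projectivization.mk ℂ (affineLift 0 0) (affineLift_ne_zero 0 0)
  else Projectivization.mk ℂ z h

/-- `q : S^{2n+1} → CP^n`, `z ↦ [z]`, is a Riemannian submersion onto `(CP^n, g)`: at each unit
vector `z` its differential maps the space `H_z` of the vectors orthogonal to `z` and `i z`
isometrically onto the tangent space, and vanishes at `i z`. -/
structure IsSubmersionMetric (n : ℕ) (g : TensorField (Cn n) (CP n)) : Prop where
  smooth : ContMDiffOn 𝓘(ℝ, Cn (n + 1)) 𝓘(ℝ, Cn n) ∞ (proj n) {z | z ≠ 0}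
  vertical : ∀ z : Cn (n + 1), ‖z‖ = 1 →
    mfderiv 𝓘(ℝ, Cn (n + 1)) 𝓘(ℝ, Cn n) (proj n) z (Complex.I • z : Cn (n + 1)) = 0
  surjective : ∀ z : Cn (n + 1), ‖z‖ = 1 → ∀ u : TangentSpace 𝓘(ℝ, Cn n) (proj n z),
    ∃ v : Cn (n + 1), inner ℂ z v = 0 ∧ mfderiv 𝓘(ℝ, Cn (n + 1)) 𝓘(ℝ, Cn n) (proj n) z v = u
  isometric : ∀ z : Cn (n + 1), ‖z‖ = 1 → ∀ v w : Cn (n + 1), inner ℂ z v = 0 → inner ℂ z w = 0 →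
    pullback (proj n) g z v w = (inner ℂ v w).re

/-- The round metric of the unit sphere of `ℝ³`, induced by the Euclidean scalar product. -/
def roundMetric : TensorField (EuclideanSpace ℝ (Fin 2))
    (Metric.sphere (0 : EuclideanSpace ℝ (Fin 3)) 1) :=
  pullback (E' := EuclideanSpace ℝ (Fin 3)) (M' := EuclideanSpace ℝ (Fin 3))
    Subtype.val 
    (fun _ => (innerSL ℝ : EuclideanSpace ℝ (Fin 3) →L[ℝ] EuclideanSpace ℝ (Fin 3) →L[ℝ] ℝ))

/-! ### The homogeneous space `SU(n+1) / S(U(1) × U(n))` -/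

/-- The group `SU(n+1)`. -/
abbrev SU (n : ℕ) : Type := Matrix.specialUnitaryGroup (Fin (n + 1)) ℂ

/-- The subgroup `S(U(1) × U(n))` of the block diagonal matrices. -/
def blockSubgroup (n : ℕ) : Subgroup (SU n) where
  carrier := {x | ∀ j : Fin n, x.1 0 j.succ = 0 ∧ x.1 j.succ 0 = 0}
  one_mem' j := by simp [Fin.succ_ne_zero, (Fin.succ_ne_zero _).symm]
  mul_mem' {x y} hx hy j := by
    simp only [Submonoid.coe_mul, Matrix.mul_apply, Fin.sum_univ_succ]
    constructor
    · simp [(hx _).1, (hy _).1]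
    · simp [(hx _).2, (hy _).2]
  inv_mem' {x} hx j := by
    rw [← Matrix.star_eq_inv]
    simp [Matrix.specialUnitaryGroup.coe_star, Matrix.star_apply, (hx _).1, (hx _).2]

/-- The homogeneous space `SU(n+1) / S(U(1) × U(n))`, with the quotient topology. -/
abbrev HomSpace (n : ℕ) : Type := SU n ⧸ blockSubgroup n

/-- The first column `x · m` of `x`, where `m = (1, 0, …, 0)`. -/
def firstColumn {n : ℕ} (x : SU n) : Cn (n + 1) := WithLp.toLp 2 fun k => x.1 k 0

theorem firstColumn_ne_zero {n : ℕ} (x : SU n) : firstColumn x ≠ 0 := by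
  intro h
  have hu : star x.1 * x.1 = 1 := (Matrix.mem_unitaryGroup_iff').1
    (Matrix.mem_specialUnitaryGroup_iff.1 x.2).1
  have h0 : ∀ k, x.1 k 0 = 0 := fun k => by
    have := congrArg (fun v : Cn (n + 1) => v k) h
    simpa [firstColumn] using this
  have := congrFun (congrFun hu 0) 0
  simp [Matrix.mul_apply, h0] at this

theorem mk_firstColumn_mul {n : ℕ} (x h : SU n) (hh : h ∈ blockSubgroup n) :
    Projectivization.mk ℂ (firstColumn (x * h)) (firstColumn_ne_zero _) =
      Projectivization.mk ℂ (firstColumn x) (firstColumn_ne_zero _) := by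
  refine (Projectivization.mk_eq_mk_iff' ℂ _ _ _ _).2 ⟨h.1 0 0, ?_⟩
  ext k
  simp [firstColumn, Matrix.mul_apply, Fin.sum_univ_succ, (hh _).2, mul_comm]

/-- The map `SU(n+1) / S(U(1) × U(n)) → CP^n`, `[x] ↦ [x · m]`. -/
def homMap (n : ℕ) : HomSpace n → CP n :=
  Quotient.lift (fun x : SU n => Projectivization.mk ℂ (firstColumn x) (firstColumn_ne_zero x)) (by
    intro x y hxy
    have h : x⁻¹ * y ∈ blockSubgroup n := QuotientGroup.leftRel_apply.1 hxy
    have := mk_firstColumn_mul x (x⁻¹ * y) h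
    simp only [mul_inv_cancel_left] at this
    exact this.symm)

section Homogeneous

attribute [local instance] Matrix.normedAddCommGroup Matrix.normedSpace

/-- A map from a normed space to `SU(n+1)`, an embedded submanifold of the space of matrices, is
smooth if it is smooth as a matrix valued map. -/
def IsSmoothIntoSU {n : ℕ} {V : Type*} [NormedAddCommGroup V] [NormedSpace ℝ V]
    (γ : V → SU n) : Prop :=
  ContDiff ℝ ∞ (fun s => (γ s : Matrix (Fin (n + 1)) (Fin (n + 1)) ℂ))

end Homogeneous

/-- The given atlas of `SU(n+1) / S(U(1) × U(n))` is the smooth structure of the homogeneous space,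
the one for which the projection `x ↦ [x]` is a smooth submersion. Smoothness of a map on the
embedded submanifold `SU(n+1)` is tested along the smooth maps `ℝᵏ → SU(n+1)`, and the tangent
vectors of `SU(n+1)` are the velocities of its smooth curves. -/
structure IsHomogeneousStructure (n : ℕ) [ChartedSpace (Cn n) (HomSpace n)] : Prop where
  manifold : IsManifold 𝓘(ℝ, Cn n) ∞ (HomSpace n)
  smooth : ∀ (k : ℕ) (γ : EuclideanSpace ℝ (Fin k) → SU n), IsSmoothIntoSU γ →
    ContMDiff 𝓘(ℝ, EuclideanSpace ℝ (Fin k)) 𝓘(ℝ, Cn n) ∞ (fun s => (γ s : HomSpace n))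
  submersion : ∀ (x : SU n) (u : TangentSpace 𝓘(ℝ, Cn n) (x : HomSpace n)),
    ∃ γ : ℝ → SU n, IsSmoothIntoSU γ ∧ γ 0 = x ∧
      (mfderiv 𝓘(ℝ, ℝ) 𝓘(ℝ, Cn n) (fun s => (γ s : HomSpace n)) 0 (1 : ℝ) : Cn n) = u

/-- Invariance under the left translations by `SU(n+1)`. -/
def IsInvariantMetric (n : ℕ) [ChartedSpace (Cn n) (HomSpace n)]
    (h : TensorField (Cn n) (HomSpace n)) : Prop :=
  ∀ a : SU n, pullback (fun c : HomSpace n => a • c) h = h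

end FubiniStudy

end

open FubiniStudy

/-!
All of the geometry is carried by the degenerate Hermitian form
`(|z|² ⟨v, w⟩ - ⟨v, z⟩ ⟨z, w⟩) / |z|⁴` on `ℂⁿ⁺¹ ∖ {0}`: it is invariant under rescaling of `z` and
`v`, `w` together, on the sphere it is the inner product of horizontal components, and in an affine
chart it becomes the Hermitian form of the Fubini-Study metric.

In a chart the Christoffel symbols of the Chern connection, `-(⟨t, u⟩ v + ⟨t, v⟩ u) / (1 + |t|²)`,
are symmetric and compatible with the metric, so they are those of the Levi-Civita connection; the
metric is therefore Kähler, and differentiating them once more expresses the curvature tensor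
through the Hermitian form alone. Tracing it gives `Ric = 2 (n + 1) g`, and its values on a plane
give the sectional curvatures. A conformal change of metric only rescales `⟨R(u, v) w, z⟩` when
`w ⊥ z` and both are orthogonal to `u` and `v`, and for `n ≥ 2` there are unit vectors with `w`
orthogonal to `u` and `Ju`, for which `⟨R(u, Ju) w, Jw⟩ = -2`; hence the metric is not locally
conformally flat.

The Hopf map `h : ℂ² ∖ {0} → S²` satisfies `⟨h z, h w⟩ = 2 |⟨z, w⟩|² / (|z|² |w|²) - 1`. This
determines the distances `|h z - h w|`, so in the limit `w → z` the induced map on the projective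
line multiplies the metric by `4`, and the inverse function theorem makes it a diffeomorphism.

A product of two reflections moves the first basis vector to a nearby unit vector smoothly, which
provides local sections of `SU(n+1) → CPⁿ` and hence the diffeomorphism with the homogeneous space.
Since `SU(n+1)` acts transitively on pairs consisting of a point and a Fubini-Study unit vector at
it, an invariant metric is determined by its value on a single vector.
-/

namespace FubiniStudy

open Filter Topology

/-! ### Bilinear forms on normed spaces -/

section BilinearForms

variable {E : Type*} [NormedAddCommGroup E] [NormedSpace ℝ E] {A B : E →L[ℝ] E →L[ℝ] ℝ}

theorem eq_of_symm_of_apply_self_eq (hA : ∀ u v, A u v = A v u) (hB : ∀ u v, B u v = B v u)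
    (h : ∀ u, A u u = B u u) : A = B := by
  ext u v
  have hadd := h (u + v)
  simp only [map_add, add_apply] at hadd
  linarith [h u, h v, hA u v, hB u v]

theorem apply_self_eq_mul_of_unit (hB : ∀ u, u ≠ 0 → 0 < B u u) {m : ℝ}
    (h : ∀ u, B u u = 1 → A u u = m) (u : E) : A u u = m * B u u := by
  rcases eq_or_ne u 0 with rfl | hu
  · simp
  · set s := √(B u u)
    have hs0 : s ≠ 0 := (Real.sqrt_pos.2 (hB u hu)).ne'
    have hs : s ^ 2 = B u u := Real.sq_sqrt (hB u hu).le
    have hunit := h (s⁻¹ • u)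
    simp only [map_smul, smul_apply, smul_eq_mul, ← hs] at hunit
    rw [← hs, ← hunit (by field_simp)]
    field_simp

variable [FiniteDimensional ℝ E]

theorem isCoercive_of_pos (hB : ∀ u, u ≠ 0 → 0 < B u u) : IsCoercive B := by
  have : ProperSpace E := FiniteDimensional.proper ℝ E
  rcases subsingleton_or_nontrivial E with _ | _
  · exact ⟨1, one_pos, fun u => by simp [Subsingleton.elim u 0]⟩
  obtain ⟨m, hm, hmin⟩ := (isCompact_sphere (0 : E) 1).exists_isMinOn
    (NormedSpace.sphere_nonempty.2 zero_le_one) (f := fun v => B v v) (by fun_prop)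
  refine ⟨B m m, hB m (ne_zero_of_mem_unit_sphere ⟨m, hm⟩), fun u => ?_⟩
  rcases eq_or_ne u 0 with rfl | hu
  · simp
  have hu' : 0 < ‖u‖ := norm_pos_iff.2 hu
  have hle : B m m ≤ B (‖u‖⁻¹ • u) (‖u‖⁻¹ • u) := hmin (by simp [norm_smul, hu'.ne'])
  simp only [map_smul, smul_apply, smul_eq_mul] at hle
  calc B m m * ‖u‖ * ‖u‖ ≤ ‖u‖⁻¹ * (‖u‖⁻¹ * B u u) * ‖u‖ * ‖u‖ := by gcongr
    _ = B u u := by field_simp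

theorem isVonNBounded_setOf_apply_self_lt_one (hB : ∀ u, u ≠ 0 → 0 < B u u) :
    Bornology.IsVonNBounded ℝ {u : E | B u u < 1} := by
  obtain ⟨c, hc, hcB⟩ := isCoercive_of_pos hB
  refine (NormedSpace.isVonNBounded_iff' ℝ).2 ⟨√(1 / c), fun u (hu : B u u < 1) => ?_⟩
  refine Real.le_sqrt_of_sq_le ((le_div_iff₀ hc).2 ?_)
  linarith [hcB u]

theorem isInvertible_of_pos (hB : ∀ u, u ≠ 0 → 0 < B u u) : B.IsInvertible := by
  have hinj : Function.Injective (B : E →ₗ[ℝ] E →L[ℝ] ℝ) := by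
    rw [injective_iff_map_eq_zero]
    intro u (hu : B u = 0)
    by_contra hu0
    exact (hB u hu0).ne' (by simp [hu])
  have hrank : Module.finrank ℝ E = Module.finrank ℝ (E →L[ℝ] ℝ) := by
    rw [← (LinearMap.toContinuousLinearMap (𝕜 := ℝ) (E := E) (F' := ℝ)).finrank_eq]
    exact (Subspace.dual_finrank_eq (K := ℝ) (V := E)).symm
  exact ⟨(LinearEquiv.ofInjectiveOfFinrankEq _ hinj hrank).toContinuousLinearEquiv, rfl⟩

end BilinearForms

/-! ### Inverse function theorem and transport of atlases -/

section InverseFunctionTheorem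

variable {𝕜 : Type*} [RCLike 𝕜] {E E' : Type*} [NormedAddCommGroup E] [NormedSpace 𝕜 E]
  [NormedAddCommGroup E'] [NormedSpace 𝕜 E'] {m : WithTop ℕ∞}

theorem exists_contDiffAt_rightInverse [CompleteSpace E] [CompleteSpace E'] {f : E → E'} {x : E}
    (hf : ContDiffAt 𝕜 m f x) (hm : m ≠ 0) (hbij : Function.Bijective (fderiv 𝕜 f x)) :
    ∃ g : E' → E, ContDiffAt 𝕜 m g (f x) ∧ g (f x) = x ∧ ∀ᶠ y in 𝓝 (f x), f (g y) = y := by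
  let f' : E ≃L[𝕜] E' := ContinuousLinearEquiv.ofBijective (fderiv 𝕜 f x)
    (LinearMap.ker_eq_bot.2 hbij.1) (LinearMap.range_eq_top.2 hbij.2)
  have hf' : HasFDerivAt f (f' : E →L[𝕜] E') x := (hf.differentiableAt hm).hasFDerivAt
  exact ⟨hf.localInverse hf' hm, hf.to_localInverse hf' hm, hf.localInverse_apply_image hf' hm,
    (hf.hasStrictFDerivAt' hf' hm).eventually_right_inverse⟩

variable {M N : Type*} [TopologicalSpace M] [ChartedSpace E M] [TopologicalSpace N]
  [ChartedSpace E' N] {f : M → N} {x : M}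

theorem hasMFDerivAt_iff_hasFDerivAt_chart {f' : E →L[𝕜] E'} :
    HasMFDerivAt 𝓘(𝕜, E) 𝓘(𝕜, E') f x f' ↔ ContinuousAt f x ∧
      HasFDerivAt (fun y => chartAt E' (f x) (f ((chartAt E x).symm y))) f' (chartAt E x x) := by
  have h : HasMFDerivAt 𝓘(𝕜, E) 𝓘(𝕜, E') f x f' ↔ ContinuousAt f x ∧
      HasFDerivWithinAt (fun y => chartAt E' (f x) (f ((chartAt E x).symm y))) f'
        (Set.range (id : E → E)) (chartAt E x x) := Iff.rfl
  rw [h, Set.range_id, hasFDerivWithinAt_univ]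

theorem exists_contMDiffAt_rightInverse [CompleteSpace E] [CompleteSpace E']
    [IsManifold 𝓘(𝕜, E) m M] (hf : ContMDiffAt 𝓘(𝕜, E) 𝓘(𝕜, E') m f x) (hm : m ≠ 0)
    (hbij : Function.Bijective (mfderiv 𝓘(𝕜, E) 𝓘(𝕜, E') f x)) :
    ∃ g : N → M, ContMDiffAt 𝓘(𝕜, E') 𝓘(𝕜, E) m g (f x) ∧ g (f x) = x ∧
      ∀ᶠ y in 𝓝 (f x), f (g y) = y := by
  set φ := extChartAt 𝓘(𝕜, E) x
  set ψ := extChartAt 𝓘(𝕜, E') (f x)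
  set F : E → E' := writtenInExtChartAt 𝓘(𝕜, E) 𝓘(𝕜, E') x f
  have hFx : F (φ x) = ψ (f x) := by simp [F, writtenInExtChartAt, φ, ψ]
  have hF : ContDiffAt 𝕜 m F (φ x) := by
    have h : ContDiffWithinAt 𝕜 m F (Set.range (id : E → E)) (φ x) := (contMDiffAt_iff.1 hf).2
    rwa [Set.range_id, contDiffWithinAt_univ] at h
  let f' : E →L[𝕜] E' := mfderiv 𝓘(𝕜, E) 𝓘(𝕜, E') f x
  have hf' : Function.Bijective f' := hbij
  have hF' : HasFDerivAt F f' (φ x) :=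
    (hasMFDerivAt_iff_hasFDerivAt_chart.1 (hf.mdifferentiableAt hm).hasMFDerivAt).2
  obtain ⟨L, hL, hLx, hFL⟩ := exists_contDiffAt_rightInverse hF hm (by rwa [hF'.fderiv])
  rw [hFx] at hL hLx hFL
  have hψ : ContMDiffAt 𝓘(𝕜, E') 𝓘(𝕜, E') m ψ (f x) := contMDiffAt_extChartAt
  have hφ : ContMDiffAt 𝓘(𝕜, E) 𝓘(𝕜, E) m φ.symm (L (ψ (f x))) := by
    rw [hLx]
    exact (contMDiffOn_extChartAt_symm x).contMDiffAt (extChartAt_target_mem_nhds x)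
  have hg : ContMDiffAt 𝓘(𝕜, E') 𝓘(𝕜, E) m (fun y => φ.symm (L (ψ y))) (f x) :=
    hφ.comp (f x) (hL.contMDiffAt.comp (f x) hψ)
  have hgx : φ.symm (L (ψ (f x))) = x := by rw [hLx]; exact extChartAt_to_inv x
  have hfg : ContinuousAt (fun y => f (φ.symm (L (ψ y)))) (f x) :=
    ContinuousAt.comp (g := f) (by rw [hgx]; exact hf.continuousAt) hg.continuousAt
  have hmem : ∀ᶠ y in 𝓝 (f x), f (φ.symm (L (ψ y))) ∈ ψ.source :=
    hfg.eventually_mem (by rw [hgx]; exact extChartAt_source_mem_nhds _)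
  refine ⟨_, hg, hgx, ?_⟩
  filter_upwards [hmem, extChartAt_source_mem_nhds (I := 𝓘(𝕜, E')) (f x),
    hψ.continuousAt.eventually hFL] with y hfgy hy hFLy
  exact ψ.injOn hfgy hy hFLy

theorem exists_diffeomorph_of_bijective [CompleteSpace E] [CompleteSpace E']
    [IsManifold 𝓘(𝕜, E) m M] (hf : ContMDiff 𝓘(𝕜, E) 𝓘(𝕜, E') m f) (hm : m ≠ 0)
    (hb : Function.Bijective f)
    (hbij : ∀ x, Function.Bijective (mfderiv 𝓘(𝕜, E) 𝓘(𝕜, E') f x)) :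
    ∃ Φ : Diffeomorph 𝓘(𝕜, E) 𝓘(𝕜, E') M N m, ⇑Φ = f := by
  refine ⟨⟨Equiv.ofBijective f hb, hf, fun y => ?_⟩, rfl⟩
  obtain ⟨x, rfl⟩ := hb.2 y
  obtain ⟨g, hg, -, hfg⟩ := exists_contMDiffAt_rightInverse (hf x) hm (hbij x)
  refine hg.congr_of_eventuallyEq ?_
  filter_upwards [hfg] with y hy
  exact (Equiv.ofBijective f hb).symm_apply_eq.2 hy.symm

end InverseFunctionTheorem

section TransportCharts

variable {E M N : Type*} [NormedAddCommGroup E] [TopologicalSpace M] [TopologicalSpace N]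
  [ChartedSpace E N]

/-- The atlas transported from `N` to `M` along a homeomorphism `Ψ : M ≃ₜ N`, for which `Ψ` becomes
a diffeomorphism. -/
abbrev transportCharts (Ψ : M ≃ₜ N) : ChartedSpace E M where
  atlas := (fun e => Ψ.toOpenPartialHomeomorph.trans e) '' atlas E N
  chartAt p := Ψ.toOpenPartialHomeomorph.trans (chartAt E (Ψ p))
  mem_chart_source p := by simp
  chart_mem_atlas p := Set.mem_image_of_mem _ (chart_mem_atlas E (Ψ p))

theorem transportCharts_chartAt_symm_apply (Ψ : M ≃ₜ N) (q : N) :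
    (transportCharts Ψ).chartAt (Ψ.symm q) =
      Ψ.toOpenPartialHomeomorph.trans (chartAt E q) := by
  change Ψ.toOpenPartialHomeomorph.trans (chartAt E (Ψ (Ψ.symm q))) = _
  rw [Ψ.apply_symm_apply]

variable {𝕜 : Type*} [NontriviallyNormedField 𝕜] [NormedSpace 𝕜 E] {m : WithTop ℕ∞}

theorem isManifold_transportCharts [IsManifold 𝓘(𝕜, E) m N] (Ψ : M ≃ₜ N) :
    @IsManifold 𝕜 _ E _ _ E _ 𝓘(𝕜, E) m M _ (transportCharts Ψ) := by
  let _ := transportCharts (E := E) Ψ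
  refine isManifold_of_contDiffOn 𝓘(𝕜, E) m M ?_
  rintro _ _ ⟨e, he, rfl⟩ ⟨e', he', rfl⟩
  have h := (contDiffGroupoid m 𝓘(𝕜, E)).compatible he he'
  rw [contDiffGroupoid, mem_groupoid_of_pregroupoid] at h
  replace h : ContDiffOn 𝕜 m _ _ := h.1
  refine h.congr_mono (fun y _ => ?_) fun y hy => ?_
  · simp
  · simpa using hy

theorem contMDiff_symm_transportCharts (Ψ : M ≃ₜ N) :
    @ContMDiff 𝕜 _ E _ _ E _ 𝓘(𝕜, E) N _ _ E _ _ E _ 𝓘(𝕜, E) M _ (transportCharts Ψ) m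
      Ψ.symm := by
  let _ := transportCharts (E := E) Ψ
  intro q
  refine contMDiffAt_iff_target.2 ⟨Ψ.symm.continuous.continuousAt, ?_⟩
  have h : (extChartAt 𝓘(𝕜, E) (Ψ.symm q) ∘ Ψ.symm : N → E) = extChartAt 𝓘(𝕜, E) q := by
    ext y
    change chartAt E (Ψ.symm q) (Ψ.symm y) = chartAt E q y
    rw [show chartAt E (Ψ.symm q) = _ from transportCharts_chartAt_symm_apply Ψ q]
    simp
  rw [h]
  exact contMDiffAt_extChartAt

theorem hasMFDerivAt_symm_transportCharts (Ψ : M ≃ₜ N) (q : N) :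
    @HasMFDerivAt 𝕜 _ E _ _ E _ 𝓘(𝕜, E) N _ _ E _ _ E _ 𝓘(𝕜, E) M _ (transportCharts Ψ)
      Ψ.symm q (ContinuousLinearMap.id 𝕜 E) := by
  let _ := transportCharts (E := E) Ψ
  have h : (fun y => chartAt E (Ψ.symm q) (Ψ.symm ((chartAt E q).symm y)))
      =ᶠ[𝓝 (chartAt E q q)] id := by
    filter_upwards [(chartAt E q).open_target.mem_nhds (mem_chart_target E q)] with y hy
    rw [show chartAt E (Ψ.symm q) = _ from transportCharts_chartAt_symm_apply Ψ q]
    simp [hy]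
  refine ⟨Ψ.symm.continuous.continuousAt, ?_⟩
  exact ((hasFDerivAt_id _).congr_of_eventuallyEq h).hasFDerivWithinAt

end TransportCharts

/-! ### Smooth metrics and pull-backs -/

section Charts

variable {H H' M N : Type*} [TopologicalSpace H] [TopologicalSpace H'] [TopologicalSpace M]
  [ChartedSpace H M] [TopologicalSpace N] [ChartedSpace H' N]

theorem eventually_mem_chart_target_and_mem_chart_source {f : M → N} {p : M}
    (hf : ContinuousAt f p) : ∀ᶠ y in 𝓝 (chartAt H p p),
      y ∈ (chartAt H p).target ∧ f ((chartAt H p).symm y) ∈ (chartAt H' (f p)).source := by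
  refine Eventually.and ((chartAt H p).open_target.mem_nhds (mem_chart_target H p)) ?_
  have hp : (chartAt H p).symm (chartAt H p p) = p := (chartAt H p).left_inv (mem_chart_source H p)
  have hcont : ContinuousAt (fun y => f ((chartAt H p).symm y)) (chartAt H p p) :=
    ContinuousAt.comp (by rwa [hp])
      ((chartAt H p).symm.continuousAt (mem_chart_target H p))
  exact hcont.eventually_mem (by rw [hp]; exact chart_source_mem_nhds H' (f p))

end Charts

section Metrics

variable {E E' E'' : Type*} [NormedAddCommGroup E] [NormedSpace ℝ E] [NormedAddCommGroup E']
  [NormedSpace ℝ E'] [NormedAddCommGroup E''] [NormedSpace ℝ E''] {M N P : Type*}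
  [TopologicalSpace M] [ChartedSpace E M] [TopologicalSpace N] [ChartedSpace E' N]
  [TopologicalSpace P] [ChartedSpace E'' P]

theorem tangentCoordinates_eq_coordMetric [IsManifold 𝓘(ℝ, E) ∞ M] (g : TensorField E M) (p : M)
    {q : M} (hq : q ∈ (chartAt E p).source) :
    (trivializationAt (E →L[ℝ] E →L[ℝ] ℝ) (fun p : M =>
      TangentSpace 𝓘(ℝ, E) p →L[ℝ] TangentSpace 𝓘(ℝ, E) p →L[ℝ] ℝ) p ⟨q, g q⟩).2 =
        coordMetric g p (chartAt E p q) := by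
  ext u v
  have hsymm : ∀ u, (trivializationAt E (TangentSpace 𝓘(ℝ, E)) p).symm q u =
      (trivializationAt E (TangentSpace 𝓘(ℝ, E)) p).symmL ℝ q u := fun u =>
    (Bundle.Trivialization.symmL_apply _ (by simpa using hq) u).symm
  have hcast : ∀ q' : M, q' = q → ∀ a b : E,
      (g q' : E →L[ℝ] E →L[ℝ] ℝ) a b = (g q : E →L[ℝ] E →L[ℝ] ℝ) a b := by
    rintro _ rfl a b
    rfl
  rw [hom_trivializationAt_apply,
    inCoordinates_apply_eq₂ (by simpa using hq) (by simpa using hq) (by simp)]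
  simp only [hsymm, TangentBundle.symmL_trivializationAt (I := 𝓘(ℝ, E)) (x₀ := p) (x := q) hq]
  simp only [mfld_simps, mfderivWithin_univ, Bundle.Trivial.linearMapAt_trivialization,
    Bundle.Trivial.fiberBundle_trivializationAt', LinearMap.id_coe, id]
  exact (hcast _ ((chartAt E p).left_inv hq) _ _).symm

theorem isSmoothMetric_of_coordMetric [FiniteDimensional ℝ E] [IsManifold 𝓘(ℝ, E) ∞ M]
    (g : TensorField E M) (hsymm : ∀ p u v, g p u v = g p v u)
    (hpos : ∀ p u, u ≠ 0 → 0 < g p u u)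
    (hsmooth : ∀ p, ContDiffAt ℝ ∞ (coordMetric g p) (chartAt E p p)) : IsSmoothMetric g := by
  refine ⟨⟨g, hsymm, hpos,
    fun p => isVonNBounded_setOf_apply_self_lt_one (E := E) (B := g p) (hpos p),
    fun p => ?_⟩, rfl⟩
  rw [Bundle.contMDiffAt_section]
  have h : ContMDiffAt 𝓘(ℝ, E) 𝓘(ℝ, E →L[ℝ] E →L[ℝ] ℝ) ∞ (coordMetric g p ∘ chartAt E p) p :=
    (hsmooth p).contMDiffAt.comp p (contMDiffAt_of_mem_maximalAtlas
      (IsManifold.chart_mem_maximalAtlas p) (mem_chart_source E p))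
  refine h.congr_of_eventuallyEq ?_
  filter_upwards [(chartAt E p).open_source.mem_nhds (mem_chart_source E p)] with q hq
  exact tangentCoordinates_eq_coordMetric g p hq

theorem pullback_apply_of_hasMFDerivAt {f : M → N} {x : M} {f' : E →L[ℝ] E'}
    (hf : HasMFDerivAt 𝓘(ℝ, E) 𝓘(ℝ, E') f x f') (g : TensorField E' N) (u v : E) :
    (pullback f g x : E →L[ℝ] E →L[ℝ] ℝ) u v = (g (f x) : E' →L[ℝ] E' →L[ℝ] ℝ) (f' u) (f' v) := by
  have h : (mfderiv 𝓘(ℝ, E) 𝓘(ℝ, E') f x : E →L[ℝ] E') = f' := hf.mfderiv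
  rw [← h]
  rfl

theorem pullback_congr_of_eventuallyEq {f k : M → N} {x : M} (h : f =ᶠ[𝓝 x] k)
    (g : TensorField E' N) : pullback (E := E) f g x = pullback k g x := by
  rw [pullback, pullback, h.mfderiv_eq, h.eq_of_nhds]

theorem pullback_comp_apply {f : M → N} {k : N → P} {x : M}
    (hk : MDifferentiableAt 𝓘(ℝ, E') 𝓘(ℝ, E'') k (f x))
    (hf : MDifferentiableAt 𝓘(ℝ, E) 𝓘(ℝ, E') f x) (g : TensorField E'' P) :
    pullback (E := E) (k ∘ f) g x = pullback f (pullback (E := E') k g) x := by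
  rw [pullback, mfderiv_comp x hk hf]
  rfl

theorem pullback_comp {f : M → N} {k : N → P}
    (hk : MDifferentiable 𝓘(ℝ, E') 𝓘(ℝ, E'') k) (hf : MDifferentiable 𝓘(ℝ, E) 𝓘(ℝ, E') f)
    (g : TensorField E'' P) : pullback (E := E) (k ∘ f) g = pullback f (pullback (E := E') k g) :=
  funext fun x => pullback_comp_apply (hk (f x)) (hf x) g

theorem contDiffAt_pullback {φ : E → E'} {G : E' → E' →L[ℝ] E' →L[ℝ] ℝ} {y : E}
    (hφ : ContDiffAt ℝ ∞ φ y) (hG : ContDiffAt ℝ ∞ G (φ y)) :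
    ContDiffAt ℝ ∞ (F := E →L[ℝ] E →L[ℝ] ℝ) (pullback φ (G : TensorField E' E')) y := by
  have heq : pullback (E := E) φ (G : TensorField E' E') =
      fun y => ContinuousLinearMap.precomp ℝ (fderiv ℝ φ y) ∘L G (φ y) ∘L fderiv ℝ φ y := by
    ext1 y
    exact congrArg (fun D : E →L[ℝ] E' => ContinuousLinearMap.precomp ℝ D ∘L G (φ y) ∘L D)
      mfderiv_eq_fderiv
  have hφ' : ContDiffAt ℝ ∞ (fderiv ℝ φ) y := hφ.fderiv_right (by simp)
  rw [heq]
  exact ((ContinuousLinearMap.compL ℝ E E' ℝ).flip.contDiff.contDiffAt.comp y hφ').clm_comp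
    ((hG.comp y hφ).clm_comp hφ')

variable [IsManifold 𝓘(ℝ, E) ∞ M] [IsManifold 𝓘(ℝ, E') ∞ N]

theorem contMDiffAt_chartAt_symm {p : M} {y : E} (hy : y ∈ (chartAt E p).target) :
    ContMDiffAt 𝓘(ℝ, E) 𝓘(ℝ, E) ∞ (chartAt E p).symm y :=
  contMDiffOn_chart_symm.contMDiffAt ((chartAt E p).open_target.mem_nhds hy)

theorem contMDiffAt_chartAt {p q : M} (hq : q ∈ (chartAt E p).source) :
    ContMDiffAt 𝓘(ℝ, E) 𝓘(ℝ, E) ∞ (chartAt E p) q :=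
  contMDiffOn_chart.contMDiffAt ((chartAt E p).open_source.mem_nhds hq)

theorem contDiffAt_chart_comp_chart_symm {f : M → N} (hf : ContMDiff 𝓘(ℝ, E) 𝓘(ℝ, E') ∞ f) {p : M}
    {y : E} (hy : y ∈ (chartAt E p).target)
    (hfy : f ((chartAt E p).symm y) ∈ (chartAt E' (f p)).source) :
    ContDiffAt ℝ ∞ (fun y => chartAt E' (f p) (f ((chartAt E p).symm y))) y :=
  ((contMDiffAt_chartAt hfy).comp y ((hf _).comp y (contMDiffAt_chartAt_symm hy))).contDiffAt

theorem coordMetric_pullback_eventuallyEq {f : M → N} (hf : ContMDiff 𝓘(ℝ, E) 𝓘(ℝ, E') ∞ f)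
    (g : TensorField E' N) (p : M) : coordMetric (pullback f g) p =ᶠ[𝓝 (chartAt E p p)]
      pullback (fun y => chartAt E' (f p) (f ((chartAt E p).symm y)))
        (coordMetric g (f p) : TensorField E' E') := by
  filter_upwards [(eventually_mem_chart_target_and_mem_chart_source (H' := E')
    hf.continuous.continuousAt).eventually_nhds] with y hy
  obtain ⟨hyt, hys⟩ := hy.self_of_nhds
  have hchart : f ∘ (chartAt E p).symm =ᶠ[𝓝 y]
      (chartAt E' (f p)).symm ∘ fun y => chartAt E' (f p) (f ((chartAt E p).symm y)) := by
    filter_upwards [hy] with t ht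
    exact ((chartAt E' (f p)).left_inv ht.2).symm
  have hpullback :
      coordMetric (pullback f g) p y = pullback (E := E) (f ∘ (chartAt E p).symm) g y :=
    (pullback_comp_apply ((hf _).mdifferentiableAt (by simp))
      ((contMDiffAt_chartAt_symm hyt).mdifferentiableAt (by simp)) g).symm
  rw [hpullback, pullback_congr_of_eventuallyEq hchart]
  exact pullback_comp_apply (f := fun y => chartAt E' (f p) (f ((chartAt E p).symm y)))
    (k := (chartAt E' (f p)).symm)
    ((contMDiffAt_chartAt_symm ((chartAt E' (f p)).map_source hys)).mdifferentiableAt (by simp))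
    ((contDiffAt_chart_comp_chart_symm hf hyt hys).contMDiffAt.mdifferentiableAt (by simp)) g

theorem contDiffAt_coordMetric_pullback {f : M → N} (hf : ContMDiff 𝓘(ℝ, E) 𝓘(ℝ, E') ∞ f)
    {g : TensorField E' N} {p : M}
    (hg : ContDiffAt ℝ ∞ (coordMetric g (f p)) (chartAt E' (f p) (f p))) :
    ContDiffAt ℝ ∞ (coordMetric (pullback f g) p) (chartAt E p p) := by
  have hp : (chartAt E p).symm (chartAt E p p) = p := (chartAt E p).left_inv (mem_chart_source E p)
  refine ContDiffAt.congr_of_eventuallyEq ?_ (coordMetric_pullback_eventuallyEq hf g p)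
  exact contDiffAt_pullback (contDiffAt_chart_comp_chart_symm hf (mem_chart_target E p)
    (by rw [hp]; exact mem_chart_source E' (f p))) (by rwa [hp])

end Metrics

/-! ### The Levi-Civita connection in coordinates -/

section Christoffel

variable {E : Type*} [NormedAddCommGroup E] [NormedSpace ℝ E] {G : E → E →L[ℝ] E →L[ℝ] ℝ}
  {y : E}

theorem fderiv_clm_apply_const {V F F' : Type*} [NormedAddCommGroup V] [NormedSpace ℝ V]
    [NormedAddCommGroup F] [NormedSpace ℝ F] [NormedAddCommGroup F'] [NormedSpace ℝ F']
    {L : V → F →L[ℝ] F'} {x : V} (hL : DifferentiableAt ℝ L x) (u : V) (v : F) :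
    fderiv ℝ L x u v = fderiv ℝ (fun x => L x v) x u := by
  simp [fderiv_clm_apply hL (differentiableAt_const v)]

theorem christoffel_eq_of_koszul {u v x : E} (hG : (G y).IsInvertible)
    (h : ∀ w, G y x w = koszul G y u v w) : christoffel G y u v = x := by
  rw [christoffel_apply, hG.inverse_apply_eq]
  ext w
  exact (h w).symm

theorem christoffel_eq_of_compatible (hG : (G y).IsInvertible) (hsymm : ∀ u v, G y u v = G y v u)
    {Γ : E → E → E} (hΓ : ∀ u v, Γ u v = Γ v u)
    (hcompat : ∀ u v w, fderiv ℝ G y u v w = G y (Γ u v) w + G y v (Γ u w)) (u v : E) :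
    christoffel G y u v = Γ u v := by
  refine christoffel_eq_of_koszul hG fun w => ?_
  rw [koszul_apply, hcompat, hcompat, hcompat, hΓ v u, hΓ w u, hΓ w v, hsymm v (Γ u w),
    hsymm u (Γ v w)]
  ring

theorem contDiffAt_koszul (hG : ContDiffAt ℝ ∞ G y) : ContDiffAt ℝ ∞ (koszul G) y := by
  have hD : ContDiffAt ℝ ∞ (fderiv ℝ G) y := hG.fderiv_right (m := ∞) (by simp)
  have hflip : ContDiffAt ℝ ∞ (fun x => (fderiv ℝ G x).flip) y :=
    (ContinuousLinearMap.flipₗᵢ ℝ E E (E →L[ℝ] ℝ)).contDiff.contDiffAt.comp y hD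
  exact ((hD.add hflip).sub (contDiffAt_const.clm_comp hflip)).const_smul (1 / 2 : ℝ)

theorem contDiffAt_inverse [CompleteSpace E] (hG : ContDiffAt ℝ ∞ G y)
    (hinv : (G y).IsInvertible) : ContDiffAt ℝ ∞ (fun x => (G x).inverse) y := by
  obtain ⟨e, he⟩ := hinv
  have hmap := contDiffAt_map_inverse (𝕜 := ℝ) (n := ∞) e
  rw [he] at hmap
  exact hmap.comp y hG

theorem contDiffAt_christoffel [CompleteSpace E] (hG : ContDiffAt ℝ ∞ G y)
    (hinv : (G y).IsInvertible) : ContDiffAt ℝ ∞ (christoffel G) y :=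
  ((ContinuousLinearMap.compL ℝ E (E →L[ℝ] ℝ) E).contDiff.contDiffAt.comp y
    (contDiffAt_inverse hG hinv)).clm_comp (contDiffAt_koszul hG)

end Christoffel

/-! ### The Hermitian form of the Fubini-Study metric -/

section HermitianForms

variable {H : Type*} [NormedAddCommGroup H] [InnerProductSpace ℂ H]

/-- The degenerate Hermitian form on `H ∖ {0}` whose real part is the pull-back of the Fubini-Study
metric along the projection `z ↦ [z]`, conjugate linear in the first vector. -/
noncomputable def hermForm (z v w : H) : ℂ :=
  inner ℂ v w / (‖z‖ : ℂ) ^ 2 - inner ℂ v z * inner ℂ z w / (‖z‖ : ℂ) ^ 4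

/-- The factor `1 / (1 + |t|²)`, as a complex number since it mostly multiplies Hermitian
products. -/
noncomputable def conformalFactor (t : H) : ℂ := (1 + inner ℂ t t)⁻¹

/-- The Hermitian form `((1 + |t|²) ⟨u, v⟩ - ⟨u, t⟩ ⟨t, v⟩) / (1 + |t|²)²`, whose real part is the
Fubini-Study metric in an affine chart. -/
noncomputable def coordHerm (t u v : H) : ℂ :=
  conformalFactor t * inner ℂ u v - conformalFactor t ^ 2 * (inner ℂ u t * inner ℂ t v)

/-- The Christoffel symbols `-(⟨t, u⟩ v + ⟨t, v⟩ u) / (1 + |t|²)` of the Chern connection of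
`coordHerm`. -/
noncomputable def chernGamma (t u v : H) : H :=
  (-conformalFactor t) • (inner ℂ t u • v + inner ℂ t v • u)

theorem inner_self_complex (z : H) : inner ℂ z z = (‖z‖ : ℂ) ^ 2 :=
  inner_self_eq_norm_sq_to_K z

theorem norm_complex_ne_zero {F : Type*} [NormedAddCommGroup F] {z : F} (hz : z ≠ 0) :
    (‖z‖ : ℂ) ≠ 0 :=
  Complex.ofReal_ne_zero.2 (norm_ne_zero_iff.2 hz)

theorem hermForm_smul_add {z : H} (hz : z ≠ 0) {c : ℂ} (hc : c ≠ 0) (a b : ℂ) (v w : H) :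
    hermForm (c • z) (c • v + a • z) (c • w + b • z) = hermForm z v w := by
  have hz' := norm_complex_ne_zero hz
  have hc' : (starRingEnd ℂ) c ≠ 0 := by simpa using hc
  have hnorm_sq : ((‖c‖ : ℝ) : ℂ) ^ 2 = c * (starRingEnd ℂ) c := (Complex.mul_conj' c).symm
  have hnorm_four : ((‖c‖ : ℝ) : ℂ) ^ 4 = (c * (starRingEnd ℂ) c) ^ 2 := by rw [← hnorm_sq]; ring
  simp only [hermForm, inner_add_left, inner_add_right, inner_smul_left, inner_smul_right,
    norm_smul, inner_self_complex, Complex.ofReal_mul, mul_pow, hnorm_sq, hnorm_four]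
  field_simp
  ring

theorem hermForm_of_norm_eq_one {z v w : H} (hz : ‖z‖ = 1) (hw : inner ℂ z w = 0) :
    hermForm z v w = inner ℂ v w := by
  simp [hermForm, hz, hw]

theorem one_add_inner_self (t : H) : (1 : ℂ) + inner ℂ t t = ((1 + ‖t‖ ^ 2 : ℝ) : ℂ) := by
  rw [inner_self_complex]
  push_cast
  ring

theorem one_add_inner_self_ne_zero (t : H) : (1 : ℂ) + inner ℂ t t ≠ 0 := by
  rw [one_add_inner_self]
  exact Complex.ofReal_ne_zero.2 (by positivity)

theorem conformalFactor_eq (t : H) : conformalFactor t = (((1 + ‖t‖ ^ 2)⁻¹ : ℝ) : ℂ) := by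
  rw [conformalFactor, one_add_inner_self]
  push_cast
  rfl

theorem conj_conformalFactor (t : H) :
    (starRingEnd ℂ) (conformalFactor t) = conformalFactor t := by
  rw [conformalFactor_eq, Complex.conj_ofReal]

theorem coordHerm_conj (t u v : H) : (starRingEnd ℂ) (coordHerm t u v) = coordHerm t v u := by
  simp only [coordHerm, map_sub, map_mul, map_pow, conj_conformalFactor, inner_conj_symm]
  ring

theorem coordHerm_re_comm (t u v : H) : (coordHerm t u v).re = (coordHerm t v u).re := by
  rw [← coordHerm_conj, Complex.conj_re]

theorem coordHerm_im_comm (t u v : H) : (coordHerm t u v).im = -(coordHerm t v u).im := by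
  rw [← coordHerm_conj, Complex.conj_im]

theorem coordHerm_self (t u : H) : coordHerm t u u = ((coordHerm t u u).re : ℂ) :=
  (Complex.conj_eq_iff_re.1 (coordHerm_conj t u u)).symm

theorem coordHerm_add_left (t u u' v : H) :
    coordHerm t (u + u') v = coordHerm t u v + coordHerm t u' v := by
  simp only [coordHerm, inner_add_left]
  ring

theorem coordHerm_add_right (t u v v' : H) :
    coordHerm t u (v + v') = coordHerm t u v + coordHerm t u v' := by
  simp only [coordHerm, inner_add_right]
  ring

theorem coordHerm_smul_left (t u v : H) (c : ℂ) :
    coordHerm t (c • u) v = (starRingEnd ℂ) c * coordHerm t u v := by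
  simp only [coordHerm, inner_smul_left]
  ring

theorem coordHerm_smul_right (t u v : H) (c : ℂ) :
    coordHerm t u (c • v) = c * coordHerm t u v := by
  simp only [coordHerm, inner_smul_right]
  ring

theorem coordHerm_I_smul (t u v : H) :
    coordHerm t (Complex.I • u) (Complex.I • v) = coordHerm t u v := by
  rw [coordHerm_smul_left, coordHerm_smul_right, ← mul_assoc]
  simp

theorem coordHerm_self_re (t u : H) : (coordHerm t u u).re =
    ((1 + ‖t‖ ^ 2)⁻¹) ^ 2 * (‖u‖ ^ 2 + (‖t‖ ^ 2 * ‖u‖ ^ 2 - ‖inner ℂ t u‖ ^ 2)) := by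
  have hinner : inner ℂ u t * inner ℂ t u = ((‖inner ℂ t u‖ ^ 2 : ℝ) : ℂ) := by
    rw [← inner_conj_symm u t, Complex.conj_mul', Complex.ofReal_pow]
  have hself : coordHerm t u u = (((1 + ‖t‖ ^ 2)⁻¹ * ‖u‖ ^ 2 -
      ((1 + ‖t‖ ^ 2)⁻¹) ^ 2 * ‖inner ℂ t u‖ ^ 2 : ℝ) : ℂ) := by
    rw [coordHerm, hinner, inner_self_complex, conformalFactor_eq]
    push_cast
    rfl
  rw [hself, Complex.ofReal_re]
  field_simp
  ring

theorem coordHerm_self_pos (t : H) {u : H} (hu : u ≠ 0) : 0 < (coordHerm t u u).re := by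
  have hcauchy : ‖inner ℂ t u‖ ^ 2 ≤ ‖t‖ ^ 2 * ‖u‖ ^ 2 := by
    rw [← mul_pow]
    gcongr
    exact norm_inner_le_norm t u
  have hu' : 0 < ‖u‖ ^ 2 := by positivity
  rw [coordHerm_self_re]
  exact mul_pos (by positivity) (by linarith)

theorem chernGamma_comm (t u v : H) : chernGamma t u v = chernGamma t v u := by
  rw [chernGamma, chernGamma, add_comm]

theorem chernGamma_smul_right (t u v : H) (c : ℂ) :
    chernGamma t u (c • v) = c • chernGamma t u v := by
  simp only [chernGamma, inner_smul_right]
  module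

variable [NormedSpace ℝ H]

theorem contDiff_conformalFactor : ContDiff ℝ ∞ (conformalFactor (H := H)) :=
  ContDiff.inv (contDiff_const.add (contDiff_id.inner ℂ contDiff_id)) one_add_inner_self_ne_zero

theorem contDiff_coordHerm (u v : H) : ContDiff ℝ ∞ (fun t : H => coordHerm t u v) :=
  (contDiff_conformalFactor.mul contDiff_const).sub ((contDiff_conformalFactor.pow 2).mul
    ((contDiff_const.inner ℂ contDiff_id).mul (contDiff_id.inner ℂ contDiff_const)))

theorem hasDerivAt_add_smul {F : Type*} [NormedAddCommGroup F] [NormedSpace ℝ F] (t u : F) :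
    HasDerivAt (fun s : ℝ => t + s • u) u 0 := by
  simpa only [one_smul, id] using ((hasDerivAt_id (0 : ℝ)).smul_const u).const_add t

theorem hasLineDerivAt_inner_left (t u v : H) :
    HasLineDerivAt ℝ (fun t : H => inner ℂ t v) (inner ℂ u v) t u :=
  ((hasDerivAt_add_smul t u).inner ℂ (hasDerivAt_const (0 : ℝ) v)).congr_deriv (by simp)

theorem hasLineDerivAt_inner_right (t u v : H) :
    HasLineDerivAt ℝ (fun t : H => inner ℂ v t) (inner ℂ v u) t u :=
  ((hasDerivAt_const (0 : ℝ) v).inner ℂ (hasDerivAt_add_smul t u)).congr_deriv (by simp)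

theorem hasLineDerivAt_conformalFactor (t u : H) :
    HasLineDerivAt ℝ (conformalFactor (H := H))
      (-conformalFactor t ^ 2 * (inner ℂ u t + inner ℂ t u)) t u := by
  have h := ((hasDerivAt_add_smul t u).inner ℂ (hasDerivAt_add_smul t u)).const_add 1
  refine (HasDerivAt.fun_inv h (by simpa using one_add_inner_self_ne_zero t)).congr_deriv ?_
  simp only [zero_smul, add_zero, conformalFactor]
  field_simp
  ring

theorem hasLineDerivAt_coordHerm (t u v w : H) :
    HasLineDerivAt ℝ (fun t : H => coordHerm t v w)
      (coordHerm t (chernGamma t u v) w + coordHerm t v (chernGamma t u w)) t u := by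
  have hf : HasDerivAt (fun s : ℝ => conformalFactor (t + s • u)) _ 0 :=
    hasLineDerivAt_conformalFactor t u
  have h := (hf.mul_const (inner ℂ v w)).sub
    ((hf.pow 2).mul ((hasLineDerivAt_inner_right t u v).mul (hasLineDerivAt_inner_left t u w)))
  refine HasDerivAt.congr_deriv h ?_
  simp only [coordHerm, chernGamma, inner_smul_left, inner_smul_right, inner_add_left,
    inner_add_right, map_neg, conj_conformalFactor, inner_conj_symm, zero_smul, add_zero,
    Pi.mul_apply, Pi.pow_apply, inner_zero_left, inner_zero_right]
  ring

section

variable [FiniteDimensional ℝ H] {G : H → H →L[ℝ] H →L[ℝ] ℝ}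

theorem contDiff_of_eq_coordHerm (hG : ∀ t u v, G t u v = (coordHerm t u v).re) :
    ContDiff ℝ ∞ G := by
  refine contDiff_clm_apply_iff.2 fun u => contDiff_clm_apply_iff.2 fun v => ?_
  simp only [hG]
  exact Complex.reCLM.contDiff.comp (contDiff_coordHerm u v)

theorem isInvertible_of_eq_coordHerm (hG : ∀ t u v, G t u v = (coordHerm t u v).re) (t : H) :
    (G t).IsInvertible :=
  isInvertible_of_pos fun v hv => by rw [hG]; exact coordHerm_self_pos t hv

theorem fderiv_of_eq_coordHerm (hG : ∀ t u v, G t u v = (coordHerm t u v).re) (t u v w : H) :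
    fderiv ℝ G t u v w =
      (coordHerm t (chernGamma t u v) w + coordHerm t v (chernGamma t u w)).re := by
  have hd : Differentiable ℝ G := (contDiff_of_eq_coordHerm hG).differentiable (by simp)
  rw [fderiv_clm_apply_const (hd t), fderiv_clm_apply_const (by fun_prop)]
  refine (DifferentiableAt.hasFDerivAt (by fun_prop)).hasLineDerivAt u |>.unique ?_
  simp only [hG]
  exact Complex.reCLM.hasFDerivAt.comp_hasDerivAt (0 : ℝ) (hasLineDerivAt_coordHerm t u v w)

theorem christoffel_of_eq_coordHerm (hG : ∀ t u v, G t u v = (coordHerm t u v).re) (t u v : H) :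
    christoffel G t u v = chernGamma t u v := by
  refine christoffel_eq_of_compatible (isInvertible_of_eq_coordHerm hG t)
    (fun u v => ?_) (chernGamma_comm t) (fun u v w => ?_) u v
  · rw [hG, hG, coordHerm_re_comm]
  · rw [fderiv_of_eq_coordHerm hG, hG, hG, Complex.add_re]

end

variable [IsScalarTower ℝ ℂ H]

theorem hasLineDerivAt_chernGamma (t u v w : H) :
    HasLineDerivAt ℝ (fun t : H => chernGamma t v w)
      ((conformalFactor t ^ 2 * (inner ℂ u t + inner ℂ t u)) •
          (inner ℂ t v • w + inner ℂ t w • v)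
        - conformalFactor t • (inner ℂ u v • w + inner ℂ u w • v)) t u := by
  have hf : HasDerivAt (fun s : ℝ => conformalFactor (t + s • u)) _ 0 :=
    hasLineDerivAt_conformalFactor t u
  have h := hf.neg.smul (((hasLineDerivAt_inner_left t u v).smul_const w).add
    ((hasLineDerivAt_inner_left t u w).smul_const v))
  refine HasDerivAt.congr_deriv h ?_
  simp only [zero_smul, add_zero, Pi.add_apply, Pi.neg_apply]
  module

variable [FiniteDimensional ℝ H] {G : H → H →L[ℝ] H →L[ℝ] ℝ}

theorem fderiv_christoffel_of_eq_coordHerm (hG : ∀ t u v, G t u v = (coordHerm t u v).re)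
    (t u v w : H) : fderiv ℝ (christoffel G) t u v w =
      (conformalFactor t ^ 2 * (inner ℂ u t + inner ℂ t u)) •
          (inner ℂ t v • w + inner ℂ t w • v)
        - conformalFactor t • (inner ℂ u v • w + inner ℂ u w • v) := by
  have : CompleteSpace H := FiniteDimensional.complete ℝ H
  have hd : DifferentiableAt ℝ (christoffel G) t :=
    (contDiffAt_christoffel (contDiff_of_eq_coordHerm hG).contDiffAt
      (isInvertible_of_eq_coordHerm hG t)).differentiableAt (by simp)
  rw [fderiv_clm_apply_const hd, fderiv_clm_apply_const (by fun_prop)]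
  refine (DifferentiableAt.hasFDerivAt (by fun_prop)).hasLineDerivAt u |>.unique ?_
  simp only [christoffel_of_eq_coordHerm hG]
  exact hasLineDerivAt_chernGamma t u v w

theorem coordCurvature_of_eq_coordHerm (hG : ∀ t u v, G t u v = (coordHerm t u v).re)
    (t u v w : H) :
    coordCurvature G t u v w = coordHerm t v w • u - coordHerm t u w • v
      - (coordHerm t u v - coordHerm t v u) • w := by
  rw [coordCurvature_apply, fderiv_christoffel_of_eq_coordHerm hG,
    fderiv_christoffel_of_eq_coordHerm hG]
  simp only [christoffel_of_eq_coordHerm hG, chernGamma, coordHerm, inner_add_right,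
    inner_smul_right]
  module

end HermitianForms

/-! ### The projection to projective space and its differential -/

section Projection

variable {n : ℕ}

theorem slot_injective (i : Fin (n + 1)) : Function.Injective (slot (n := n) i) := by
  intro u v h
  ext j
  rw [← slot_succAbove i u j, h, slot_succAbove]

theorem inner_slot (i : Fin (n + 1)) (u v : Cn n) :
    inner ℂ (slot i u) (slot i v) = inner ℂ u v := by
  simp [PiLp.inner_apply, Fin.sum_univ_succAbove _ i]

theorem inner_affineLift_slot (i : Fin (n + 1)) (t v : Cn n) :
    inner ℂ (affineLift i t) (slot i v) = inner ℂ t v := by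
  simp [PiLp.inner_apply, Fin.sum_univ_succAbove _ i]

theorem inner_slot_affineLift (i : Fin (n + 1)) (t v : Cn n) :
    inner ℂ (slot i v) (affineLift i t) = inner ℂ v t := by
  simp [PiLp.inner_apply, Fin.sum_univ_succAbove _ i]

theorem norm_affineLift_sq (i : Fin (n + 1)) (t : Cn n) : ‖affineLift i t‖ ^ 2 = 1 + ‖t‖ ^ 2 := by
  simp [EuclideanSpace.norm_sq_eq, Fin.sum_univ_succAbove _ i]

theorem slot_affineCoord {k : Fin (n + 1)} {z : Cn (n + 1)} (hz : z k ≠ 0) :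
    slot k (affineCoord k z) = (z k)⁻¹ • z - EuclideanSpace.single k 1 := by
  ext m
  refine Fin.succAboveCases k ?_ (fun j => ?_) m
  · simp [hz]
  · simp [affineCoord, Fin.succAbove_ne, div_eq_inv_mul]

theorem affineLift_affineCoord {k : Fin (n + 1)} {z : Cn (n + 1)} (hz : z k ≠ 0) :
    affineLift k (affineCoord k z) = (z k)⁻¹ • z := by
  rw [affineLift, slot_affineCoord hz, add_sub_cancel]

theorem contDiffAt_affineCoord {k : Fin (n + 1)} {z : Cn (n + 1)} (hz : z k ≠ 0) :
    ContDiffAt ℝ ∞ (affineCoord k) z := by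
  have hcoord (m : Fin (n + 1)) : ContDiff ℂ ω (fun z : Cn (n + 1) => z m) :=
    (EuclideanSpace.proj (𝕜 := ℂ) m : Cn (n + 1) →L[ℂ] ℂ).contDiff
  have hcomplex : ContDiffAt ℂ ω (affineCoord k) z :=
    (contDiffAt_piLp 2).2 fun _ => (hcoord _).contDiffAt.div (hcoord k).contDiffAt hz
  exact (hcomplex.restrict_scalars ℝ).of_le le_top

theorem slot_fderiv_affineCoord {k : Fin (n + 1)} {z : Cn (n + 1)} (hz : z k ≠ 0)
    (v : Cn (n + 1)) :
    slot k (fderiv ℝ (affineCoord k) z v) = (z k)⁻¹ • v + (-(v k) / (z k) ^ 2) • z := by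
  have hslot : HasFDerivAt (fun y => slot k (affineCoord k y))
      ((slot k).restrictScalars ℝ ∘L fderiv ℝ (affineCoord k) z) z :=
    ((slot k).restrictScalars ℝ).hasFDerivAt.comp z
      ((contDiffAt_affineCoord hz).differentiableAt (by simp)).hasFDerivAt
  have hcoord : HasFDerivAt (fun y : Cn (n + 1) => y k)
      (EuclideanSpace.proj (𝕜 := ℂ) k : Cn (n + 1) →L[ℂ] ℂ) z :=
    (EuclideanSpace.proj (𝕜 := ℂ) k : Cn (n + 1) →L[ℂ] ℂ).hasFDerivAt
  have hquotient := (((hasDerivAt_inv hz).comp_hasFDerivAt z hcoord).smul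
    (hasFDerivAt_id z)).sub_const (EuclideanSpace.single k (1 : ℂ))
  have heq : (fun y : Cn (n + 1) => (y k)⁻¹ • y - EuclideanSpace.single k 1) =ᶠ[𝓝 z]
      fun y => slot k (affineCoord k y) := by
    have hne : ∀ᶠ y : Cn (n + 1) in 𝓝 z, y k ≠ 0 := ContinuousAt.eventually_ne (by fun_prop) hz
    filter_upwards [hne] with y hy using (slot_affineCoord hy).symm
  refine (DFunLike.congr_fun ((hslot.congr_of_eventuallyEq heq).unique
    (hquotient.restrictScalars ℝ)) v).trans ?_
  simp [div_eq_mul_inv, mul_comm]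

theorem proj_of_ne {z : Cn (n + 1)} (hz : z ≠ 0) : proj n z = Projectivization.mk ℂ z hz := by
  simp [proj, hz]

theorem proj_mem_affineSet {i : Fin (n + 1)} {z : Cn (n + 1)} (hz : z ≠ 0) :
    proj n z ∈ affineSet i ↔ z i ≠ 0 := by
  rw [proj_of_ne hz, mk_mem_affineSet]

theorem affineMap_proj (i : Fin (n + 1)) {z : Cn (n + 1)} (hz : z ≠ 0) :
    affineMap i (proj n z) = affineCoord i z := by
  rw [proj_of_ne hz]
  rfl

theorem chartIndex_mem (p : CP n) : p ∈ affineSet (chartIndex p) :=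
  (exists_mem_affineSet p).choose_spec

theorem chartIndex_proj_ne {z : Cn (n + 1)} (hz : z ≠ 0) : z (chartIndex (proj n z)) ≠ 0 :=
  (proj_mem_affineSet hz).1 (chartIndex_mem _)

theorem proj_affineLift (i : Fin (n + 1)) (t : Cn n) :
    proj n (affineLift i t) = (affineChart i).symm t := by
  rw [proj_of_ne (affineLift_ne_zero i t)]
  rfl

theorem proj_smul {c : ℂ} (hc : c ≠ 0) {z : Cn (n + 1)} (hz : z ≠ 0) :
    proj n (c • z) = proj n z := by
  rw [proj_of_ne hz, proj_of_ne (smul_ne_zero hc hz)]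
  exact (Projectivization.mk_eq_mk_iff' ℂ _ _ _ _).2 ⟨c, rfl⟩

theorem exists_proj_eq (p : CP n) : ∃ z : Cn (n + 1), ‖z‖ = 1 ∧ proj n z = p := by
  have hrep := p.rep_nonzero
  refine ⟨(‖p.rep‖ : ℂ)⁻¹ • p.rep, by simp [norm_smul, hrep], ?_⟩
  rw [proj_smul (inv_ne_zero (norm_complex_ne_zero hrep)) hrep, proj_of_ne hrep,
    Projectivization.mk_rep]

theorem continuousAt_proj {z : Cn (n + 1)} (hz : z ≠ 0) : ContinuousAt (proj n) z := by
  have hcont : ContinuousOn (proj n) {z | z ≠ 0} := by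
    rw [continuousOn_iff_continuous_domRestrict]
    exact (isQuotientMap_mk' n).continuous.congr fun v => (proj_of_ne v.2).symm
  exact hcont.continuousAt (isOpen_ne.mem_nhds hz)

theorem affineMap_proj_eventuallyEq (i : Fin (n + 1)) {z : Cn (n + 1)} (hz : z ≠ 0) :
    (fun y => affineMap i (proj n y)) =ᶠ[𝓝 z] affineCoord i := by
  filter_upwards [isOpen_ne.mem_nhds hz] with y hy using affineMap_proj i hy

theorem contMDiffAt_proj {z : Cn (n + 1)} (hz : z ≠ 0) :
    ContMDiffAt 𝓘(ℝ, Cn (n + 1)) 𝓘(ℝ, Cn n) ∞ (proj n) z :=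
  contMDiffAt_iff_target.2 ⟨continuousAt_proj hz,
    (contDiffAt_affineCoord (chartIndex_proj_ne hz)).contMDiffAt.congr_of_eventuallyEq
      (affineMap_proj_eventuallyEq _ hz)⟩

/-- The differential at `z` of the projection `ℂⁿ⁺¹ → CPⁿ`, read in the preferred chart
at `[z]`. -/
noncomputable def dproj (z : Cn (n + 1)) : Cn (n + 1) →L[ℝ] Cn n :=
  mfderiv 𝓘(ℝ, Cn (n + 1)) 𝓘(ℝ, Cn n) (proj n) z

theorem hasMFDerivAt_proj {z : Cn (n + 1)} (hz : z ≠ 0) :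
    HasMFDerivAt 𝓘(ℝ, Cn (n + 1)) 𝓘(ℝ, Cn n) (proj n) z (dproj z) :=
  ((contMDiffAt_proj hz).mdifferentiableAt (by simp)).hasMFDerivAt

theorem dproj_eq_fderiv_affineCoord {z : Cn (n + 1)} (hz : z ≠ 0) :
    dproj z = fderiv ℝ (affineCoord (chartIndex (proj n z))) z :=
  ((hasMFDerivAt_iff_hasFDerivAt_chart.1 (hasMFDerivAt_proj hz)).2.congr_of_eventuallyEq
    (affineMap_proj_eventuallyEq _ hz).symm).fderiv.symm

theorem slot_dproj {z : Cn (n + 1)} (hz : z ≠ 0) (v : Cn (n + 1)) :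
    slot (chartIndex (proj n z)) (dproj z v) = (z (chartIndex (proj n z)))⁻¹ • v
      + (-(v (chartIndex (proj n z))) / z (chartIndex (proj n z)) ^ 2) • z := by
  rw [dproj_eq_fderiv_affineCoord hz, slot_fderiv_affineCoord (chartIndex_proj_ne hz)]

theorem dproj_smul_self {z : Cn (n + 1)} (hz : z ≠ 0) (c : ℂ) : dproj z (c • z) = 0 := by
  have hk := chartIndex_proj_ne hz
  apply slot_injective (chartIndex (proj n z))
  have hcoeff : (z (chartIndex (proj n z)))⁻¹ * c
      + -(c • z) (chartIndex (proj n z)) / z (chartIndex (proj n z)) ^ 2 = 0 := by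
    simp only [PiLp.smul_apply, smul_eq_mul]
    field_simp
    ring
  rw [slot_dproj hz, map_zero, smul_smul, ← add_smul, hcoeff, zero_smul]

theorem exists_dproj_eq {z : Cn (n + 1)} (hz : ‖z‖ = 1) (u : Cn n) :
    ∃ v : Cn (n + 1), inner ℂ z v = 0 ∧ dproj z v = u := by
  have hz0 : z ≠ 0 := norm_ne_zero_iff.1 (by simp [hz])
  have hk := chartIndex_proj_ne hz0
  set k := chartIndex (proj n z) with hkdef
  refine ⟨z k • slot k u - inner ℂ z (z k • slot k u) • z, ?_, slot_injective k ?_⟩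
  · rw [inner_sub_right, inner_smul_right z z, inner_self_complex, hz, Complex.ofReal_one,
      one_pow, mul_one, sub_self]
  · rw [map_sub, dproj_smul_self hz0, sub_zero, slot_dproj hz0, ← hkdef]
    simp [smul_smul, hk]

theorem fubiniStudy_apply (p : CP n) (u v : Cn n) :
    (fubiniStudy n p : Cn n →L[ℝ] Cn n →L[ℝ] ℝ) u v =
      (hermForm (affineLift (chartIndex p) (affineMap (chartIndex p) p))
        (slot (chartIndex p) u) (slot (chartIndex p) v)).re := by
  set i := chartIndex p
  set σ := affineLift i (affineMap i p)
  have hσ : (‖σ‖ : ℂ) ≠ 0 := norm_complex_ne_zero (affineLift_ne_zero _ _)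
  have hlift (u : Cn n) : horizontalLift i (affineMap i p) u =
      (‖σ‖⁻¹ : ℂ) • (slot i u - (inner ℂ σ (slot i u) / (‖σ‖ : ℂ) ^ 2) • σ) := by
    change (‖σ‖⁻¹ : ℂ) • (Submodule.span ℂ {σ})ᗮ.starProjection (slot i u) = _
    rw [Submodule.starProjection_orthogonal_val, Submodule.starProjection_singleton,
      RCLike.ofReal_pow]
    rfl
  have hreal (x y : Cn (n + 1)) : innerSL ℝ x y = (inner ℂ x y).re := by simp [PiLp.inner_apply]
  change innerSL ℝ (horizontalLift i (affineMap i p) u) (horizontalLift i (affineMap i p) v) = _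
  rw [hreal, hlift, hlift]
  congr 1
  simp only [inner_sub_left, inner_sub_right, inner_smul_left, inner_smul_right,
    inner_self_complex, hermForm, map_div₀, map_inv₀, Complex.conj_ofReal, map_pow,
    inner_conj_symm]
  field_simp
  ring

theorem pullback_proj {z : Cn (n + 1)} (hz : z ≠ 0) (v w : Cn (n + 1)) :
    pullback (proj n) (fubiniStudy n) z v w = (hermForm z v w).re := by
  have hk := chartIndex_proj_ne hz
  refine (pullback_apply_of_hasMFDerivAt (hasMFDerivAt_proj hz) _ _ _).trans
    ((fubiniStudy_apply _ _ _).trans ?_)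
  rw [slot_dproj hz, slot_dproj hz, affineMap_proj _ hz, affineLift_affineCoord hk,
    hermForm_smul_add hz (inv_ne_zero hk)]

theorem isSubmersionMetric_fubiniStudy (n : ℕ) : IsSubmersionMetric n (fubiniStudy n) where
  smooth _ hz := (contMDiffAt_proj hz).contMDiffWithinAt
  vertical z hz := dproj_smul_self (norm_ne_zero_iff.1 (by simp [hz])) _
  surjective _ hz := exists_dproj_eq hz
  isometric z hz v w _ hw := by
    rw [← hermForm_of_norm_eq_one hz hw]
    exact pullback_proj (norm_ne_zero_iff.1 (by simp [hz])) v w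

variable {V : Type*} [NormedAddCommGroup V] [NormedSpace ℝ V] {ζ : V → Cn (n + 1)}
  {ζ' : V →L[ℝ] Cn (n + 1)} {y : V}

theorem hasMFDerivAt_proj_comp (hζ : HasFDerivAt ζ ζ' y) (hy : ζ y ≠ 0) :
    HasMFDerivAt 𝓘(ℝ, V) 𝓘(ℝ, Cn n) (fun y => proj n (ζ y)) y (dproj (ζ y) ∘L ζ' : V →L[ℝ] Cn n) :=
  (hasMFDerivAt_proj hy).comp y hζ.hasMFDerivAt

theorem pullback_proj_comp (hζ : HasFDerivAt ζ ζ' y) (hy : ζ y ≠ 0) (u v : V) :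
    pullback (fun y => proj n (ζ y)) (fubiniStudy n) y u v = (hermForm (ζ y) (ζ' u) (ζ' v)).re :=
  (pullback_apply_of_hasMFDerivAt (hasMFDerivAt_proj_comp hζ hy) _ _ _).trans <|
    (pullback_apply_of_hasMFDerivAt (hasMFDerivAt_proj hy) _ _ _).symm.trans (pullback_proj hy _ _)

end Projection

/-! ### Topology and orientation of projective space -/

section Topology

variable {n : ℕ}

/-- The function `[z] ↦ |⟨a, z⟩| / |z|`. By the equality case of the Cauchy-Schwarz inequality it
attains `|a|` only at `[a]`, hence these functions separate points. -/
noncomputable def cosDist (a : Cn (n + 1)) (p : CP n) : ℝ := ‖inner ℂ a p.rep‖ / ‖p.rep‖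

theorem cosDist_mk (a z : Cn (n + 1)) (hz : z ≠ 0) :
    cosDist a (Projectivization.mk ℂ z hz) = ‖inner ℂ a z‖ / ‖z‖ := by
  obtain ⟨c, hc⟩ := Projectivization.exists_smul_eq_mk_rep ℂ z hz
  rw [cosDist, ← hc, Units.smul_def, inner_smul_right, norm_smul, norm_mul,
    mul_div_mul_left _ _ (norm_ne_zero_iff.2 c.ne_zero)]

theorem continuous_cosDist (a : Cn (n + 1)) : Continuous (cosDist (n := n) a) := by
  refine (isQuotientMap_mk' n).continuous_iff.2 ?_
  have heq : cosDist a ∘ (Projectivization.mk' ℂ : {v : Cn (n + 1) // v ≠ 0} → CP n) =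
      fun v => ‖inner ℂ a v.1‖ / ‖v.1‖ := funext fun v => cosDist_mk a v.1 v.2
  rw [heq]
  exact Continuous.div (by fun_prop) (by fun_prop) fun v => norm_ne_zero_iff.2 v.2

theorem eq_of_cosDist_rep_eq {p q : CP n} (h : cosDist p.rep p = cosDist p.rep q) : p = q := by
  have hp := norm_ne_zero_iff.2 p.rep_nonzero
  have hq := norm_ne_zero_iff.2 q.rep_nonzero
  have hinner : ‖inner ℂ p.rep q.rep‖ = ‖p.rep‖ * ‖q.rep‖ := by
    rw [cosDist, cosDist, inner_self_complex, norm_pow, Complex.norm_real, norm_norm] at h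
    field_simp at h
    exact h.symm
  obtain ⟨r, -, hr⟩ := (norm_inner_eq_norm_iff p.rep_nonzero q.rep_nonzero).1 hinner
  rw [← p.mk_rep, ← q.mk_rep]
  exact ((Projectivization.mk_eq_mk_iff' ℂ _ _ _ _).2 ⟨r, hr.symm⟩).symm

instance instT2SpaceCP (n : ℕ) : T2Space (CP n) where
  t2 p _ hpq := separated_by_continuous (continuous_cosDist p.rep) fun h =>
    hpq (eq_of_cosDist_rep_eq h)

instance instSecondCountableTopologyCP (n : ℕ) : SecondCountableTopology (CP n) :=
  have (i : Fin (n + 1)) : SecondCountableTopology (affineSet (n := n) i) :=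
    (affineChart i).secondCountableTopology_source
  TopologicalSpace.secondCountableTopology_of_countable_cover isOpen_affineSet
    (Set.eq_univ_of_forall fun p => Set.mem_iUnion.2 (exists_mem_affineSet p))

end Topology

section Orientation

variable {E : Type*} [NormedAddCommGroup E] [NormedSpace ℂ E]

theorem det_restrictScalars_pos [NormedSpace ℝ E] [IsScalarTower ℝ ℂ E] [FiniteDimensional ℂ E]
    (D : E →L[ℂ] E) (hD : Function.Injective D) : 0 < (D.restrictScalars ℝ).det := by
  have hdet : (D.restrictScalars ℝ).det = Algebra.norm ℝ (LinearMap.det (D : E →ₗ[ℂ] E)) :=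
    LinearMap.det_restrictScalars
  rw [hdet, Algebra.norm_complex_apply, Complex.normSq_pos]
  exact (LinearEquiv.isUnit_det' (LinearEquiv.ofInjectiveEndo (D : E →ₗ[ℂ] E) hD)).ne_zero

theorem injective_fderiv_of_leftInverse {f f' : E → E} {y : E}
    (hf : DifferentiableAt ℂ f y) (hf' : DifferentiableAt ℂ f' (f y)) (h : f' ∘ f =ᶠ[𝓝 y] id) :
    Function.Injective (fderiv ℂ f y) := by
  have hcomp : fderiv ℂ f' (f y) ∘L fderiv ℂ f y = ContinuousLinearMap.id ℂ E :=
    ((hf'.hasFDerivAt.comp y hf.hasFDerivAt).congr_of_eventuallyEq h.symm).unique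
      (hasFDerivAt_id y)
  exact Function.LeftInverse.injective (DFunLike.congr_fun hcomp)

theorem isOrientable_of_complex [NormedSpace ℝ E] [IsScalarTower ℝ ℂ E] [FiniteDimensional ℂ E]
    (M : Type*) [TopologicalSpace M] [ChartedSpace E M] [IsManifold 𝓘(ℂ, E) ω M]
    [IsManifold 𝓘(ℝ, E) ∞ M] : IsOrientable E M := by
  have htransition {e e' : OpenPartialHomeomorph M E} (he : e ∈ atlas E M) (he' : e' ∈ atlas E M)
      {y : E} (hy : y ∈ (e.symm.trans e').source) :
      DifferentiableAt ℂ (fun x => e' (e.symm x)) y := by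
    rw [OpenPartialHomeomorph.trans_source] at hy
    exact ((contMDiffAt_of_mem_maximalAtlas
      (IsManifold.subset_maximalAtlas (I := 𝓘(ℂ, E)) (n := ω) he') hy.2).comp y
      (contMDiffAt_symm_of_mem_maximalAtlas
        (IsManifold.subset_maximalAtlas he) hy.1)).contDiffAt.differentiableAt (by simp)
  refine ⟨atlas E M, IsManifold.subset_maximalAtlas, fun p =>
    ⟨chartAt E p, chart_mem_atlas E p, mem_chart_source E p⟩, fun e he e' he' y hy => ?_⟩
  have hd := htransition he he' hy
  rw [hd.fderiv_restrictScalars ℝ]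
  refine det_restrictScalars_pos _ (injective_fderiv_of_leftInverse hd
    (htransition he' he ((e.symm.trans e').map_source hy)) ?_)
  filter_upwards [(e.symm.trans e').open_source.mem_nhds hy] with x hx
  exact (e.symm.trans e').left_inv hx

end Orientation

/-! ### The Kähler property and the Chern connection -/

section Kahler

variable {n : ℕ} (p : CP n)

theorem hermForm_affineLift (i : Fin (n + 1)) (t u v : Cn n) :
    hermForm (affineLift i t) (slot i u) (slot i v) = coordHerm t u v := by
  have hnorm_sq : (‖affineLift i t‖ : ℂ) ^ 2 = 1 + inner ℂ t t := by
    rw [one_add_inner_self, ← norm_affineLift_sq i, Complex.ofReal_pow]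
  have hnorm_four : (‖affineLift i t‖ : ℂ) ^ 4 = (1 + inner ℂ t t) ^ 2 := by
    rw [← hnorm_sq]
    ring
  simp only [hermForm, hnorm_sq, hnorm_four, inner_slot, inner_slot_affineLift,
    inner_affineLift_slot, coordHerm, conformalFactor]
  field_simp

theorem coordMetric_fubiniStudy (t u v : Cn n) :
    coordMetric (fubiniStudy n) p t u v = (coordHerm t u v).re := by
  have hchart : ⇑(chartAt (Cn n) p).symm = fun y => proj n (affineLift (chartIndex p) y) :=
    funext fun y => (proj_affineLift _ y).symm
  have hlift : HasFDerivAt (affineLift (chartIndex p))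
      ((slot (chartIndex p)).restrictScalars ℝ) t :=
    ((slot (chartIndex p)).restrictScalars ℝ).hasFDerivAt.const_add _
  have hpullback := pullback_proj_comp hlift (affineLift_ne_zero _ _) u v
  rw [← hchart] at hpullback
  exact hpullback.trans (congrArg Complex.re (hermForm_affineLift _ _ _ _))

theorem fubiniStudy_eq_coordHerm (u v : Cn n) :
    (fubiniStudy n p : Cn n →L[ℝ] Cn n →L[ℝ] ℝ) u v = (coordHerm (chartAt (Cn n) p p) u v).re :=
  (fubiniStudy_apply p u v).trans (congrArg Complex.re (hermForm_affineLift _ _ _ _))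

theorem isSmoothMetric_fubiniStudy (n : ℕ) : IsSmoothMetric (fubiniStudy n) := by
  refine isSmoothMetric_of_coordMetric _ (fun p u v => ?_) (fun p u hu => ?_) fun p => ?_
  · exact (fubiniStudy_eq_coordHerm p u v).trans
      ((coordHerm_re_comm _ _ _).trans (fubiniStudy_eq_coordHerm p v u).symm)
  · exact (coordHerm_self_pos _ hu).trans_eq (fubiniStudy_eq_coordHerm p u u).symm
  · exact (contDiff_of_eq_coordHerm (coordMetric_fubiniStudy p)).contDiffAt

theorem fderiv_fundamentalForm (t u v w : Cn n) :
    fderiv ℝ (fun y => fundamentalForm (fubiniStudy n) p y v w) t u =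
      (coordHerm t (chernGamma t u v) w + coordHerm t v (chernGamma t u w)).im := by
  have heq : (fun y => fundamentalForm (fubiniStudy n) p y v w) =
      fun y => (coordHerm y (Complex.I • v) w).re :=
    funext fun y => coordMetric_fubiniStudy p y _ _
  have hdiff : Differentiable ℝ fun y : Cn n => (coordHerm y (Complex.I • v) w).re :=
    (Complex.reCLM.contDiff.comp (contDiff_coordHerm (Complex.I • v) w)).differentiable (by simp)
  have hline : HasLineDerivAt ℝ (fun y : Cn n => (coordHerm y (Complex.I • v) w).re) _ t u :=
    Complex.reCLM.hasFDerivAt.comp_hasDerivAt (0 : ℝ)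
      (hasLineDerivAt_coordHerm t u (Complex.I • v) w)
  rw [heq, ((hdiff t).hasFDerivAt.hasLineDerivAt u).unique hline]
  simp [chernGamma_smul_right, coordHerm_smul_left]

theorem isKahler_fubiniStudy (n : ℕ) : IsKahler (fubiniStudy n) where
  smooth := isSmoothMetric_fubiniStudy n
  hermitian p u v := (fubiniStudy_eq_coordHerm p _ _).trans
    ((congrArg Complex.re (coordHerm_I_smul _ _ _)).trans (fubiniStudy_eq_coordHerm p u v).symm)
  closed p u v w := by
    rw [fderiv_fundamentalForm, fderiv_fundamentalForm, fderiv_fundamentalForm]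
    set t := chartAt (Cn n) p p
    simp only [Complex.add_im]
    rw [coordHerm_im_comm t v, coordHerm_im_comm t w, coordHerm_im_comm t u, chernGamma_comm t u w,
      chernGamma_comm t v u, chernGamma_comm t w v]
    ring

theorem leviCivita_fubiniStudy (u v : Cn n) :
    leviCivita (fubiniStudy n) p u v = chernGamma (chartAt (Cn n) p p) u v :=
  christoffel_of_eq_coordHerm (coordMetric_fubiniStudy p) _ u v

theorem isChernConnection_fubiniStudy :
    IsChernConnection (fubiniStudy n) p (leviCivita (fubiniStudy n) p) where
  complex_linear u v := by
    rw [leviCivita_fubiniStudy, leviCivita_fubiniStudy, chernGamma_smul_right]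
  type_one_zero u v := by
    rw [leviCivita_fubiniStudy, leviCivita_fubiniStudy, chernGamma_comm, chernGamma_smul_right,
      chernGamma_comm]
  metric u v w := by
    rw [fderiv_of_eq_coordHerm (coordMetric_fubiniStudy p), leviCivita_fubiniStudy,
      leviCivita_fubiniStudy, coordMetric_fubiniStudy, coordMetric_fubiniStudy, Complex.add_re]

end Kahler

/-! ### Ricci curvature -/

section Trace

variable {V : Type*} [AddCommGroup V] [Module ℝ V] [Module ℂ V] [IsScalarTower ℝ ℂ V]
  [FiniteDimensional ℝ V]

theorem trace_smulRight_complex (φ : V →ₗ[ℝ] ℂ) (w : V) :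
    LinearMap.trace ℝ V (φ.smulRight w) = (φ w).re + (φ (Complex.I • w)).im := by
  have hsplit : φ.smulRight w = (Complex.reLm ∘ₗ φ).smulRight w +
      (Complex.imLm ∘ₗ φ).smulRight (Complex.I • w) := by
    ext u
    have hsmul (r : ℝ) (x : V) : r • x = (r : ℂ) • x := (algebraMap_smul ℂ r x).symm
    simp only [LinearMap.add_apply, LinearMap.smulRight_apply, LinearMap.comp_apply, hsmul,
      Complex.reLm_coe, Complex.imLm_coe]
    rw [← mul_smul, ← add_smul, Complex.re_add_im]
  rw [hsplit, map_add, LinearMap.trace_smulRight, LinearMap.trace_smulRight]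
  rfl

theorem trace_smulRight_complexLinear (φ : V →ₗ[ℂ] ℂ) (w : V) :
    LinearMap.trace ℝ V ((φ.restrictScalars ℝ).smulRight w) = 2 * (φ w).re := by
  rw [trace_smulRight_complex, LinearMap.restrictScalars_apply, LinearMap.restrictScalars_apply,
    map_smul, smul_eq_mul, Complex.I_mul_im]
  ring

theorem trace_smulRight_conj_complexLinear (φ : V →ₗ[ℂ] ℂ) (w : V) :
    LinearMap.trace ℝ V
      ((Complex.conjAe.toLinearMap ∘ₗ φ.restrictScalars ℝ).smulRight w) = 0 := by
  simp [trace_smulRight_complex]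

theorem trace_restrictScalars_complex (L : V →ₗ[ℂ] V) :
    LinearMap.trace ℝ V (L.restrictScalars ℝ) = 2 * (LinearMap.trace ℂ V L).re := by
  have : FiniteDimensional ℂ V := FiniteDimensional.right ℝ ℂ V
  let b := Module.finBasis ℂ V
  have hsum : L = ∑ k, (b.coord k).smulRight (L (b k)) := b.ext fun j => by
    simp [LinearMap.sum_apply, Finsupp.single_apply, ite_smul]
  have hsum' : L.restrictScalars ℝ =
      ∑ k, ((b.coord k).restrictScalars ℝ).smulRight (L (b k)) := by
    ext u
    conv_lhs => rw [LinearMap.restrictScalars_apply, hsum]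
    simp only [LinearMap.sum_apply, LinearMap.smulRight_apply, LinearMap.restrictScalars_apply]
  rw [hsum', map_sum, Finset.sum_congr rfl fun k _ => trace_smulRight_complexLinear _ _]
  conv_rhs => rw [hsum, map_sum, Complex.re_sum]
  simp only [LinearMap.trace_smulRight, Finset.mul_sum]

end Trace

/-- `coordHerm t v` as a complex linear form. -/
noncomputable def coordHermLin {H : Type*} [NormedAddCommGroup H] [InnerProductSpace ℂ H]
    (t v : H) : H →ₗ[ℂ] ℂ where
  toFun := coordHerm t v
  map_add' := coordHerm_add_right t v
  map_smul' c w := coordHerm_smul_right t v w c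

/-- The two conjugate linear terms of the curvature are traceless. -/
theorem trace_of_eq_curvature {H : Type*} [NormedAddCommGroup H] [InnerProductSpace ℂ H]
    [Module ℝ H] [IsScalarTower ℝ ℂ H] [FiniteDimensional ℝ H] (t v w : H) {L : H →ₗ[ℝ] H}
    (hL : ∀ u, L u = coordHerm t v w • u - coordHerm t u w • v
      - (coordHerm t u v - coordHerm t v u) • w) :
    LinearMap.trace ℝ H L = 2 * (Module.finrank ℂ H + 1) * (coordHerm t v w).re := by
  have : FiniteDimensional ℂ H := FiniteDimensional.right ℝ ℂ H
  let conjForm (x : H) : H →ₗ[ℝ] ℂ :=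
    Complex.conjAe.toLinearMap ∘ₗ (coordHermLin t x).restrictScalars ℝ
  have hsplit : L = (coordHerm t v w • LinearMap.id + (coordHermLin t v).smulRight w
      : H →ₗ[ℂ] H).restrictScalars ℝ
        - (conjForm w).smulRight v - (conjForm v).smulRight w := by
    ext u
    rw [hL, ← coordHerm_conj t w u, ← coordHerm_conj t v u]
    change _ = coordHerm t v w • u + coordHerm t v u • w
      - (starRingEnd ℂ) (coordHerm t w u) • v - (starRingEnd ℂ) (coordHerm t v u) • w
    module
  rw [hsplit, map_sub, map_sub, trace_smulRight_conj_complexLinear,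
    trace_smulRight_conj_complexLinear, trace_restrictScalars_complex, map_add, map_smul,
    LinearMap.trace_id, LinearMap.trace_smulRight]
  change 2 * (coordHerm t v w * (Module.finrank ℂ H : ℂ) + coordHerm t v w).re - 0 - 0 = _
  rw [Complex.add_re, ← Complex.ofReal_natCast, Complex.re_mul_ofReal]
  ring

theorem riemann_fubiniStudy {n : ℕ} (p : CP n) (u v w : Cn n) :
    (riemann (fubiniStudy n) p : Cn n →L[ℝ] Cn n →L[ℝ] Cn n →L[ℝ] Cn n) u v w =
      coordHerm (chartAt (Cn n) p p) v w • u - coordHerm (chartAt (Cn n) p p) u w • v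
      - (coordHerm (chartAt (Cn n) p p) u v - coordHerm (chartAt (Cn n) p p) v u) • w :=
  coordCurvature_of_eq_coordHerm (coordMetric_fubiniStudy p) _ u v w

theorem isEinstein_fubiniStudy (n : ℕ) : IsEinstein (fubiniStudy n) (2 * (n + 1)) := by
  intro p v w
  refine (trace_of_eq_curvature (chartAt (Cn n) p p) v w
    fun u => riemann_fubiniStudy p u v w).trans ?_
  rw [finrank_euclideanSpace_fin]
  exact congrArg (2 * ((n : ℝ) + 1) * ·) (fubiniStudy_eq_coordHerm p v w).symm

/-! ### Sectional curvature -/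

section HermitianFrames

variable {H : Type*} [NormedAddCommGroup H] [InnerProductSpace ℂ H] {t u v w : H}

theorem coordHerm_eq_zero (hre : (coordHerm t u w).re = 0)
    (him : (coordHerm t (Complex.I • u) w).re = 0) : coordHerm t u w = 0 := by
  rw [coordHerm_smul_left] at him
  exact Complex.ext hre (by simpa using him)

theorem coordHerm_eq_one (hu : (coordHerm t u u).re = 1) : coordHerm t u u = 1 := by
  rw [coordHerm_self, hu, Complex.ofReal_one]

theorem coordHerm_smul_add_self {a b : ℂ} (hu : coordHerm t u u = 1) (hw : coordHerm t w w = 1)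
    (huw : coordHerm t u w = 0) (hab : ‖a‖ ^ 2 + ‖b‖ ^ 2 = 1) :
    coordHerm t (a • w + b • u) (a • w + b • u) = 1 := by
  have hwu : coordHerm t w u = 0 := by rw [← coordHerm_conj, huw, map_zero]
  have hab' : (‖a‖ : ℂ) ^ 2 + (‖b‖ : ℂ) ^ 2 = 1 := by exact_mod_cast hab
  simp only [coordHerm_add_left, coordHerm_add_right, coordHerm_smul_left, coordHerm_smul_right,
    hu, hw, huw, hwu, mul_zero, mul_one, zero_add, add_zero, Complex.mul_conj', hab']

theorem exists_coordHerm_smul_self_eq_one (t : H) (hv : v ≠ 0) :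
    ∃ r : ℂ, coordHerm t (r • v) (r • v) = 1 := by
  have hpos := coordHerm_self_pos t hv
  have hsqrt : √(coordHerm t v v).re ≠ 0 := (Real.sqrt_pos.2 hpos).ne'
  refine ⟨((√(coordHerm t v v).re)⁻¹ : ℝ), coordHerm_eq_one ?_⟩
  rw [coordHerm_smul_left, coordHerm_smul_right, Complex.conj_ofReal, Complex.re_ofReal_mul,
    Complex.re_ofReal_mul]
  field_simp
  rw [Real.sq_sqrt hpos.le]

theorem exists_coordHerm_orthonormal (hH : 1 < Module.finrank ℂ H) (t : H) :
    ∃ u w : H, coordHerm t u u = 1 ∧ coordHerm t w w = 1 ∧ coordHerm t u w = 0 := by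
  have : Nontrivial H := Module.nontrivial_of_finrank_pos (R := ℂ) (by omega)
  obtain ⟨x, hx⟩ := exists_ne (0 : H)
  obtain ⟨y, hxy⟩ := exists_linearIndependent_pair_of_one_lt_finrank hH hx
  obtain ⟨r, hr⟩ := exists_coordHerm_smul_self_eq_one t hx
  set u := r • x with hu
  have hne : (-coordHerm t u y) • u + y ≠ 0 := fun hzero =>
    one_ne_zero (LinearIndependent.pair_iff.1 hxy (-coordHerm t u y * r) 1
      (by rw [mul_smul, one_smul, ← hu, hzero])).2
  obtain ⟨r', hr'⟩ := exists_coordHerm_smul_self_eq_one t hne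
  refine ⟨u, _, hr, hr', ?_⟩
  rw [coordHerm_smul_right, coordHerm_add_right, coordHerm_smul_right, hr]
  ring

theorem linearIndependent_of_coordHerm [Module ℝ H] [IsScalarTower ℝ ℂ H]
    (hu : coordHerm t u u = 1) (hw : coordHerm t w w = 1) (huw : (coordHerm t u w).re = 0) :
    LinearIndependent ℝ ![u, w] := by
  refine LinearIndependent.pair_iff.2 fun a b hab => ?_
  have hpair (x : H) : a * (coordHerm t x u).re + b * (coordHerm t x w).re = 0 := by
    have hzero : coordHerm t x ((a : ℂ) • u + (b : ℂ) • w) = coordHerm t x ((0 : ℂ) • w) :=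
      congrArg (coordHerm t x) (by
        rw [zero_smul, ← hab, ← algebraMap_smul ℂ a u, ← algebraMap_smul ℂ b w]; rfl)
    simpa only [coordHerm_add_right, coordHerm_smul_right, Complex.add_re, Complex.re_ofReal_mul,
      zero_mul, Complex.zero_re] using congrArg Complex.re hzero
  constructor
  · simpa [hu, huw] using hpair u
  · simpa [hw, coordHerm_re_comm t w u, huw] using hpair w

end HermitianFrames

variable {n : ℕ}

theorem sectional_fubiniStudy_eq_div (p : CP n) (u v : Cn n) :
    sectional (fubiniStudy n) p u v =
      (coordHerm (chartAt (Cn n) p p) (coordHerm (chartAt (Cn n) p p) v v • u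
        - coordHerm (chartAt (Cn n) p p) u v • v
        - (coordHerm (chartAt (Cn n) p p) u v - coordHerm (chartAt (Cn n) p p) v u) • v) u).re /
      ((coordHerm (chartAt (Cn n) p p) u u).re * (coordHerm (chartAt (Cn n) p p) v v).re
        - (coordHerm (chartAt (Cn n) p p) u v).re ^ 2) := by
  have hnum := (fubiniStudy_eq_coordHerm p _ u).trans
    (congrArg (fun x => (coordHerm (chartAt (Cn n) p p) x u).re) (riemann_fubiniStudy p u v v))
  exact congrArg₂ (· / ·) hnum (congrArg₂ (· - ·) (congrArg₂ (· * ·)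
    (fubiniStudy_eq_coordHerm p u u) (fubiniStudy_eq_coordHerm p v v))
    (congrArg (· ^ 2) (fubiniStudy_eq_coordHerm p u v)))

/-- The imaginary part of the Hermitian form is `⟨Ju, v⟩`, the cosine of the angle between `v`
and the complex line of `u`. -/
theorem sectional_fubiniStudy {p : CP n} {u v : Cn n}
    (hu : coordHerm (chartAt (Cn n) p p) u u = 1) (hv : coordHerm (chartAt (Cn n) p p) v v = 1)
    (huv : (coordHerm (chartAt (Cn n) p p) u v).re = 0) :
    sectional (fubiniStudy n) p u v = 1 + 3 * (coordHerm (chartAt (Cn n) p p) u v).im ^ 2 := by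
  rw [sectional_fubiniStudy_eq_div]
  set t := chartAt (Cn n) p p
  set b := (coordHerm t u v).im
  have huv' : coordHerm t u v = b * Complex.I := Complex.ext (by simpa using huv) (by simp [b])
  have hvu : coordHerm t v u = -(b * Complex.I) := by
    rw [← coordHerm_conj, huv', map_mul, Complex.conj_ofReal, Complex.conj_I, mul_neg]
  have hcurv : coordHerm t v v • u - coordHerm t u v • v
      - (coordHerm t u v - coordHerm t v u) • v = (1 : ℂ) • u + (-(3 * b) * Complex.I) • v := by
    rw [hv, huv', hvu]
    module
  have hnum : coordHerm t ((1 : ℂ) • u + (-(3 * b) * Complex.I) • v) u =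
      ((1 + 3 * b ^ 2 : ℝ) : ℂ) := by
    rw [coordHerm_add_left, coordHerm_smul_left, coordHerm_smul_left, hvu, hu]
    simp only [map_one, map_mul, map_neg, Complex.conj_I, Complex.conj_ofReal, map_ofNat]
    push_cast
    linear_combination -3 * (b : ℂ) ^ 2 * Complex.I_sq
  rw [hcurv, hnum, huv, hu, hv, Complex.ofReal_re]
  simp

theorem sectional_fubiniStudy_cos_smul_add_sin_smul {p : CP n} {u w : Cn n}
    (hu : coordHerm (chartAt (Cn n) p p) u u = 1) (hw : coordHerm (chartAt (Cn n) p p) w w = 1)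
    (huw : coordHerm (chartAt (Cn n) p p) u w = 0) (s : ℝ) :
    sectional (fubiniStudy n) p u (Real.cos s • w + Real.sin s • Complex.I • u : Cn n) =
      1 + 3 * Real.sin s ^ 2 := by
  have hv : (Real.cos s • w + Real.sin s • Complex.I • u : Cn n) =
      (Real.cos s : ℂ) • w + (Real.sin s * Complex.I : ℂ) • u :=
    congrArg (Real.cos s • w + ·) (mul_smul (Real.sin s : ℂ) Complex.I u).symm
  have hvv := coordHerm_smul_add_self (a := Real.cos s) (b := Real.sin s * Complex.I) hu hw huw
    (by rw [norm_mul, Complex.norm_I, mul_one, Complex.norm_real, Complex.norm_real,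
      Real.norm_eq_abs, Real.norm_eq_abs, sq_abs, sq_abs, Real.cos_sq_add_sin_sq])
  have huv : coordHerm (chartAt (Cn n) p p) u
      ((Real.cos s : ℂ) • w + (Real.sin s * Complex.I : ℂ) • u) = Real.sin s * Complex.I := by
    rw [coordHerm_add_right, coordHerm_smul_right, coordHerm_smul_right, hu, huw, mul_zero,
      mul_one, zero_add]
  rw [hv]
  refine (sectional_fubiniStudy hu hvv ?_).trans ?_
  · rw [huv, Complex.re_ofReal_mul, Complex.I_re, mul_zero]
  · rw [huv, Complex.im_ofReal_mul, Complex.I_im, mul_one]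

theorem sectional_angle (p : CP n) (u w : TangentSpace 𝓘(ℝ, Cn n) p)
    (hu : fubiniStudy n p u u = 1) (hw : fubiniStudy n p w w = 1) (huw : fubiniStudy n p u w = 0)
    (hJ : fubiniStudy n p (complexStructure p u) w = 0) (s : ℝ) :
    sectional (fubiniStudy n) p u (Real.cos s • w + Real.sin s • complexStructure p u) =
      1 + 3 * Real.sin s ^ 2 :=
  sectional_fubiniStudy_cos_smul_add_sin_smul
    (coordHerm_eq_one ((fubiniStudy_eq_coordHerm p u u).symm.trans hu))
    (coordHerm_eq_one ((fubiniStudy_eq_coordHerm p w w).symm.trans hw))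
    (coordHerm_eq_zero ((fubiniStudy_eq_coordHerm p u w).symm.trans huw)
      ((fubiniStudy_eq_coordHerm p _ w).symm.trans hJ)) s

instance instNonemptyCP : Nonempty (CP n) := ⟨proj n 0⟩

theorem not_hasConstantSectionalCurvature (hn : 2 ≤ n) :
    ¬ ∃ c : ℝ, HasConstantSectionalCurvature (fubiniStudy n) c := by
  rintro ⟨c, hc⟩
  obtain ⟨p⟩ := instNonemptyCP (n := n)
  obtain ⟨u, w, hu, hw, huw⟩ := exists_coordHerm_orthonormal
    (by rwa [finrank_euclideanSpace_fin]) (chartAt (Cn n) p p)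
  have huIu : coordHerm (chartAt (Cn n) p p) u (Complex.I • u) = Complex.I := by
    rw [coordHerm_smul_right, hu, mul_one]
  have hIu : coordHerm (chartAt (Cn n) p p) (Complex.I • u) (Complex.I • u) = 1 := by
    rw [coordHerm_I_smul, hu]
  have huw_re : (coordHerm (chartAt (Cn n) p p) u w).re = 0 := by rw [huw, Complex.zero_re]
  have huIu_re : (coordHerm (chartAt (Cn n) p p) u (Complex.I • u)).re = 0 := by
    rw [huIu, Complex.I_re]
  have hindep_real : LinearIndependent ℝ ![u, w] := linearIndependent_of_coordHerm hu hw huw_re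
  have hindep_complex : LinearIndependent ℝ ![u, Complex.I • u] :=
    linearIndependent_of_coordHerm hu hIu huIu_re
  have hreal := (hc p u w hindep_real).symm.trans (sectional_fubiniStudy hu hw huw_re)
  have hcomplex := (hc p u (Complex.I • u : Cn n) hindep_complex).symm.trans
    (sectional_fubiniStudy hu hIu huIu_re)
  rw [huw, Complex.zero_im] at hreal
  rw [huIu, Complex.I_im] at hcomplex
  linarith

/-! ### Conformal changes of metric -/

section Conformal

variable {E : Type*} [NormedAddCommGroup E] [NormedSpace ℝ E]
  {G : E → E →L[ℝ] E →L[ℝ] ℝ} {φ : E → ℝ} {y u v w z : E}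

theorem apply_christoffel (hG : (G y).IsInvertible) (u v w : E) :
    G y (christoffel G y u v) w = koszul G y u v w :=
  (DFunLike.congr_fun (hG.inverse_apply_eq.1 (christoffel_apply G y u v).symm) w).symm

theorem fderiv_apply_comm (hG : DifferentiableAt ℝ G y)
    (hsymm : ∀ᶠ x in 𝓝 y, ∀ u v, G x u v = G x v u) (u v w : E) :
    fderiv ℝ G y u v w = fderiv ℝ G y u w v := by
  have hswap : (fun x => G x v w) =ᶠ[𝓝 y] fun x => G x w v := hsymm.mono fun x hx => hx v w
  rw [fderiv_clm_apply_const hG, fderiv_clm_apply_const (by fun_prop), hswap.fderiv_eq,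
    ← fderiv_clm_apply_const (by fun_prop), ← fderiv_clm_apply_const hG]

theorem christoffel_comm (hG : DifferentiableAt ℝ G y)
    (hsymm : ∀ᶠ x in 𝓝 y, ∀ u v, G x u v = G x v u) (u v : E) :
    christoffel G y u v = christoffel G y v u := by
  rw [christoffel_apply, christoffel_apply]
  congr 1
  ext w
  rw [koszul_apply, koszul_apply, fderiv_apply_comm hG hsymm w u v]
  ring

theorem fderiv_eq_christoffel_add (hG : DifferentiableAt ℝ G y) (hinv : (G y).IsInvertible)
    (hsymm : ∀ᶠ x in 𝓝 y, ∀ u v, G x u v = G x v u) (u v w : E) :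
    fderiv ℝ G y u v w = G y (christoffel G y u v) w + G y v (christoffel G y u w) := by
  rw [hsymm.self_of_nhds v, apply_christoffel hinv, apply_christoffel hinv, koszul_apply,
    koszul_apply, fderiv_apply_comm hG hsymm u v w, fderiv_apply_comm hG hsymm w u v,
    fderiv_apply_comm hG hsymm v u w]
  ring

/-- The gradient of `φ` for the metric `G`: the vector field dual to the differential of `φ`. -/
noncomputable def metricGradient (G : E → E →L[ℝ] E →L[ℝ] ℝ) (φ : E → ℝ) (y : E) : E :=
  (G y).inverse (fderiv ℝ φ y)

theorem apply_metricGradient (hG : (G y).IsInvertible) (w : E) :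
    G y (metricGradient G φ y) w = fderiv ℝ φ y w :=
  (DFunLike.congr_fun (hG.inverse_apply_eq.1 (rfl : _ = metricGradient G φ y)) w).symm

theorem fderiv_exp_smul (hG : DifferentiableAt ℝ G y) (hφ : DifferentiableAt ℝ φ y) (u v w : E) :
    fderiv ℝ (fun x => Real.exp (2 * φ x) • G x) y u v w =
      Real.exp (2 * φ y) * (fderiv ℝ G y u v w + 2 * fderiv ℝ φ y u * G y v w) := by
  have hderiv : HasFDerivAt (fun x => Real.exp (2 * φ x) • G x) _ y :=
    ((hφ.hasFDerivAt.const_mul 2).exp).smul hG.hasFDerivAt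
  rw [hderiv.fderiv]
  change Real.exp (2 * φ y) * fderiv ℝ G y u v w +
      (Real.exp (2 * φ y) * (2 * fderiv ℝ φ y u)) * G y v w = _
  ring

theorem isInvertible_smul {A : E →L[ℝ] E →L[ℝ] ℝ} (hA : A.IsInvertible) {r : ℝ} (hr : r ≠ 0) :
    (r • A).IsInvertible := by
  obtain ⟨e, rfl⟩ := hA
  exact ⟨(ContinuousLinearEquiv.smulLeft (Units.mk0 r hr)).trans e, by ext; simp⟩

theorem christoffel_exp_smul (hG : DifferentiableAt ℝ G y) (hinv : (G y).IsInvertible)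
    (hφ : DifferentiableAt ℝ φ y) (u v : E) :
    christoffel (fun x => Real.exp (2 * φ x) • G x) y u v =
      christoffel G y u v + fderiv ℝ φ y u • v + fderiv ℝ φ y v • u
        - G y u v • metricGradient G φ y := by
  refine christoffel_eq_of_koszul (isInvertible_smul hinv (Real.exp_pos _).ne') fun w => ?_
  rw [koszul_apply, fderiv_exp_smul hG hφ, fderiv_exp_smul hG hφ, fderiv_exp_smul hG hφ]
  simp only [smul_apply, map_add, map_sub, map_smul, add_apply, sub_apply, smul_eq_mul,
    apply_christoffel hinv, apply_metricGradient hinv, koszul_apply]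
  ring

theorem christoffel_exp_smul_comp (hG : DifferentiableAt ℝ G y) (hinv : (G y).IsInvertible)
    (hφ : DifferentiableAt ℝ φ y) (huw : G y u w = 0) (hvw : G y v w = 0) :
    christoffel (fun x => Real.exp (2 * φ x) • G x) y u
        (christoffel (fun x => Real.exp (2 * φ x) • G x) y v w) =
      christoffel G y u (christoffel G y v w)
        + (fderiv ℝ φ y v • christoffel G y u w + fderiv ℝ φ y u • christoffel G y v w)
        + fderiv ℝ φ y w • christoffel G y u v
        + fderiv ℝ φ y u • (fderiv ℝ φ y v • w + fderiv ℝ φ y w • v)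
        + fderiv ℝ φ y (christoffel G y v w + fderiv ℝ φ y v • w + fderiv ℝ φ y w • v) • u
        - (G y u (christoffel G y v w) + fderiv ℝ φ y w * G y u v) • metricGradient G φ y := by
  simp only [christoffel_exp_smul hG hinv hφ, huw, hvw, map_add, map_smul, smul_eq_mul,
    zero_smul, sub_zero, mul_zero]
  module

variable [CompleteSpace E]

theorem eventually_isInvertible (hG : ContinuousAt G y) (hinv : (G y).IsInvertible) :
    ∀ᶠ x in 𝓝 y, (G x).IsInvertible := by
  obtain ⟨e, he⟩ := hinv
  exact hG.eventually (he ▸ ContinuousLinearEquiv.nhds e)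

theorem contDiffAt_metricGradient (hG : ContDiffAt ℝ ∞ G y) (hinv : (G y).IsInvertible)
    (hφ : ContDiffAt ℝ ∞ φ y) : ContDiffAt ℝ ∞ (metricGradient G φ) y :=
  (contDiffAt_inverse hG hinv).clm_apply (hφ.fderiv_right (m := ∞) (by simp))

theorem christoffel_exp_smul_eventuallyEq (hG : ContDiffAt ℝ ∞ G y) (hinv : (G y).IsInvertible)
    (hφ : ContDiffAt ℝ ∞ φ y) (v w : E) :
    (fun x => christoffel (fun x => Real.exp (2 * φ x) • G x) x v w) =ᶠ[𝓝 y]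
      fun x => christoffel G x v w + fderiv ℝ φ x v • w + fderiv ℝ φ x w • v
        - G x v w • metricGradient G φ x := by
  filter_upwards [(hG.of_le (m := 1) (by simp)).eventually (by simp),
    (hφ.of_le (m := 1) (by simp)).eventually (by simp),
    eventually_isInvertible hG.continuousAt hinv] with x hGx hφx hinvx
  exact christoffel_exp_smul (hGx.differentiableAt (by simp)) hinvx
    (hφx.differentiableAt (by simp)) v w

theorem fderiv_christoffel_exp_smul (hG : ContDiffAt ℝ ∞ G y) (hinv : (G y).IsInvertible)
    (hφ : ContDiffAt ℝ ∞ φ y) (u v w : E) :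
    fderiv ℝ (christoffel fun x => Real.exp (2 * φ x) • G x) y u v w =
      fderiv ℝ (christoffel G) y u v w + fderiv ℝ (fderiv ℝ φ) y u v • w
        + fderiv ℝ (fderiv ℝ φ) y u w • v - (fderiv ℝ G y u v w • metricGradient G φ y
        + G y v w • fderiv ℝ (metricGradient G φ) y u) := by
  have hΓ' : DifferentiableAt ℝ (christoffel fun x => Real.exp (2 * φ x) • G x) y :=
    (contDiffAt_christoffel ((contDiffAt_const.mul hφ).exp.smul hG)
      (isInvertible_smul hinv (Real.exp_pos _).ne')).differentiableAt (by simp)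
  have hΓ := ((contDiffAt_christoffel hG hinv).differentiableAt (by simp)).hasFDerivAt
  have hGd := (hG.differentiableAt (by simp)).hasFDerivAt
  have hdφ := ((hφ.fderiv_right (m := ∞) (by simp)).differentiableAt (by simp)).hasFDerivAt
  have hgrad := ((contDiffAt_metricGradient hG hinv hφ).differentiableAt (by simp)).hasFDerivAt
  have hv := hasFDerivAt_const (𝕜 := ℝ) v y
  have hw := hasFDerivAt_const (𝕜 := ℝ) w y
  have hderiv := ((((hΓ.clm_apply hv).clm_apply hw).add ((hdφ.clm_apply hv).smul_const w)).add
    ((hdφ.clm_apply hw).smul_const v)).sub (((hGd.clm_apply hv).clm_apply hw).smul hgrad)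
  rw [fderiv_clm_apply_const hΓ', fderiv_clm_apply_const (by fun_prop),
    (christoffel_exp_smul_eventuallyEq hG hinv hφ v w).fderiv_eq]
  refine (DFunLike.congr_fun hderiv.fderiv u).trans ?_
  simp only [add_apply, sub_apply, smul_apply, zero_apply, ContinuousLinearMap.smulRight_apply,
    ContinuousLinearMap.flip_apply, ContinuousLinearMap.comp_apply, map_zero, zero_add]
  abel

/-- The gradient of the conformal factor enters only through the products `⟨u, w⟩`, `⟨v, w⟩`. -/
theorem coordCurvature_exp_smul_of_orthogonal (hG : ContDiffAt ℝ ∞ G y)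
    (hinv : (G y).IsInvertible) (hsymm : ∀ᶠ x in 𝓝 y, ∀ u v, G x u v = G x v u)
    (hφ : ContDiffAt ℝ ∞ φ y) (huw : G y u w = 0) (hvw : G y v w = 0) :
    coordCurvature (fun x => Real.exp (2 * φ x) • G x) y u v w = coordCurvature G y u v w
      + (fderiv ℝ (fderiv ℝ φ) y u v - fderiv ℝ (fderiv ℝ φ) y v u) • w
      + (fderiv ℝ (fderiv ℝ φ) y u w + fderiv ℝ φ y u * fderiv ℝ φ y w
          - fderiv ℝ φ y (christoffel G y u w + fderiv ℝ φ y u • w + fderiv ℝ φ y w • u)) • v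
      + (-fderiv ℝ (fderiv ℝ φ) y v w - fderiv ℝ φ y v * fderiv ℝ φ y w
          + fderiv ℝ φ y (christoffel G y v w + fderiv ℝ φ y v • w + fderiv ℝ φ y w • v)) • u := by
  have hGd := hG.differentiableAt (by simp)
  have hφd := hφ.differentiableAt (by simp)
  rw [coordCurvature_apply, coordCurvature_apply, fderiv_christoffel_exp_smul hG hinv hφ,
    fderiv_christoffel_exp_smul hG hinv hφ, christoffel_exp_smul_comp hGd hinv hφd huw hvw,
    christoffel_exp_smul_comp hGd hinv hφd hvw huw, hvw, huw,
    fderiv_eq_christoffel_add hGd hinv hsymm u, fderiv_eq_christoffel_add hGd hinv hsymm v,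
    christoffel_comm hGd hsymm v u, hsymm.self_of_nhds v u,
    hsymm.self_of_nhds v (christoffel G y u w), hsymm.self_of_nhds u (christoffel G y v w)]
  module

theorem apply_coordCurvature_exp_smul (hG : ContDiffAt ℝ ∞ G y) (hinv : (G y).IsInvertible)
    (hsymm : ∀ᶠ x in 𝓝 y, ∀ u v, G x u v = G x v u) (hφ : ContDiffAt ℝ ∞ φ y)
    (huw : G y u w = 0) (hvw : G y v w = 0) (huz : G y u z = 0) (hvz : G y v z = 0)
    (hwz : G y w z = 0) :
    G y (coordCurvature (fun x => Real.exp (2 * φ x) • G x) y u v w) z =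
      G y (coordCurvature G y u v w) z := by
  rw [coordCurvature_exp_smul_of_orthogonal hG hinv hsymm hφ huw hvw]
  simp only [map_add, map_smul, add_apply, smul_apply, huz, hvz, hwz, smul_zero, add_zero]

end Conformal

theorem coordHerm_curvature_of_orthonormal {H : Type*} [NormedAddCommGroup H]
    [InnerProductSpace ℂ H] {t u w : H} (hu : coordHerm t u u = 1) (hw : coordHerm t w w = 1)
    (huw : coordHerm t u w = 0) :
    coordHerm t (coordHerm t (Complex.I • u) w • u - coordHerm t u w • Complex.I • u
      - (coordHerm t u (Complex.I • u) - coordHerm t (Complex.I • u) u) • w) (Complex.I • w) =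
      -2 := by
  have hcurv : coordHerm t (Complex.I • u) w • u - coordHerm t u w • Complex.I • u
      - (coordHerm t u (Complex.I • u) - coordHerm t (Complex.I • u) u) • w =
      (-2 * Complex.I) • w := by
    rw [coordHerm_smul_left, coordHerm_smul_left, coordHerm_smul_right, huw, hu, Complex.conj_I]
    module
  rw [hcurv, coordHerm_smul_left, coordHerm_smul_right, hw]
  simp only [map_mul, map_neg, Complex.conj_I, map_ofNat]
  linear_combination 2 * Complex.I_sq

/-- For Hermitian orthonormal `u`, `w` the component `⟨R(u, Ju) w, Jw⟩ = -2` cannot be removed by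
a conformal change. -/
theorem not_isLocallyConformallyFlat {n : ℕ} (hn : 2 ≤ n) :
    ¬ IsLocallyConformallyFlat (fubiniStudy n) := by
  intro hflat
  obtain ⟨p⟩ := instNonemptyCP (n := n)
  obtain ⟨U, hU, hp, f, hf, hR⟩ := hflat p
  set t := chartAt (Cn n) p p
  have hf' : ContDiffAt ℝ ∞ (fun y => f ((chartAt (Cn n) p).symm y)) t :=
    (((hf.contMDiffAt (hU.mem_nhds hp)).comp_of_eq (contMDiffAt_chartAt_symm (mem_chart_target _ p))
      ((chartAt (Cn n) p).left_inv (mem_chart_source _ p))) :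
        ContMDiffAt _ _ ∞ _ t).contDiffAt
  have hG := coordMetric_fubiniStudy p
  obtain ⟨u, w, hu, hw, huw⟩ :=
    exists_coordHerm_orthonormal (by rwa [finrank_euclideanSpace_fin]) t
  have hcurv := apply_coordCurvature_exp_smul (contDiff_of_eq_coordHerm hG).contDiffAt
    (isInvertible_of_eq_coordHerm hG t)
    (.of_forall fun y u v => by rw [hG, hG, coordHerm_re_comm]) hf'
    (u := u) (v := Complex.I • u) (w := w) (z := Complex.I • w) (by rw [hG, huw, Complex.zero_re])
    (by simp [hG, coordHerm_smul_left, huw]) (by simp [hG, coordHerm_smul_right, huw])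
    (by simp [hG, coordHerm_I_smul, huw]) (by simp [hG, coordHerm_smul_right, hw])
  have hzero : coordCurvature (fun y => Real.exp (2 * f ((chartAt (Cn n) p).symm y)) •
      coordMetric (fubiniStudy n) p y) t = 0 := hR p hp
  rw [hzero, hG t (coordCurvature _ t u _ w), coordCurvature_of_eq_coordHerm hG,
    coordHerm_curvature_of_orthonormal hu hw huw] at hcurv
  norm_num at hcurv

/-! ### The projective line -/

theorem sectional_fubiniStudy_complex_smul {n : ℕ} (p : CP n) {u : Cn n} (hu : u ≠ 0) {c : ℂ}
    (hc : c.im ≠ 0) : sectional (fubiniStudy n) p u (c • u : Cn n) = 4 := by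
  rw [sectional_fubiniStudy_eq_div]
  set t := chartAt (Cn n) p p
  set N := (coordHerm t u u).re
  have hN : 0 < N := coordHerm_self_pos t hu
  have hself : coordHerm t u u = (N : ℂ) := coordHerm_self t u
  have hright : coordHerm t u (c • u) = c * N := by rw [coordHerm_smul_right, hself]
  have hleft : coordHerm t (c • u) u = (starRingEnd ℂ) c * N := by
    rw [coordHerm_smul_left, hself]
  have hboth : coordHerm t (c • u) (c • u) = (starRingEnd ℂ) c * c * N := by
    rw [coordHerm_smul_left, hright, mul_assoc]
  have hcurv : coordHerm t (c • u) (c • u) • u - coordHerm t u (c • u) • c • u -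
      (coordHerm t u (c • u) - coordHerm t (c • u) u) • c • u =
      ((starRingEnd ℂ) c * c * N - (2 * c - (starRingEnd ℂ) c) * c * N) • u := by
    rw [hright, hleft, hboth]
    module
  have harea : N * ((starRingEnd ℂ) c * c * (N : ℂ)).re - (c * (N : ℂ)).re ^ 2 =
      (N * c.im) ^ 2 := by
    simp only [Complex.mul_re, Complex.mul_im, Complex.conj_re, Complex.conj_im,
      Complex.ofReal_re, Complex.ofReal_im]
    ring
  rw [hcurv, coordHerm_smul_left, hright, hboth, hself, harea, div_eq_iff (by positivity)]
  simp only [map_sub, map_mul, map_ofNat, Complex.conj_conj, Complex.conj_ofReal, Complex.mul_re,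
    Complex.mul_im, Complex.sub_re, Complex.sub_im, Complex.conj_re, Complex.conj_im,
    Complex.ofReal_re, Complex.ofReal_im, Complex.re_ofNat, Complex.im_ofNat]
  ring

theorem exists_smul_eq_of_ne_zero {u : Cn 1} (hu : u ≠ 0) (v : Cn 1) : ∃ c : ℂ, c • u = v :=
  (finrank_eq_one_iff_of_nonzero' u hu).1 finrank_euclideanSpace_fin v

theorem hasConstantSectionalCurvature_CP_one :
    HasConstantSectionalCurvature (fubiniStudy 1) 4 := by
  intro p (u : Cn 1) (v : Cn 1) huv
  replace huv : LinearIndependent ℝ ![u, v] := huv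
  have hu : u ≠ 0 := huv.ne_zero 0
  obtain ⟨c, rfl⟩ := exists_smul_eq_of_ne_zero hu v
  refine sectional_fubiniStudy_complex_smul p hu fun hc => ?_
  have hreal : c • u = c.re • u :=
    congrArg (· • u) (Complex.ext rfl (by simpa using hc) : c = (c.re : ℂ))
  exact one_ne_zero (LinearIndependent.pair_iff.1 huv (-c.re) 1 (by rw [hreal]; module)).2

section ComplexLine

variable {H : Type*} [NormedAddCommGroup H] [NormedSpace ℝ H] {G : H → H →L[ℝ] H →L[ℝ] ℝ} {y : H}

/-- For a connection form `θ` of complex scalars the quadratic terms of the curvature commute away,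
and what is left is `dθ`. -/
theorem coordCurvature_eq_zero_of_christoffel_eq_smul [NormedSpace ℂ H] [IsScalarTower ℝ ℂ H]
    {θ : H → H →L[ℝ] ℂ} (hθ : DifferentiableAt ℝ θ y)
    (hclosed : ∀ u v, fderiv ℝ θ y u v = fderiv ℝ θ y v u)
    (hΓ : ∀ᶠ x in 𝓝 y, ∀ u v, christoffel G x u v = θ x u • v) : coordCurvature G y = 0 := by
  have hΓ' : christoffel G =ᶠ[𝓝 y] fun x => ContinuousLinearMap.lsmul ℝ ℂ ∘L θ x :=
    hΓ.mono fun x hx => by ext u v; exact hx u v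
  have hderiv : fderiv ℝ (christoffel G) y =
      ContinuousLinearMap.compL ℝ H ℂ (H →L[ℝ] H) (ContinuousLinearMap.lsmul ℝ ℂ) ∘L
        fderiv ℝ θ y := by
    rw [hΓ'.fderiv_eq]
    exact ((ContinuousLinearMap.compL ℝ H ℂ (H →L[ℝ] H)
      (ContinuousLinearMap.lsmul ℝ ℂ)).hasFDerivAt.comp y hθ.hasFDerivAt).fderiv
  ext u v w
  rw [coordCurvature_apply, hderiv]
  simp only [hΓ.self_of_nhds, ContinuousLinearMap.comp_apply, ContinuousLinearMap.compL_apply,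
    ContinuousLinearMap.lsmul_apply, hclosed v u, smul_comm (θ y v)]
  simp

variable [InnerProductSpace ℂ H] [FiniteDimensional ℝ H] {c : H → ℂ}

theorem christoffel_eq_smul_of_eq_inner_smul {θ : H →L[ℝ] ℂ} (hGd : DifferentiableAt ℝ G y)
    (hc : DifferentiableAt ℝ c y) (hy : c y ≠ 0)
    (hG : ∀ᶠ x in 𝓝 y, ∀ u v, G x u v = (inner ℂ (c x • u) (c x • v)).re)
    (hθ : ∀ u, fderiv ℝ c y u = θ u * c y) (hcomm : ∀ u v : H, θ u • v = θ v • u) (u v : H) :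
    christoffel G y u v = θ u • v := by
  have hGy := hG.self_of_nhds
  have hpos (v : H) (hv : v ≠ 0) : 0 < G y v v := by
    rw [hGy]
    exact (re_inner_self_pos (𝕜 := ℂ)).2 (smul_ne_zero hy hv)
  refine christoffel_eq_of_compatible (isInvertible_of_pos hpos) (fun u v => ?_) hcomm
    (fun u v w => ?_) u v
  · rw [hGy, hGy, ← inner_conj_symm, Complex.conj_re]
  · have hnear : (fun x => G x v w) =ᶠ[𝓝 y] fun x => (inner ℂ (c x • v) (c x • w)).re :=
      hG.mono fun x hx => hx v w
    have hderiv := (Complex.reCLM.hasFDerivAt (x := inner ℂ (c y • v) (c y • w))).comp y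
      ((hc.hasFDerivAt.smul_const v).inner ℂ (hc.hasFDerivAt.smul_const w))
    rw [fderiv_clm_apply_const hGd, fderiv_clm_apply_const (by fun_prop), hnear.fderiv_eq, hGy,
      hGy, smul_comm, smul_comm (c y), ← Complex.add_re]
    refine (DFunLike.congr_fun hderiv.fderiv u).trans ?_
    simp only [ContinuousLinearMap.comp_apply, ContinuousLinearMap.prod_apply,
      ContinuousLinearMap.smulRight_apply, fderivInnerCLM_apply, hθ, mul_smul, Complex.reCLM_apply,
      add_comm]

theorem clm_smul_comm {V : Type*} [AddCommGroup V] [Module ℂ V] (hV : Module.finrank ℂ V = 1)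
    (f : V →ₗ[ℂ] ℂ) (u v : V) : f u • v = f v • u := by
  rcases eq_or_ne u 0 with rfl | hu
  · simp
  · obtain ⟨a, rfl⟩ := (finrank_eq_one_iff_of_nonzero' u hu).1 hV v
    rw [map_smul, smul_eq_mul, smul_smul, mul_comm]

theorem coordCurvature_eq_zero_of_eq_inner_smul [IsScalarTower ℝ ℂ H]
    (hH : Module.finrank ℂ H = 1) {O : Set H}
    (hO : IsOpen O) (hc : ContDiffOn ℂ ∞ c O) (hne : ∀ x ∈ O, c x ≠ 0)
    (hG : ∀ x ∈ O, ∀ u v, G x u v = (inner ℂ (c x • u) (c x • v)).re) (hy : y ∈ O) :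
    coordCurvature G y = 0 := by
  have hcC (x : H) (hx : x ∈ O) : DifferentiableAt ℂ c x :=
    (hc.contDiffAt (hO.mem_nhds hx)).differentiableAt (by simp)
  have hcR : ContDiffOn ℝ ∞ c O := hc.restrict_scalars ℝ
  have hcy : ContDiffAt ℝ ∞ c y := hcR.contDiffAt (hO.mem_nhds hy)
  have hGsmooth : ContDiffOn ℝ ∞ G O :=
    contDiffOn_clm_apply.2 fun u => contDiffOn_clm_apply.2 fun v =>
      (Complex.reCLM.contDiff.comp_contDiffOn ((hcR.smul contDiffOn_const).inner ℂ
        (hcR.smul contDiffOn_const))).congr fun x hx => hG x hx u v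
  have hd : DifferentiableAt ℝ (fderiv ℝ c) y :=
    (hcy.fderiv_right (m := ∞) (by simp)).differentiableAt (by simp)
  have hinv : HasFDerivAt (fun x => (c x)⁻¹) (-(c y ^ 2)⁻¹ • fderiv ℝ c y) y :=
    (hasDerivAt_inv (hne y hy)).comp_hasFDerivAt y (hcy.differentiableAt (by simp)).hasFDerivAt
  refine coordCurvature_eq_zero_of_christoffel_eq_smul (θ := fun x => (c x)⁻¹ • fderiv ℝ c x)
    (hinv.differentiableAt.smul hd) (fun u v => ?_) ?_
  · have hsymm : fderiv ℝ (fderiv ℝ c) y u v = fderiv ℝ (fderiv ℝ c) y v u :=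
      ((contDiffAt_infty.1 hcy 2).isSymmSndFDerivAt (by simp)).eq u v
    rw [(hinv.fun_smul hd.hasFDerivAt).fderiv]
    simp [hsymm, mul_comm, mul_left_comm]
  · filter_upwards [hO.mem_nhds hy] with x hx u v
    refine christoffel_eq_smul_of_eq_inner_smul
      ((hGsmooth.contDiffAt (hO.mem_nhds hx)).differentiableAt (by simp))
      ((hcC x hx).restrictScalars ℝ) (hne x hx)
      (Filter.mem_of_superset (hO.mem_nhds hx) hG) (fun u => ?_) (fun u v => ?_) u v
    · have := hne x hx
      simp [field]
    · rw [(hcC x hx).fderiv_restrictScalars ℝ]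
      simpa [mul_smul] using
        congrArg ((c x)⁻¹ • ·) (clm_smul_comm hH (fderiv ℂ c x).toLinearMap u v)

end ComplexLine

theorem coordHerm_one (t u v : Cn 1) : coordHerm t u v = conformalFactor t ^ 2 * inner ℂ u v := by
  have h : conformalFactor t * (1 + inner ℂ t t) = 1 :=
    inv_mul_cancel₀ (one_add_inner_self_ne_zero t)
  have hswap : inner ℂ u t * inner ℂ t v = inner ℂ t t * inner ℂ u v := by
    simp only [PiLp.inner_apply, Fin.sum_univ_one, RCLike.inner_apply]
    ring
  rw [coordHerm, hswap]
  linear_combination (-conformalFactor t * inner ℂ u v) * h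

theorem contMDiffOn_affineMap {n : ℕ} (i : Fin (n + 1)) :
    ContMDiffOn 𝓘(ℝ, Cn n) 𝓘(ℝ, Cn n) ∞ (affineMap (n := n) i) (affineSet i) :=
  contMDiffOn_of_mem_maximalAtlas (e := affineChart i)
    (IsManifold.subset_maximalAtlas (Set.mem_range_self i))

/-- The conformal factor between two affine charts is the modulus of a holomorphic function. -/
theorem coordMetric_exp_smul_fubiniStudy_one (i : Fin 2) (q : CP 1) {y : Cn 1}
    (hy : affineLift (chartIndex q) y i ≠ 0) (u v : Cn 1) :
    coordMetric (fun x => Real.exp (2 * Real.log (1 + ‖affineMap i x‖ ^ 2)) •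
        fubiniStudy 1 x : TensorField (Cn 1) (CP 1)) q y u v =
      (inner ℂ ((affineLift (chartIndex q) y i ^ 2)⁻¹ • u)
        ((affineLift (chartIndex q) y i ^ 2)⁻¹ • v)).re := by
  set k := chartIndex q
  have hcoord : affineMap i ((chartAt (Cn 1) q).symm y) = affineCoord i (affineLift k y) := rfl
  have hz : 0 < ‖affineLift k y‖ := norm_pos_iff.2 (affineLift_ne_zero k y)
  trans Real.exp (2 * Real.log (1 + ‖affineMap i ((chartAt (Cn 1) q).symm y)‖ ^ 2)) *
    coordMetric (fubiniStudy 1) q y u v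
  · rfl
  rw [hcoord, coordMetric_fubiniStudy, ← norm_affineLift_sq i, affineLift_affineCoord hy,
    coordHerm_one, ← Complex.re_ofReal_mul, conformalFactor_eq, ← norm_affineLift_sq k,
    inner_smul_left, inner_smul_right, ← mul_assoc, ← mul_assoc, Complex.conj_mul', two_mul,
    Real.exp_add, Real.exp_log (by rw [norm_smul, norm_inv]; positivity), norm_smul]
  congr 2
  norm_cast
  simp only [norm_inv, norm_pow]
  field_simp

theorem isLocallyConformallyFlat_CP_one : IsLocallyConformallyFlat (fubiniStudy 1) := by
  intro p
  set i := chartIndex p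
  refine ⟨affineSet i, isOpen_affineSet i, chartIndex_mem p,
    fun q => Real.log (1 + ‖affineMap i q‖ ^ 2), ?_, fun q hq => ?_⟩
  · have hlog : ContDiff ℝ ∞ (fun x : Cn 1 => Real.log (1 + ‖x‖ ^ 2)) :=
      (contDiff_const.add (contDiff_norm_sq ℂ)).log fun x => by positivity
    exact hlog.contMDiff.comp_contMDiffOn (contMDiffOn_affineMap i)
  · set k := chartIndex q
    have hlift : ContDiff ℂ ∞ fun y : Cn 1 => affineLift k y i :=
      contDiff_const.add ((EuclideanSpace.proj (𝕜 := ℂ) i ∘L slot k).contDiff)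
    have hq' : affineLift k (chartAt (Cn 1) q q) i ≠ 0 := by
      rw [← proj_mem_affineSet (affineLift_ne_zero k _), proj_affineLift]
      exact ((chartAt (Cn 1) q).left_inv (mem_chart_source _ q)).symm ▸ hq
    exact coordCurvature_eq_zero_of_eq_inner_smul finrank_euclideanSpace_fin
      (O := {y | affineLift k y i ≠ 0}) (isOpen_ne_fun hlift.continuous continuous_const)
      ((hlift.contDiffOn.pow 2).inv fun y hy => pow_ne_zero 2 hy)
      (fun y hy => inv_ne_zero (pow_ne_zero 2 hy))
      (fun y hy => coordMetric_exp_smul_fubiniStudy_one i q hy) hq'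

/-! ### Maps out of projective space -/

section Proj

variable {n : ℕ} {z : Cn (n + 1)}

theorem exists_contMDiffAt_section_proj (hz : z ≠ 0) :
    ∃ σ : CP n → Cn (n + 1), ContMDiffAt 𝓘(ℝ, Cn n) 𝓘(ℝ, Cn (n + 1)) ∞ σ (proj n z) ∧
      σ (proj n z) = z ∧ ∀ᶠ q in 𝓝 (proj n z), proj n (σ q) = q := by
  set i := chartIndex (proj n z)
  have hi : z i ≠ 0 := chartIndex_proj_ne hz
  have hnhds : affineSet i ∈ 𝓝 (proj n z) := (isOpen_affineSet i).mem_nhds (chartIndex_mem _)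
  have hlift : ContDiff ℝ ∞ (fun t : Cn n => z i • affineLift i t) :=
    (contDiff_const.add ((slot i).restrictScalars ℝ).contDiff).const_smul (z i)
  refine ⟨fun q => z i • affineLift i (affineMap i q),
    hlift.contMDiff.contMDiffAt.comp _ ((contMDiffOn_affineMap i).contMDiffAt hnhds), ?_, ?_⟩
  · change z i • affineLift i (affineMap i (proj n z)) = z
    rw [affineMap_proj i hz, affineLift_affineCoord hi, smul_inv_smul₀ hi]
  · filter_upwards [hnhds] with q hq
    change proj n (z i • affineLift i (affineMap i q)) = q
    rw [proj_smul hi (affineLift_ne_zero _ _), proj_affineLift]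
    exact (affineChart i).left_inv hq

theorem contMDiffAt_of_comp_proj {E N : Type*} [NormedAddCommGroup E] [NormedSpace ℝ E]
    [TopologicalSpace N] [ChartedSpace E N] {f : CP n → N} (hz : z ≠ 0)
    (hf : ContMDiffAt 𝓘(ℝ, Cn (n + 1)) 𝓘(ℝ, E) ∞ (fun z => f (proj n z)) z) :
    ContMDiffAt 𝓘(ℝ, Cn n) 𝓘(ℝ, E) ∞ f (proj n z) := by
  obtain ⟨σ, hσ, hσz, hproj⟩ := exists_contMDiffAt_section_proj hz
  refine (ContMDiffAt.comp (g := fun z => f (proj n z)) (proj n z) (hσz.symm ▸ hf)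
    hσ).congr_of_eventuallyEq ?_
  filter_upwards [hproj] with q hq
  exact congrArg f hq.symm

theorem fubiniStudy_dproj (hz : z ≠ 0) (v w : Cn (n + 1)) :
    (fubiniStudy n (proj n z) : Cn n →L[ℝ] Cn n →L[ℝ] ℝ) (dproj z v) (dproj z w) =
      (hermForm z v w).re :=
  (pullback_apply_of_hasMFDerivAt (hasMFDerivAt_proj hz) _ v w).symm.trans (pullback_proj hz v w)

theorem fubiniStudy_symm (p : CP n) (u v : Cn n) :
    (fubiniStudy n p : Cn n →L[ℝ] Cn n →L[ℝ] ℝ) u v =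
      (fubiniStudy n p : Cn n →L[ℝ] Cn n →L[ℝ] ℝ) v u :=
  (fubiniStudy_eq_coordHerm p u v).trans
    ((coordHerm_re_comm _ _ _).trans (fubiniStudy_eq_coordHerm p v u).symm)

theorem fubiniStudy_pos (p : CP n) {u : Cn n} (hu : u ≠ 0) :
    0 < (fubiniStudy n p : Cn n →L[ℝ] Cn n →L[ℝ] ℝ) u u :=
  (coordHerm_self_pos _ hu).trans_eq (fubiniStudy_eq_coordHerm p u u).symm

end Proj

/-! ### The Hopf map -/

section Hopf

/-- The Hopf map `z ↦ (2 z̄₀ z₁, |z₀|² - |z₁|²) / |z|²` from `ℂ² ∖ {0}` to the unit sphere of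
`ℂ × ℝ = ℝ³`. -/
noncomputable def hopf (z : Cn 2) : EuclideanSpace ℝ (Fin 3) :=
  (‖z‖ ^ 2)⁻¹ • !₂[2 * ((starRingEnd ℂ) (z 0) * z 1).re, 2 * ((starRingEnd ℂ) (z 0) * z 1).im,
    Complex.normSq (z 0) - Complex.normSq (z 1)]

variable {z w : Cn 2}

theorem norm_sq_eq_normSq_add (z : Cn 2) :
    ‖z‖ ^ 2 = Complex.normSq (z 0) + Complex.normSq (z 1) := by
  simp [EuclideanSpace.norm_sq_eq, Complex.normSq_eq_norm_sq]

/-- Everything about the Hopf map follows from this formula, since it determines all distances in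
the image. -/
theorem inner_hopf (hz : z ≠ 0) (hw : w ≠ 0) :
    inner ℝ (hopf z) (hopf w) = 2 * ‖inner ℂ z w‖ ^ 2 / (‖z‖ ^ 2 * ‖w‖ ^ 2) - 1 := by
  rw [hopf, hopf, real_inner_smul_left, real_inner_smul_right, ← Complex.normSq_eq_norm_sq]
  field_simp
  rw [norm_sq_eq_normSq_add, norm_sq_eq_normSq_add]
  simp [PiLp.inner_apply, Fin.sum_univ_three, Complex.normSq_apply]
  ring

theorem norm_hopf (hz : z ≠ 0) : ‖hopf z‖ = 1 := by
  have hz' : ‖z‖ ≠ 0 := norm_ne_zero_iff.2 hz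
  rw [← sq_eq_sq₀ (norm_nonneg _) zero_le_one, ← real_inner_self_eq_norm_sq, inner_hopf hz hz,
    inner_self_complex, norm_pow, Complex.norm_real, norm_norm]
  field_simp
  norm_num

theorem norm_hopf_sub_sq (hz : z ≠ 0) (hw : w ≠ 0) :
    ‖hopf w - hopf z‖ ^ 2 =
      4 * (‖z‖ ^ 2 * ‖w‖ ^ 2 - ‖inner ℂ z w‖ ^ 2) / (‖z‖ ^ 2 * ‖w‖ ^ 2) := by
  have hz' : ‖z‖ ≠ 0 := norm_ne_zero_iff.2 hz
  have hw' : ‖w‖ ≠ 0 := norm_ne_zero_iff.2 hw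
  rw [norm_sub_sq_real, norm_hopf hz, norm_hopf hw, real_inner_comm, inner_hopf hz hw]
  field_simp
  ring

theorem hopf_eq_iff (hz : z ≠ 0) (hw : w ≠ 0) : hopf z = hopf w ↔ ∃ r : ℂ, r ≠ 0 ∧ w = r • z := by
  have hz' : ‖z‖ ≠ 0 := norm_ne_zero_iff.2 hz
  have hw' : ‖w‖ ≠ 0 := norm_ne_zero_iff.2 hw
  rw [← norm_inner_eq_norm_iff hz hw, ← inner_eq_one_iff_of_norm_eq_one (𝕜 := ℝ) (norm_hopf hz)
    (norm_hopf hw), inner_hopf hz hw, ← sq_eq_sq₀ (norm_nonneg _) (by positivity), mul_pow]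
  field_simp
  constructor <;> intro h <;> linarith

theorem hopf_smul {c : ℂ} (hc : c ≠ 0) (hz : z ≠ 0) : hopf (c • z) = hopf z :=
  ((hopf_eq_iff hz (smul_ne_zero hc hz)).2 ⟨c, hc, rfl⟩).symm

theorem contDiffAt_hopf (hz : z ≠ 0) : ContDiffAt ℝ ∞ hopf z := by
  have hcoord (j : Fin 2) : ContDiff ℝ ∞ (fun z : Cn 2 => z j) :=
    ((EuclideanSpace.proj (𝕜 := ℂ) j : Cn 2 →L[ℂ] ℂ).restrictScalars ℝ).contDiff
  have hprod : ContDiff ℝ ∞ (fun z : Cn 2 => (starRingEnd ℂ) (z 0) * z 1) :=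
    (Complex.conjCLE.contDiff.comp (hcoord 0)).mul (hcoord 1)
  have hnormSq (j : Fin 2) : ContDiff ℝ ∞ (fun z : Cn 2 => Complex.normSq (z j)) := by
    simp only [Complex.normSq_eq_norm_sq]
    exact (contDiff_norm_sq ℂ).comp (hcoord j)
  refine ContDiffAt.smul ((contDiff_norm_sq ℂ).contDiffAt.inv (by simpa using hz)) ?_
  rw [contDiffAt_piLp]
  intro j
  fin_cases j
  · exact (contDiff_const.mul (Complex.reCLM.contDiff.comp hprod)).contDiffAt
  · exact (contDiff_const.mul (Complex.imCLM.contDiff.comp hprod)).contDiffAt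
  · exact ((hnormSq 0).sub (hnormSq 1)).contDiffAt

theorem norm_sq_mul_norm_add_smul_sq_sub {H : Type*} [NormedAddCommGroup H]
    [InnerProductSpace ℂ H] (z v : H) (s : ℝ) :
    ‖z‖ ^ 2 * ‖z + s • v‖ ^ 2 - ‖(inner ℂ z (z + s • v) : ℂ)‖ ^ 2 =
      s ^ 2 * (‖z‖ ^ 2 * ‖v‖ ^ 2 - ‖(inner ℂ z v : ℂ)‖ ^ 2) := by
  have hinner : inner ℂ z (z + s • v) = ((‖z‖ ^ 2 : ℝ) : ℂ) + s * inner ℂ z v := by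
    rw [inner_add_right, inner_smul_right_eq_smul, inner_self_complex, Complex.real_smul,
      Complex.ofReal_pow]
  rw [hinner, ← Complex.normSq_eq_norm_sq, ← Complex.normSq_eq_norm_sq,
    norm_add_sq (𝕜 := ℂ), inner_smul_right_eq_smul, norm_smul, Complex.normSq_apply,
    Complex.normSq_apply]
  simp only [Complex.add_re, Complex.add_im, Complex.ofReal_re, Complex.ofReal_im,
    Complex.re_ofReal_mul, Complex.im_ofReal_mul, RCLike.re_to_complex, Complex.smul_re,
    smul_eq_mul, Real.norm_eq_abs, mul_pow, sq_abs]
  ring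

theorem hermForm_self_re {H : Type*} [NormedAddCommGroup H] [InnerProductSpace ℂ H] {z : H}
    (hz : z ≠ 0) (v : H) :
    (hermForm z v v).re = (‖z‖ ^ 2 * ‖v‖ ^ 2 - ‖(inner ℂ z v : ℂ)‖ ^ 2) / ‖z‖ ^ 4 := by
  have hz' : ‖z‖ ≠ 0 := norm_ne_zero_iff.2 hz
  have hcast : hermForm z v v =
      ((‖v‖ ^ 2 / ‖z‖ ^ 2 - ‖(inner ℂ z v : ℂ)‖ ^ 2 / ‖z‖ ^ 4 : ℝ) : ℂ) := by
    rw [hermForm, inner_self_complex, ← inner_conj_symm v z, Complex.conj_mul']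
    push_cast
    rfl
  rw [hcast, Complex.ofReal_re]
  field_simp

theorem norm_fderiv_hopf_sq (hz : z ≠ 0) (v : Cn 2) :
    ‖fderiv ℝ hopf z v‖ ^ 2 = 4 * (hermForm z v v).re := by
  have hline : HasDerivAt (fun s : ℝ => hopf (z + s • v)) (fderiv ℝ hopf z v) 0 :=
    ((contDiffAt_hopf hz).differentiableAt (by simp)).hasFDerivAt.hasLineDerivAt v
  have hcont : ContinuousAt (fun s : ℝ => z + s • v) 0 := by fun_prop
  have hne : ∀ᶠ s : ℝ in 𝓝 0, z + s • v ≠ 0 := hcont.eventually_ne (by simpa using hz)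
  have hquot : (fun s : ℝ => 4 * (‖z‖ ^ 2 * ‖v‖ ^ 2 - ‖(inner ℂ z v : ℂ)‖ ^ 2) /
      (‖z‖ ^ 2 * ‖z + s • v‖ ^ 2)) =ᶠ[𝓝[≠] 0]
      fun s => ‖s⁻¹ • (hopf (z + (0 + s) • v) - hopf (z + (0 : ℝ) • v))‖ ^ 2 := by
    filter_upwards [hne.filter_mono nhdsWithin_le_nhds, self_mem_nhdsWithin] with s hs hs0
    have hs0 : s ≠ 0 := hs0
    rw [zero_add, zero_smul, add_zero, norm_smul, mul_pow, norm_hopf_sub_sq hz hs,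
      norm_sq_mul_norm_add_smul_sq_sub, norm_inv, inv_pow, Real.norm_eq_abs, sq_abs]
    field_simp
  have hlim : Tendsto (fun s : ℝ => 4 * (‖z‖ ^ 2 * ‖v‖ ^ 2 - ‖(inner ℂ z v : ℂ)‖ ^ 2) /
      (‖z‖ ^ 2 * ‖z + s • v‖ ^ 2)) (𝓝 0) (𝓝 (4 * (hermForm z v v).re)) := by
    have : ContinuousAt (fun s : ℝ => 4 * (‖z‖ ^ 2 * ‖v‖ ^ 2 - ‖(inner ℂ z v : ℂ)‖ ^ 2) /
      (‖z‖ ^ 2 * ‖z + s • v‖ ^ 2)) 0 :=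
      continuousAt_const.div (continuousAt_const.mul (hcont.norm.pow 2)) (by simpa using hz)
    convert this.tendsto using 2
    rw [hermForm_self_re hz, zero_smul, add_zero, mul_div_assoc]
    ring_nf
  exact tendsto_nhds_unique ((hasDerivAt_iff_tendsto_slope_zero.1 hline).norm.pow 2)
    ((hlim.mono_left nhdsWithin_le_nhds).congr' hquot)

/-- The map from the projective line to the unit sphere induced by the Hopf map. -/
noncomputable def hopfMap (p : CP 1) : Metric.sphere (0 : EuclideanSpace ℝ (Fin 3)) 1 :=
  ⟨hopf p.rep, mem_sphere_zero_iff_norm.2 (norm_hopf p.rep_nonzero)⟩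

theorem coe_hopfMap_proj (hz : z ≠ 0) : (hopfMap (proj 1 z)).1 = hopf z := by
  rw [proj_of_ne hz]
  obtain ⟨c, hc⟩ := Projectivization.exists_smul_eq_mk_rep ℂ z hz
  change hopf (Projectivization.mk ℂ z hz).rep = _
  rw [← hc, Units.smul_def, hopf_smul c.ne_zero hz]

theorem coe_hopfMap_comp_proj_eventuallyEq (hz : z ≠ 0) :
    (fun z => (hopfMap (proj 1 z)).1) =ᶠ[𝓝 z] hopf := by
  filter_upwards [isOpen_ne.mem_nhds hz] with y hy using coe_hopfMap_proj hy

theorem contMDiff_coe_hopfMap :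
    ContMDiff 𝓘(ℝ, Cn 1) 𝓘(ℝ, EuclideanSpace ℝ (Fin 3)) ∞ (fun p => (hopfMap p).1) := by
  intro p
  obtain ⟨z, hz, rfl⟩ := exists_proj_eq p
  have hz0 : z ≠ 0 := norm_ne_zero_iff.1 (by simp [hz])
  exact contMDiffAt_of_comp_proj hz0 ((contDiffAt_hopf hz0).contMDiffAt.congr_of_eventuallyEq
    (coe_hopfMap_comp_proj_eventuallyEq hz0))

theorem contMDiff_hopfMap :
    ContMDiff 𝓘(ℝ, Cn 1) 𝓘(ℝ, EuclideanSpace ℝ (Fin 2)) ∞ hopfMap := by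
  have : Fact (Module.finrank ℝ (EuclideanSpace ℝ (Fin 3)) = 2 + 1) := ⟨by simp⟩
  exact contMDiff_coe_hopfMap.codRestrict_sphere fun p => (hopfMap p).2

theorem hopfMap_injective : Function.Injective hopfMap := by
  intro p q hpq
  obtain ⟨z, hz, rfl⟩ := exists_proj_eq p
  obtain ⟨w, hw, rfl⟩ := exists_proj_eq q
  have hz0 : z ≠ 0 := norm_ne_zero_iff.1 (by simp [hz])
  have hw0 : w ≠ 0 := norm_ne_zero_iff.1 (by simp [hw])
  have hhopf : hopf z = hopf w := by
    rw [← coe_hopfMap_proj hz0, ← coe_hopfMap_proj hw0, hpq]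
  obtain ⟨r, hr, rfl⟩ := (hopf_eq_iff hz0 hw0).1 hhopf
  exact (proj_smul hr hz0).symm

/-- Away from the south pole the preimage is `(1 + x₂, x₀ + i x₁)`, by stereographic projection. -/
theorem exists_hopf_eq {x : EuclideanSpace ℝ (Fin 3)} (hx : ‖x‖ = 1) : ∃ z ≠ 0, hopf z = x := by
  have hsum : x 0 ^ 2 + x 1 ^ 2 + x 2 ^ 2 = 1 := by
    simpa [hx, Fin.sum_univ_three] using (EuclideanSpace.norm_sq_eq x).symm
  by_cases hpole : 1 + x 2 = 0
  · have h2 : x 2 = -1 := by linarith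
    have h0 : x 0 = 0 := by nlinarith [sq_nonneg (x 0), sq_nonneg (x 1)]
    have h1 : x 1 = 0 := by nlinarith [sq_nonneg (x 0), sq_nonneg (x 1)]
    refine ⟨!₂[0, 1], fun h => by simpa using congrArg (fun x : Cn 2 => x 1) h, ?_⟩
    rw [hopf, norm_sq_eq_normSq_add]
    ext j
    fin_cases j <;> simp [h0, h1, h2]
  · refine ⟨!₂[((1 + x 2 : ℝ) : ℂ), ⟨x 0, x 1⟩], fun h => hpole ?_, ?_⟩
    · exact Complex.ofReal_eq_zero.1 (congrArg (fun z : Cn 2 => z 0) h)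
    have hnorm : ‖(!₂[((1 + x 2 : ℝ) : ℂ), ⟨x 0, x 1⟩] : Cn 2)‖ ^ 2 = 2 * (1 + x 2) := by
      rw [norm_sq_eq_normSq_add]
      simp [Complex.normSq_apply]
      linarith
    rw [hopf, hnorm]
    ext j
    fin_cases j
    · simp; field_simp
    · simp; field_simp
    · simp [Complex.normSq_apply]
      field_simp
      linarith

theorem hopfMap_surjective : Function.Surjective hopfMap := by
  rintro ⟨x, hx⟩
  obtain ⟨z, hz, rfl⟩ := exists_hopf_eq (mem_sphere_zero_iff_norm.1 hx)
  exact ⟨proj 1 z, Subtype.ext (coe_hopfMap_proj hz)⟩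

theorem norm_mfderiv_coe_hopfMap_sq (p : CP 1) (u : Cn 1) :
    norm (E := EuclideanSpace ℝ (Fin 3))
      ((mfderiv 𝓘(ℝ, Cn 1) 𝓘(ℝ, EuclideanSpace ℝ (Fin 3)) (fun p => (hopfMap p).1) p :
        Cn 1 →L[ℝ] EuclideanSpace ℝ (Fin 3)) u) ^ 2 =
      4 * (fubiniStudy 1 p : Cn 1 →L[ℝ] Cn 1 →L[ℝ] ℝ) u u := by
  obtain ⟨z, hz, rfl⟩ := exists_proj_eq p
  have hz0 : z ≠ 0 := norm_ne_zero_iff.1 (by simp [hz])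
  obtain ⟨v, -, rfl⟩ := exists_dproj_eq hz u
  have hcomp := ((contMDiff_coe_hopfMap (proj 1 z)).mdifferentiableAt
    (by simp)).hasMFDerivAt.comp z (hasMFDerivAt_proj hz0)
  have hhopf : HasMFDerivAt 𝓘(ℝ, Cn 2) 𝓘(ℝ, EuclideanSpace ℝ (Fin 3))
      (fun z => (hopfMap (proj 1 z)).1) z (fderiv ℝ hopf z) :=
    ((contDiffAt_hopf hz0).differentiableAt (by simp)).hasFDerivAt.hasMFDerivAt
      |>.congr_of_eventuallyEq (coe_hopfMap_comp_proj_eventuallyEq hz0)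
  rw [fubiniStudy_dproj hz0, ← norm_fderiv_hopf_sq hz0]
  exact congrArg (fun x : EuclideanSpace ℝ (Fin 3) => ‖x‖ ^ 2)
    (DFunLike.congr_fun (hasMFDerivAt_unique hcomp hhopf) v)

theorem pullback_hopfMap : pullback hopfMap roundMetric = fun p => (4 : ℝ) • fubiniStudy 1 p := by
  have : Fact (Module.finrank ℝ (EuclideanSpace ℝ (Fin 3)) = 2 + 1) := ⟨by simp⟩
  funext p
  have hcomp := mfderiv_comp p ((contMDiff_coe_sphere (m := ∞) (n := 2)
    (hopfMap p)).mdifferentiableAt (by simp)) ((contMDiff_hopfMap p).mdifferentiableAt (by simp))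
  refine eq_of_symm_of_apply_self_eq (E := Cn 1) (A := pullback hopfMap roundMetric p)
    (B := (4 : ℝ) • fubiniStudy 1 p) (fun u v => ?_) (fun u v => ?_) fun u => ?_
  · exact real_inner_comm (F := EuclideanSpace ℝ (Fin 3)) _ _
  · exact congrArg (4 * ·) (fubiniStudy_symm p u v)
  · refine Eq.trans ?_ (norm_mfderiv_coe_hopfMap_sq p u)
    exact (real_inner_self_eq_norm_sq (F := EuclideanSpace ℝ (Fin 3)) _).trans
      (congrArg (fun x : EuclideanSpace ℝ (Fin 3) => ‖x‖ ^ 2) (DFunLike.congr_fun hcomp u).symm)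

theorem mfderiv_hopfMap_bijective (p : CP 1) :
    Function.Bijective (mfderiv 𝓘(ℝ, Cn 1) 𝓘(ℝ, EuclideanSpace ℝ (Fin 2)) hopfMap p :
        Cn 1 →L[ℝ] EuclideanSpace ℝ (Fin 2)) := by
  set D : Cn 1 →L[ℝ] EuclideanSpace ℝ (Fin 2) :=
    mfderiv 𝓘(ℝ, Cn 1) 𝓘(ℝ, EuclideanSpace ℝ (Fin 2)) hopfMap p
  have hpull (u : Cn 1) : (roundMetric (hopfMap p) : EuclideanSpace ℝ (Fin 2) →L[ℝ]
      EuclideanSpace ℝ (Fin 2) →L[ℝ] ℝ) (D u) (D u) =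
      4 * (fubiniStudy 1 p : Cn 1 →L[ℝ] Cn 1 →L[ℝ] ℝ) u u :=
    DFunLike.congr_fun (DFunLike.congr_fun (congrFun pullback_hopfMap p) u) u
  have hinj : Function.Injective D := by
    refine (injective_iff_map_eq_zero D).2 fun u hu => ?_
    by_contra h0
    have hzero (R : EuclideanSpace ℝ (Fin 2) →L[ℝ] EuclideanSpace ℝ (Fin 2) →L[ℝ] ℝ) :
        R (D u) (D u) = 0 := by rw [hu, map_zero]
    linarith [(hzero _).symm.trans (hpull u), fubiniStudy_pos p h0]
  have hrank : Module.finrank ℝ (Cn 1) = Module.finrank ℝ (EuclideanSpace ℝ (Fin 2)) := by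
    rw [← Module.finrank_mul_finrank ℝ ℂ (Cn 1)]
    simp
  exact ⟨hinj, (LinearMap.injective_iff_surjective_of_finrank_eq_finrank
    (f := (D : Cn 1 →ₗ[ℝ] EuclideanSpace ℝ (Fin 2))) hrank).1 hinj⟩

theorem exists_isometry_sphere :
    ∃ Φ : Diffeomorph 𝓘(ℝ, Cn 1) 𝓘(ℝ, EuclideanSpace ℝ (Fin 2)) (CP 1)
        (Metric.sphere (0 : EuclideanSpace ℝ (Fin 3)) 1) ∞,
        pullback Φ roundMetric = fun p => (4 : ℝ) • fubiniStudy 1 p := by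
  have : Fact (Module.finrank ℝ (EuclideanSpace ℝ (Fin 3)) = 2 + 1) := ⟨by simp⟩
  obtain ⟨Φ, hΦ⟩ := exists_diffeomorph_of_bijective contMDiff_hopfMap (by simp)
    ⟨hopfMap_injective, hopfMap_surjective⟩ mfderiv_hopfMap_bijective
  exact ⟨Φ, by rw [hΦ]; exact pullback_hopfMap⟩

end Hopf

/-! ### The action of the special unitary group -/

section SpecialUnitary

variable {n : ℕ}

theorem star_coe_mul_self (x : SU n) : star x.1 * x.1 = 1 :=
  Matrix.mem_unitaryGroup_iff'.1 (Matrix.mem_specialUnitaryGroup_iff.1 x.2).1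

/-- The linear action of `SU(n+1)` on `ℂⁿ⁺¹`. -/
noncomputable def act (x : SU n) : Cn (n + 1) →L[ℂ] Cn (n + 1) :=
  Matrix.toEuclideanCLM (n := Fin (n + 1)) (𝕜 := ℂ) x.1

theorem act_apply (x : SU n) (z : Cn (n + 1)) (k : Fin (n + 1)) :
    act x z k = ∑ j, x.1 k j * z j := rfl

theorem act_mul (x y : SU n) (z : Cn (n + 1)) : act (x * y) z = act x (act y z) :=
  DFunLike.congr_fun (map_mul (Matrix.toEuclideanCLM (𝕜 := ℂ)) x.1 y.1) z

theorem act_one (z : Cn (n + 1)) : act 1 z = z := by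
  have h : act (1 : SU n) = 1 := map_one (Matrix.toEuclideanCLM (𝕜 := ℂ))
  rw [h, one_apply_eq_self]

theorem act_act_inv (x : SU n) (z : Cn (n + 1)) : act x (act x⁻¹ z) = z := by
  rw [← act_mul, mul_inv_cancel, act_one]

theorem norm_act (x : SU n) (z : Cn (n + 1)) : ‖act x z‖ = ‖z‖ := by
  refine (ContinuousLinearMap.norm_map_iff_adjoint_comp_self (act x)).2 ?_ z
  have h := congrArg (Matrix.toEuclideanCLM (n := Fin (n + 1)) (𝕜 := ℂ)) (star_coe_mul_self x)
  rwa [map_mul, map_star, map_one] at h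

theorem inner_act (x : SU n) (v w : Cn (n + 1)) : inner ℂ (act x v) (act x w) = inner ℂ v w :=
  (LinearMap.norm_map_iff_inner_map_map (act x)).1 (norm_act x) v w

theorem act_injective (x : SU n) : Function.Injective (act x) :=
  (AddMonoidHomClass.isometry_of_norm (act x) (norm_act x)).injective

theorem act_ne_zero (x : SU n) {v : Cn (n + 1)} (hv : v ≠ 0) : act x v ≠ 0 :=
  (map_ne_zero_iff (act x) (act_injective x)).2 hv

theorem act_single (x : SU n) (j : Fin (n + 1)) :
    act x (EuclideanSpace.single j 1) = WithLp.toLp 2 fun k => x.1 k j := by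
  ext k
  simp [act_apply]

theorem act_single_zero (x : SU n) : act x (EuclideanSpace.single 0 1) = firstColumn x :=
  act_single x 0

theorem firstColumn_mul (x y : SU n) : firstColumn (x * y) = act x (firstColumn y) := by
  rw [← act_single_zero, act_mul, act_single_zero]

theorem norm_firstColumn (x : SU n) : ‖firstColumn x‖ = 1 := by
  simp [← act_single_zero, norm_act]

theorem hermForm_act (x : SU n) (z v w : Cn (n + 1)) :
    hermForm (act x z) (act x v) (act x w) = hermForm z v w := by
  simp only [hermForm, norm_act, inner_act]

/-- The element of `SU(n+1)` acting as a given linear isometry of determinant one. -/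
noncomputable def toSU (U : Cn (n + 1) →ₗᵢ[ℂ] Cn (n + 1)) (hU : U.toLinearMap.det = 1) : SU n :=
  ⟨(Matrix.toEuclideanCLM (𝕜 := ℂ)).symm U.toContinuousLinearMap,
    Matrix.mem_specialUnitaryGroup_iff.2 ⟨Matrix.mem_unitaryGroup_iff'.2 (by
      have hadj : star U.toContinuousLinearMap * U.toContinuousLinearMap = 1 :=
        (ContinuousLinearMap.norm_map_iff_adjoint_comp_self _).1 U.norm_map
      rw [← map_star, ← map_mul, hadj, map_one]),
    (LinearMap.det_toMatrix _ U.toLinearMap).trans hU⟩⟩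

theorem act_toSU (U : Cn (n + 1) →ₗᵢ[ℂ] Cn (n + 1)) (hU : U.toLinearMap.det = 1)
    (z : Cn (n + 1)) : act (toSU U hU) z = U z :=
  DFunLike.congr_fun
    ((Matrix.toEuclideanCLM (𝕜 := ℂ)).apply_symm_apply U.toContinuousLinearMap) z

/-- A phase `c` with `cⁿ⁺¹ = (det U)⁻¹` makes the determinant one. -/
theorem exists_act_eq_smul (U : Cn (n + 1) →ₗᵢ[ℂ] Cn (n + 1)) :
    ∃ (a : SU n) (c : ℂ), c ≠ 0 ∧ ∀ z, act a z = c • U z := by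
  have hdet : ‖U.toLinearMap.det‖ = 1 :=
    (LinearMap.normDet_eq_norm_det _).symm.trans U.normDet_eq_one
  obtain ⟨c, hc⟩ := IsAlgClosed.exists_pow_nat_eq U.toLinearMap.det⁻¹ n.succ_pos
  have hnorm : ‖c‖ = 1 := by
    refine (pow_eq_one_iff_of_nonneg (norm_nonneg c) n.succ_ne_zero).1 ?_
    rw [← norm_pow, hc, norm_inv, hdet, inv_one]
  let V : Cn (n + 1) →ₗᵢ[ℂ] Cn (n + 1) :=
    ⟨c • U.toLinearMap, fun z => by simp [norm_smul, hnorm]⟩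
  have hV : V.toLinearMap.det = 1 := by
    rw [LinearMap.det_smul, finrank_euclideanSpace_fin, hc, inv_mul_cancel₀]
    exact norm_ne_zero_iff.1 (by simp [hdet])
  exact ⟨toSU V hV, c, norm_ne_zero_iff.1 (by simp [hnorm]), act_toSU V hV⟩

theorem exists_act_single_eq {v : Fin (n + 1) → Cn (n + 1)} {s : Set (Fin (n + 1))}
    (hv : Orthonormal ℂ (s.domRestrict v)) :
    ∃ (a : SU n) (c : ℂ), c ≠ 0 ∧ ∀ i ∈ s, act a (EuclideanSpace.single i 1) = c • v i := by
  obtain ⟨b, hb⟩ := hv.exists_orthonormalBasis_extension_of_card_eq (by simp)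
  let U := (EuclideanSpace.basisFun (Fin (n + 1)) ℂ).equiv b (Equiv.refl _)
  obtain ⟨a, c, hc, ha⟩ := exists_act_eq_smul U.toLinearIsometry
  refine ⟨a, c, hc, fun i hi => ?_⟩
  rw [ha, ← hb i hi, ← EuclideanSpace.basisFun_apply]
  exact congrArg (c • ·) (OrthonormalBasis.equiv_apply_basis _ _ _ i)

theorem exists_act_single_eq_smul_pair {j : Fin (n + 1)} (hj : j ≠ 0) {z v : Cn (n + 1)}
    (hz : ‖z‖ = 1) (hv : ‖v‖ = 1) (hzv : inner ℂ z v = 0) :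
    ∃ (a : SU n) (r : ℂ), r ≠ 0 ∧ act a (EuclideanSpace.single 0 1) = r • z ∧
      act a (EuclideanSpace.single j 1) = r • v := by
  have hon : Orthonormal ℂ (Set.domRestrict {0, j} (Function.update (fun _ => v) 0 z)) := by
    refine ⟨?_, ?_⟩
    · rintro ⟨i, rfl | rfl⟩
      · simpa using hz
      · simpa [hj] using hv
    · rintro ⟨i, rfl | rfl⟩ ⟨k, rfl | rfl⟩ hik
      · exact (hik rfl).elim
      · simpa [hj] using hzv
      · simpa [hj] using inner_eq_zero_symm.1 hzv
      · exact (hik rfl).elim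
  obtain ⟨a, r, hr, ha⟩ := exists_act_single_eq hon
  exact ⟨a, r, hr, by simpa using ha 0 (by simp), by simpa [hj] using ha j (by simp)⟩

theorem exists_proj_firstColumn_eq (p : CP n) : ∃ x : SU n, proj n (firstColumn x) = p := by
  obtain ⟨z, hz, rfl⟩ := exists_proj_eq p
  obtain ⟨a, c, hc, ha⟩ := exists_act_single_eq (v := fun _ : Fin (n + 1) => z) (s := {0})
    ⟨fun _ => hz, fun i j hij => (hij (Subsingleton.elim i j)).elim⟩
  refine ⟨a, ?_⟩
  rw [← act_single_zero, ha 0 rfl, proj_smul hc (norm_ne_zero_iff.1 (by simp [hz]))]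

end SpecialUnitary

/-! ### The map to projective space -/

section HomMap

variable {n : ℕ}

theorem homMap_mk (x : SU n) : homMap n (x : HomSpace n) = proj n (firstColumn x) :=
  (proj_of_ne (firstColumn_ne_zero x)).symm

theorem homMap_one : homMap n ((1 : SU n) : HomSpace n) = proj n (EuclideanSpace.single 0 1) := by
  rw [homMap_mk, ← act_single_zero, act_one]

theorem mem_blockSubgroup_of_firstColumn_eq_smul {x : SU n} {r : ℂ}
    (hx : firstColumn x = r • EuclideanSpace.single 0 1) : x ∈ blockSubgroup n := by
  have hcol (j : Fin n) : x.1 j.succ 0 = 0 := by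
    simpa [firstColumn] using congrArg (fun v : Cn (n + 1) => v j.succ) hx
  have hcorner : x.1 0 0 ≠ 0 := fun h0 =>
    firstColumn_ne_zero x (by ext k; exact Fin.cases h0 hcol k)
  refine fun j => ⟨?_, hcol j⟩
  have horth := congrFun (congrFun (star_coe_mul_self x) 0) j.succ
  rw [Matrix.mul_apply, Fin.sum_univ_succ, Matrix.one_apply_ne (Fin.succ_ne_zero j).symm] at horth
  simp only [Matrix.star_apply, hcol, star_zero, zero_mul, Finset.sum_const_zero,
    add_zero] at horth
  exact (mul_eq_zero.1 horth).resolve_left (star_ne_zero.2 hcorner)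

theorem homMap_injective : Function.Injective (homMap n) := by
  intro c d h
  induction c using Quotient.inductionOn with | _ x
  induction d using Quotient.inductionOn with | _ y
  obtain ⟨r, hr⟩ := (Projectivization.mk_eq_mk_iff' ℂ _ _ (firstColumn_ne_zero x)
    (firstColumn_ne_zero y)).1 h
  refine (QuotientGroup.eq.2 (mem_blockSubgroup_of_firstColumn_eq_smul (r := r) ?_)).symm
  rw [firstColumn_mul, ← hr, map_smul, ← firstColumn_mul, inv_mul_cancel, ← act_single_zero,
    act_one]

theorem homMap_bijective : Function.Bijective (homMap n) := by
  refine ⟨homMap_injective, fun p => ?_⟩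
  obtain ⟨x, hx⟩ := exists_proj_firstColumn_eq p
  exact ⟨x, (homMap_mk x).trans hx⟩

/-- The inverse of `homMap`. -/
noncomputable def homInv (n : ℕ) : CP n → HomSpace n :=
  (Equiv.ofBijective (homMap n) homMap_bijective).symm

theorem homInv_homMap (c : HomSpace n) : homInv n (homMap n c) = c :=
  (Equiv.ofBijective (homMap n) homMap_bijective).symm_apply_apply c

theorem homInv_bijective : Function.Bijective (homInv n) :=
  (Equiv.ofBijective (homMap n) homMap_bijective).symm.bijective

theorem homInv_proj_firstColumn (x : SU n) : homInv n (proj n (firstColumn x)) = x := by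
  rw [← homMap_mk, homInv_homMap]

end HomMap

/-! ### Translations of projective space -/

section Translation

variable {n : ℕ}

/-- The action of `SU(n+1)` on projective space. -/
noncomputable def actCP (a : SU n) : CP n → CP n :=
  Projectivization.map (act a : Cn (n + 1) →ₗ[ℂ] Cn (n + 1)) (act_injective a)

theorem actCP_proj (a : SU n) {z : Cn (n + 1)} (hz : z ≠ 0) :
    actCP a (proj n z) = proj n (act a z) := by
  rw [proj_of_ne hz, proj_of_ne (act_ne_zero a hz)]
  rfl

theorem actCP_actCP_inv (a : SU n) (p : CP n) : actCP a (actCP a⁻¹ p) = p := by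
  obtain ⟨x, rfl⟩ := exists_proj_firstColumn_eq p
  rw [actCP_proj _ (firstColumn_ne_zero x), ← firstColumn_mul,
    actCP_proj _ (firstColumn_ne_zero _), ← firstColumn_mul, mul_inv_cancel_left]

theorem homMap_smul (a : SU n) (c : HomSpace n) : homMap n (a • c) = actCP a (homMap n c) := by
  induction c using Quotient.inductionOn with | _ x
  refine (homMap_mk (a * x)).trans (Eq.trans ?_ (congrArg (actCP a) (homMap_mk x)).symm)
  rw [actCP_proj a (firstColumn_ne_zero x), firstColumn_mul]

theorem actCP_comp_proj_eventuallyEq (a : SU n) {z : Cn (n + 1)} (hz : z ≠ 0) :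
    (fun y => actCP a (proj n y)) =ᶠ[𝓝 z] fun y => proj n (act a y) := by
  filter_upwards [isOpen_ne.mem_nhds hz] with y hy using actCP_proj a hy

theorem contMDiff_actCP (a : SU n) : ContMDiff 𝓘(ℝ, Cn n) 𝓘(ℝ, Cn n) ∞ (actCP a) := by
  intro p
  obtain ⟨x, rfl⟩ := exists_proj_firstColumn_eq p
  have hx := firstColumn_ne_zero x
  refine contMDiffAt_of_comp_proj hx
    (ContMDiffAt.congr_of_eventuallyEq ?_ (actCP_comp_proj_eventuallyEq a hx))
  exact ContMDiffAt.comp (g := proj n) _ (contMDiffAt_proj (act_ne_zero a hx))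
    ((act a).restrictScalars ℝ).contDiff.contMDiff.contMDiffAt

theorem mfderiv_actCP_dproj (a : SU n) {z : Cn (n + 1)} (hz : z ≠ 0) (v : Cn (n + 1)) :
    (mfderiv 𝓘(ℝ, Cn n) 𝓘(ℝ, Cn n) (actCP a) (proj n z) : Cn n →L[ℝ] Cn n) (dproj z v) =
      dproj (act a z) (act a v) := by
  have hleft := HasMFDerivAt.comp (g := actCP a) z
    ((contMDiff_actCP a (proj n z)).mdifferentiableAt (by simp)).hasMFDerivAt
    (hasMFDerivAt_proj hz)
  have hright := hasMFDerivAt_proj_comp ((act a).restrictScalars ℝ).hasFDerivAt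
    (act_ne_zero a hz)
  exact DFunLike.congr_fun (hasMFDerivAt_unique hleft
    (hright.congr_of_eventuallyEq (actCP_comp_proj_eventuallyEq a hz))) v

theorem dproj_smul {c : ℂ} (hc : c ≠ 0) {z : Cn (n + 1)} (hz : z ≠ 0) (v : Cn (n + 1)) :
    dproj (c • z) (c • v) = dproj z v := by
  have hscale := hasMFDerivAt_proj_comp (y := z)
    ((c • ContinuousLinearMap.id ℂ (Cn (n + 1))).restrictScalars ℝ).hasFDerivAt
    (smul_ne_zero hc hz)
  have heq : proj n =ᶠ[𝓝 z] fun y => proj n (c • y) := by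
    filter_upwards [isOpen_ne.mem_nhds hz] with y hy using (proj_smul hc hy).symm
  exact (DFunLike.congr_fun (hasMFDerivAt_unique (hasMFDerivAt_proj hz)
    (hscale.congr_of_eventuallyEq heq)) v).symm

theorem pullback_actCP (a : SU n) :
    pullback (E := Cn n) (actCP a) (fubiniStudy n) = fubiniStudy n := by
  funext p
  obtain ⟨z, hz, rfl⟩ := exists_proj_eq p
  have hz0 : z ≠ 0 := norm_ne_zero_iff.1 (by simp [hz])
  refine ContinuousLinearMap.ext fun (u : Cn n) => ContinuousLinearMap.ext fun (v : Cn n) => ?_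
  obtain ⟨u, -, rfl⟩ := exists_dproj_eq hz u
  obtain ⟨v, -, rfl⟩ := exists_dproj_eq hz v
  calc (pullback (E := Cn n) (actCP a) (fubiniStudy n) (proj n z) : Cn n →L[ℝ] Cn n →L[ℝ] ℝ)
        (dproj z u) (dproj z v)
      = (pullback (proj n) (pullback (E := Cn n) (actCP a) (fubiniStudy n)) z :
          Cn (n + 1) →L[ℝ] Cn (n + 1) →L[ℝ] ℝ) u v :=
        (pullback_apply_of_hasMFDerivAt (hasMFDerivAt_proj hz0) _ u v).symm
    _ = pullback (actCP a ∘ proj n) (fubiniStudy n) z u v := by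
        rw [pullback_comp_apply ((contMDiff_actCP a _).mdifferentiableAt (by simp))
          (hasMFDerivAt_proj hz0).mdifferentiableAt]
    _ = pullback (fun y => proj n (act a y)) (fubiniStudy n) z u v := by
        rw [pullback_congr_of_eventuallyEq]
        exact actCP_comp_proj_eventuallyEq a hz0
    _ = (hermForm (act a z) (act a u) (act a v)).re :=
        pullback_proj_comp ((act a).restrictScalars ℝ).hasFDerivAt (act_ne_zero a hz0) u v
    _ = (hermForm z u v).re := by rw [hermForm_act]
    _ = _ := (fubiniStudy_dproj hz0 u v).symm

end Translation

/-! ### Rotations onto affine lifts -/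

section Rotation

theorem reflection_span_singleton_add {𝕜 E : Type*} [RCLike 𝕜] [NormedAddCommGroup E]
    [InnerProductSpace 𝕜 E] {v w : E} (h : ‖v‖ = ‖w‖) (hvw : inner 𝕜 v w = inner 𝕜 w v) :
    (𝕜 ∙ (v + w)).reflection v = w := by
  have hadd : (𝕜 ∙ (v + w)).reflection (v + w) = v + w :=
    Submodule.reflection_mem_subspace_eq_self (Submodule.mem_span_singleton_self _)
  have hsub : (𝕜 ∙ (v + w)).reflection (v - w) = -(v - w) := by
    refine Submodule.reflection_mem_subspace_orthogonalComplement_eq_neg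
      (Submodule.mem_orthogonal_singleton_iff_inner_right.2 ?_)
    simp only [inner_add_left, inner_sub_right, inner_self_eq_norm_sq_to_K, h, hvw]
    ring
  have htwo : (2 : 𝕜) • (𝕜 ∙ (v + w)).reflection v = (2 : 𝕜) • w := by
    rw [← map_smul, show (2 : 𝕜) • v = (v + w) + (v - w) by module, map_add, hadd, hsub]
    module
  exact smul_right_injective E two_ne_zero htwo

theorem contDiff_reflection_span_singleton {V E : Type*} [NormedAddCommGroup V] [NormedSpace ℝ V]
    [NormedAddCommGroup E] [InnerProductSpace ℂ E] {u : V → E} (hu : ContDiff ℝ ∞ u)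
    (hne : ∀ y, u y ≠ 0) (v : E) : ContDiff ℝ ∞ fun y => (ℂ ∙ u y).reflection v := by
  let _ := InnerProductSpace.rclikeToReal ℂ E
  simp only [Submodule.reflection_singleton_apply, two_smul]
  have hnorm : ContDiff ℝ ∞ fun y => ((‖u y‖ : ℂ) ^ 2) := by
    simpa only [Function.comp_def, Complex.ofRealCLM_apply, Complex.ofReal_pow] using
      Complex.ofRealCLM.contDiff.comp (hu.norm_sq ℝ)
  have hcoeff : ContDiff ℝ ∞ fun y => inner ℂ (u y) v / (‖u y‖ : ℂ) ^ 2 := by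
    simp only [div_eq_mul_inv]
    exact (hu.inner ℂ contDiff_const).mul (hnorm.inv fun y => by simp [hne y])
  exact ((hcoeff.smul hu).add (hcoeff.smul hu)).sub contDiff_const

variable {n : ℕ}

/-- The axis of the reflection that exchanges `‖ℓ‖ • e₀` and `ℓ`, for the affine lift `ℓ = (1, w)`
of `w`. -/
noncomputable def bisector (w : Cn n) : Cn (n + 1) :=
  (‖affineLift 0 w‖ : ℂ) • EuclideanSpace.single 0 1 + affineLift 0 w

theorem bisector_ne_zero (w : Cn n) : bisector w ≠ 0 := fun h => by
  have h0 : (‖affineLift 0 w‖ : ℂ) + 1 = 0 := by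
    simpa [bisector] using congrArg (fun z : Cn (n + 1) => z 0) h
  norm_cast at h0
  linarith [norm_nonneg (affineLift 0 w)]

theorem contDiff_bisector : ContDiff ℝ ∞ (bisector (n := n)) := by
  have hlift : ContDiff ℝ ∞ fun w : Cn n => affineLift 0 w :=
    contDiff_const.add ((slot 0).restrictScalars ℝ).contDiff
  have hnorm := hlift.norm ℂ (affineLift_ne_zero 0)
  exact ((Complex.ofRealCLM.contDiff.comp hnorm).smul contDiff_const).add hlift

theorem det_reflection_span_singleton {𝕜 E : Type*} [RCLike 𝕜] [NormedAddCommGroup E]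
    [InnerProductSpace 𝕜 E] {d : ℕ} [Fact (Module.finrank 𝕜 E = d + 1)] {z : E} (hz : z ≠ 0) :
    LinearMap.det ((𝕜 ∙ z).reflection.toLinearEquiv : E →ₗ[𝕜] E) = (-1) ^ d := by
  rw [Submodule.det_reflection, Submodule.finrank_orthogonal_span_singleton (n := d) hz]

/-- The special unitary map taking the first basis vector to the normalized affine lift of `w`, as
a product of two reflections. -/
noncomputable def rotation (w : Cn n) : SU n :=
  toSU ((ℂ ∙ bisector w).reflection.toLinearIsometry.comp
    (ℂ ∙ (EuclideanSpace.single 0 1 : Cn (n + 1))).reflection.toLinearIsometry) (by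
      have : Fact (Module.finrank ℂ (Cn (n + 1)) = n + 1) := ⟨finrank_euclideanSpace_fin⟩
      refine (LinearMap.det_comp _ _).trans ?_
      refine (congrArg₂ (· * ·) (det_reflection_span_singleton (d := n) (bisector_ne_zero w))
        (det_reflection_span_singleton (d := n) (by simp))).trans ?_
      rw [← mul_pow, neg_one_mul, neg_neg, one_pow])

theorem act_rotation (w : Cn n) (z : Cn (n + 1)) :
    act (rotation w) z = (ℂ ∙ bisector w).reflection
      ((ℂ ∙ (EuclideanSpace.single 0 1 : Cn (n + 1))).reflection z) :=
  act_toSU _ _ z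

theorem rotation_zero : rotation (0 : Cn n) = 1 := by
  have hbis : bisector (0 : Cn n) = (2 : ℂ) • EuclideanSpace.single 0 1 := by
    simp [bisector, affineLift, two_smul]
  have hact (z : Cn (n + 1)) : act (rotation 0) z = z := by
    simp only [act_rotation, hbis, Submodule.reflection_reflection,
      Submodule.span_singleton_smul_eq (two_ne_zero (α := ℂ)).isUnit]
  exact Subtype.ext ((Matrix.toEuclideanCLM (𝕜 := ℂ)).injective
    (ContinuousLinearMap.ext fun z => (hact z).trans (act_one z).symm))

theorem smul_firstColumn_rotation (w : Cn n) :
    (‖affineLift 0 w‖ : ℂ) • firstColumn (rotation w) = affineLift 0 w := by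
  rw [← act_single_zero, act_rotation,
    Submodule.reflection_mem_subspace_eq_self (Submodule.mem_span_singleton_self _), ← map_smul]
  refine reflection_span_singleton_add ?_ ?_
  · rw [norm_smul]
    simp
  · rw [inner_smul_left, inner_smul_right, EuclideanSpace.inner_single_left,
      EuclideanSpace.inner_single_right]
    simp

theorem proj_firstColumn_mul_rotation (x : SU n) (w : Cn n) :
    proj n (firstColumn (x * rotation w)) = proj n (act x (affineLift 0 w)) := by
  rw [← smul_firstColumn_rotation, map_smul, firstColumn_mul,
    proj_smul (norm_complex_ne_zero (affineLift_ne_zero 0 w))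
      (act_ne_zero x (firstColumn_ne_zero _))]

theorem contDiff_rotation_apply (i j : Fin (n + 1)) :
    ContDiff ℝ ∞ fun w : Cn n => (rotation w).1 i j := by
  have hcol : ContDiff ℝ ∞ fun w : Cn n => act (rotation w) (EuclideanSpace.single j 1) := by
    simp only [act_rotation]
    exact contDiff_reflection_span_singleton contDiff_bisector bisector_ne_zero _
  simp only [act_single] at hcol
  exact (contDiff_piLp 2).1 hcol i

end Rotation

/-! ### Smooth maps into the special unitary group -/

section SmoothMaps

variable {n : ℕ} {V : Type*} [NormedAddCommGroup V] [NormedSpace ℝ V] {γ : V → SU n}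

section MatrixNorm

attribute [local instance] Matrix.normedAddCommGroup Matrix.normedSpace

theorem isSmoothIntoSU_iff :
    IsSmoothIntoSU γ ↔ ∀ i j, ContDiff ℝ ∞ (fun s => (γ s).1 i j) := by
  refine Iff.trans (contDiff_pi (𝕜 := ℝ) (n := ∞)
    (Φ := fun s => ((γ s).1 : Fin (n + 1) → Fin (n + 1) → ℂ))) ?_
  exact forall_congr' fun i => contDiff_pi (Φ := fun s => (γ s).1 i)

end MatrixNorm

theorem continuous_of_isSmoothIntoSU (hγ : IsSmoothIntoSU γ) : Continuous γ :=
  Continuous.subtype_mk (continuous_pi fun i => continuous_pi fun j =>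
    (isSmoothIntoSU_iff.1 hγ i j).continuous) _

theorem contDiff_firstColumn (hγ : IsSmoothIntoSU γ) : ContDiff ℝ ∞ fun s => firstColumn (γ s) :=
  (contDiff_piLp 2).2 fun k => isSmoothIntoSU_iff.1 hγ k 0

theorem contMDiff_proj_firstColumn (hγ : IsSmoothIntoSU γ) :
    ContMDiff 𝓘(ℝ, V) 𝓘(ℝ, Cn n) ∞ fun s => proj n (firstColumn (γ s)) := fun s =>
  ContMDiffAt.comp (g := proj n) s (contMDiffAt_proj (firstColumn_ne_zero (γ s)))
    ((contDiff_firstColumn hγ).contMDiff s)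

theorem isSmoothIntoSU_mul_rotation (x : SU n) {f : V → Cn n} (hf : ContDiff ℝ ∞ f) :
    IsSmoothIntoSU fun s => x * rotation (f s) := by
  rw [isSmoothIntoSU_iff]
  intro i j
  simp only [Submonoid.coe_mul, Matrix.mul_apply]
  exact ContDiff.sum fun k _ => contDiff_const.mul ((contDiff_rotation_apply k j).comp hf)

end SmoothMaps

/-! ### Local sections of the projection of the special unitary group -/

section Sections

variable {n : ℕ}

/-- The lift factors through a Euclidean space because `IsHomogeneousStructure.smooth` tests
smoothness only along maps from Euclidean spaces. -/
theorem exists_local_lift (x : SU n) :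
    ∃ (k : ℕ) (γ : EuclideanSpace ℝ (Fin k) → SU n) (L : CP n → EuclideanSpace ℝ (Fin k)),
      IsSmoothIntoSU γ ∧
      ContMDiffAt 𝓘(ℝ, Cn n) 𝓘(ℝ, EuclideanSpace ℝ (Fin k)) ∞ L (homMap n x) ∧
      homInv n =ᶠ[𝓝 (homMap n x)] fun q => (γ (L q) : HomSpace n) := by
  let e : EuclideanSpace ℝ (Fin (Module.finrank ℝ (Cn n))) ≃L[ℝ] Cn n :=
    ContinuousLinearEquiv.ofFinrankEq finrank_euclideanSpace_fin
  have hmem : actCP x⁻¹ (homMap n x) ∈ affineSet 0 := by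
    rw [homMap_mk, actCP_proj _ (firstColumn_ne_zero x), ← firstColumn_mul, inv_mul_cancel,
      proj_mem_affineSet (firstColumn_ne_zero _)]
    simp [firstColumn]
  have hnhds : affineSet 0 ∈ 𝓝 (actCP x⁻¹ (homMap n x)) :=
    (affineChart (n := n) 0).open_source.mem_nhds hmem
  refine ⟨_, fun s => x * rotation (e s), fun q => e.symm (affineMap 0 (actCP x⁻¹ q)),
    isSmoothIntoSU_mul_rotation x e.contDiff, ?_, ?_⟩
  · exact e.symm.contDiff.contMDiff.contMDiffAt.comp _
      (((contMDiffOn_affineMap 0).contMDiffAt hnhds).comp _ (contMDiff_actCP x⁻¹ _))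
  · filter_upwards [(contMDiff_actCP x⁻¹).continuous.continuousAt hnhds] with q hq
    rw [← homInv_proj_firstColumn, e.apply_symm_apply, proj_firstColumn_mul_rotation,
      ← actCP_proj x (affineLift_ne_zero 0 _), proj_affineLift]
    congr 1
    refine (actCP_actCP_inv x q).symm.trans (congrArg (actCP x) ?_)
    exact ((affineChart 0).left_inv hq).symm

theorem continuous_homMap : Continuous (homMap n) := by
  refine continuous_quot_lift _ (continuous_iff_continuousAt.2 fun x => ?_)
  have hcol : Continuous (firstColumn (n := n)) := (PiLp.continuous_toLp 2 _).comp
    (continuous_pi fun k => (continuous_apply_apply k 0).comp continuous_subtype_val)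
  refine ((continuousAt_proj (firstColumn_ne_zero x)).comp hcol.continuousAt).congr ?_
  exact Eventually.of_forall fun y => proj_of_ne (firstColumn_ne_zero y)

theorem continuous_homInv : Continuous (homInv n) := by
  rw [continuous_iff_continuousAt]
  intro p
  obtain ⟨c, rfl⟩ := homMap_bijective.2 p
  induction c using Quotient.inductionOn with | _ x
  obtain ⟨k, γ, L, hγ, hL, h⟩ := exists_local_lift x
  refine ContinuousAt.congr ?_ h.symm
  exact (continuous_quot_mk.comp (continuous_of_isSmoothIntoSU hγ)).continuousAt.comp
    hL.continuousAt

variable (n) in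
/-- `homMap` as a homeomorphism. -/
noncomputable def homHomeomorph : HomSpace n ≃ₜ CP n where
  toEquiv := Equiv.ofBijective (homMap n) homMap_bijective
  continuous_toFun := continuous_homMap
  continuous_invFun := continuous_homInv

theorem exists_slot_zero_eq {v : Cn (n + 1)} (hv : v 0 = 0) : ∃ w : Cn n, slot 0 w = v := by
  refine ⟨WithLp.toLp 2 fun j => v j.succ, ?_⟩
  ext k
  refine Fin.cases ?_ (fun k => ?_) k
  · simp [hv]
  · simpa using slot_succAbove (0 : Fin (n + 1)) (WithLp.toLp 2 fun j => v j.succ : Cn n) k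

theorem exists_dproj_act_slot_eq (x : SU n) (u : Cn n) :
    ∃ w : Cn n, dproj (firstColumn x) (act x (slot 0 w)) = u := by
  obtain ⟨v, hv, rfl⟩ := exists_dproj_eq (norm_firstColumn x) u
  have hzero : act x⁻¹ v 0 = 0 := by
    have h : inner ℂ (EuclideanSpace.single 0 1) (act x⁻¹ v) = 0 := by
      rw [← inner_act x, act_act_inv, act_single_zero, hv]
    simpa [EuclideanSpace.inner_single_left] using h
  obtain ⟨w, hw⟩ := exists_slot_zero_eq hzero
  exact ⟨w, by rw [hw, act_act_inv]⟩

theorem hasMFDerivAt_proj_firstColumn_mul_rotation (x : SU n) :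
    HasMFDerivAt 𝓘(ℝ, Cn n) 𝓘(ℝ, Cn n) (fun w => proj n (firstColumn (x * rotation w))) 0
      (dproj (firstColumn x) ∘L (act x).restrictScalars ℝ ∘L (slot 0).restrictScalars ℝ :
        Cn n →L[ℝ] Cn n) := by
  have hlift : HasFDerivAt (fun w => act x (affineLift 0 w))
      ((act x).restrictScalars ℝ ∘L (slot 0).restrictScalars ℝ) (0 : Cn n) :=
    ((act x).restrictScalars ℝ).hasFDerivAt.comp 0
      (((slot 0).restrictScalars ℝ).hasFDerivAt.const_add _)
  have hzero : act x (affineLift 0 0) = firstColumn x := by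
    rw [affineLift, map_zero, add_zero, act_single_zero]
  have h := hasMFDerivAt_proj_comp hlift (act_ne_zero x (affineLift_ne_zero 0 0))
  rw [hzero] at h
  exact h.congr_of_eventuallyEq (Eventually.of_forall (proj_firstColumn_mul_rotation x))

end Sections

/-! ### The smooth structure of the homogeneous space -/

section Structure

variable {n : ℕ}

theorem exists_isHomogeneousStructure (n : ℕ) :
    ∃ _ : ChartedSpace (Cn n) (HomSpace n), IsHomogeneousStructure n := by
  let _ := transportCharts (E := Cn n) (homHomeomorph n)
  have hmk (x : SU n) : (x : HomSpace n) = (homHomeomorph n).symm (proj n (firstColumn x)) :=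
    (homInv_proj_firstColumn x).symm
  refine ⟨_, isManifold_transportCharts _, fun k γ hγ => ?_, fun x u => ?_⟩
  · simp only [hmk]
    exact (contMDiff_symm_transportCharts (homHomeomorph n)).comp (contMDiff_proj_firstColumn hγ)
  · obtain ⟨w, hw⟩ := exists_dproj_act_slot_eq x u
    let A : ℝ →L[ℝ] Cn n := (ContinuousLinearMap.id ℝ ℝ).smulRight w
    have hA : A 1 = w := one_smul ℝ w
    refine ⟨fun s => x * rotation (A s), isSmoothIntoSU_mul_rotation x A.contDiff, ?_, ?_⟩
    · simp only [map_zero, rotation_zero, mul_one]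
    · have hproj := hasMFDerivAt_proj_firstColumn_mul_rotation x
      rw [← map_zero A] at hproj
      have hcurve := (hasMFDerivAt_symm_transportCharts (homHomeomorph n) _).comp (0 : ℝ)
        (hproj.comp (0 : ℝ) A.hasFDerivAt.hasMFDerivAt)
      rw [funext fun s => hmk (x * rotation (A s))]
      refine (DFunLike.congr_fun hcurve.mfderiv (1 : ℝ)).trans ?_
      exact (congrArg (fun w => dproj (firstColumn x) (act x (slot 0 w))) hA).trans hw

theorem bijective_of_surjective {E : Type*} [NormedAddCommGroup E] [NormedSpace ℝ E]
    [FiniteDimensional ℝ E] {D : E →L[ℝ] E} (h : Function.Surjective D) : Function.Bijective D :=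
  ⟨(LinearMap.injective_iff_surjective (f := (D : E →ₗ[ℝ] E))).2 h, h⟩

variable [ChartedSpace (Cn n) (HomSpace n)]

theorem contMDiff_homInv (hs : IsHomogeneousStructure n) :
    ContMDiff 𝓘(ℝ, Cn n) 𝓘(ℝ, Cn n) ∞ (homInv n) := by
  intro p
  obtain ⟨c, rfl⟩ := homMap_bijective.2 p
  induction c using Quotient.inductionOn with | _ x
  obtain ⟨k, γ, L, hγ, hL, h⟩ := exists_local_lift x
  exact ((hs.smooth k γ hγ).contMDiffAt.comp _ hL).congr_of_eventuallyEq h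

theorem mfderiv_homInv_surjective (hs : IsHomogeneousStructure n) (p : CP n) :
    Function.Surjective (mfderiv 𝓘(ℝ, Cn n) 𝓘(ℝ, Cn n) (homInv n) p : Cn n →L[ℝ] Cn n) := by
  intro u
  obtain ⟨x, rfl⟩ := exists_proj_firstColumn_eq p
  obtain ⟨γ, hγ, rfl, hu⟩ := hs.submersion x u
  have hcomp := mfderiv_comp (0 : ℝ) ((contMDiff_homInv hs _).mdifferentiableAt (by simp))
    ((contMDiff_proj_firstColumn hγ 0).mdifferentiableAt (by simp))
  refine ⟨(mfderiv 𝓘(ℝ, ℝ) 𝓘(ℝ, Cn n) (fun s => proj n (firstColumn (γ s))) 0 :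
    ℝ →L[ℝ] Cn n) 1, ?_⟩
  rw [← hu]
  refine (DFunLike.congr_fun hcomp (1 : ℝ)).symm.trans ?_
  rw [show homInv n ∘ (fun s => proj n (firstColumn (γ s))) = fun s => (γ s : HomSpace n) from
    funext fun s => homInv_proj_firstColumn (γ s)]
  rfl

theorem exists_diffeomorph_homMap (hs : IsHomogeneousStructure n) :
    ∃ Φ : Diffeomorph 𝓘(ℝ, Cn n) 𝓘(ℝ, Cn n) (HomSpace n) (CP n) ∞, ⇑Φ = homMap n := by
  obtain ⟨Ψ, hΨ⟩ := exists_diffeomorph_of_bijective (contMDiff_homInv hs) (by simp)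
    homInv_bijective fun p => bijective_of_surjective (E := Cn n) (mfderiv_homInv_surjective hs p)
  refine ⟨Ψ.symm, funext fun c => Ψ.injective ?_⟩
  exact (Ψ.apply_symm_apply c).trans ((congrFun hΨ _).trans (homInv_homMap c)).symm

end Structure

/-! ### Invariant metrics -/

section InvariantMetric

variable {n : ℕ} [ChartedSpace (Cn n) (HomSpace n)]

variable (n) in
/-- The pull-back of the Fubini-Study metric to the homogeneous space. -/
noncomputable abbrev homMetric : TensorField (Cn n) (HomSpace n) :=
  pullback (homMap n) (fubiniStudy n)

/-- The differential of `homMap`. -/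
noncomputable def dhom (c : HomSpace n) : Cn n →L[ℝ] Cn n :=
  mfderiv 𝓘(ℝ, Cn n) 𝓘(ℝ, Cn n) (homMap n) c

/-- The differential of the translation of the homogeneous space by `a`. -/
noncomputable def dtranslation (a : SU n) (c : HomSpace n) : Cn n →L[ℝ] Cn n :=
  mfderiv 𝓘(ℝ, Cn n) 𝓘(ℝ, Cn n) (fun c : HomSpace n => a • c) c

theorem homMetric_apply (c : HomSpace n) (u v : Cn n) :
    (homMetric n c : Cn n →L[ℝ] Cn n →L[ℝ] ℝ) u v =
      (fubiniStudy n (homMap n c) : Cn n →L[ℝ] Cn n →L[ℝ] ℝ) (dhom c u) (dhom c v) := rfl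

theorem homMetric_symm (c : HomSpace n) (u v : Cn n) :
    (homMetric n c : Cn n →L[ℝ] Cn n →L[ℝ] ℝ) u v =
      (homMetric n c : Cn n →L[ℝ] Cn n →L[ℝ] ℝ) v u := by
  rw [homMetric_apply, homMetric_apply, fubiniStudy_symm]

theorem apply_dtranslation_of_isInvariantMetric {h : TensorField (Cn n) (HomSpace n)}
    (hinv : IsInvariantMetric n h) (a : SU n) (c : HomSpace n) (u v : Cn n) :
    (h (a • c) : Cn n →L[ℝ] Cn n →L[ℝ] ℝ) (dtranslation a c u) (dtranslation a c v) =
      (h c : Cn n →L[ℝ] Cn n →L[ℝ] ℝ) u v :=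
  DFunLike.congr_fun (DFunLike.congr_fun (congrFun (hinv a) c) u) v

theorem exists_horizontal_lift {c : HomSpace n} {u : Cn n}
    (hu : (homMetric n c : Cn n →L[ℝ] Cn n →L[ℝ] ℝ) u u = 1) :
    ∃ z v : Cn (n + 1), ‖z‖ = 1 ∧ ‖v‖ = 1 ∧ inner ℂ z v = 0 ∧
      proj n z = homMap n c ∧ dproj z v = dhom c u := by
  obtain ⟨z, hz, hzc⟩ := exists_proj_eq (homMap n c)
  obtain ⟨v, hv, hvu⟩ := exists_dproj_eq hz (dhom c u)
  have hz0 : z ≠ 0 := norm_ne_zero_iff.1 (by simp [hz])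
  rw [homMetric_apply, ← hzc, ← hvu, fubiniStudy_dproj hz0, hermForm_of_norm_eq_one hz hv,
    inner_self_complex] at hu
  norm_cast at hu
  exact ⟨z, v, hz, (pow_eq_one_iff_of_nonneg (norm_nonneg v) two_ne_zero).1 hu, hv, hzc, hvu⟩

theorem ne_zero_of_dhom_one_eq {j : Fin (n + 1)} (hj : j ≠ 0) {u₀ : Cn n}
    (hu₀ : dhom ((1 : SU n) : HomSpace n) u₀ =
      dproj (EuclideanSpace.single 0 1) (EuclideanSpace.single j 1)) : u₀ ≠ 0 := by
  rintro rfl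
  have hunit : (fubiniStudy n (proj n (EuclideanSpace.single 0 1)) : Cn n →L[ℝ] Cn n →L[ℝ] ℝ)
      (dproj (EuclideanSpace.single 0 1) (EuclideanSpace.single j 1))
      (dproj (EuclideanSpace.single 0 1) (EuclideanSpace.single j 1)) = 1 := by
    rw [fubiniStudy_dproj (by simp), hermForm_of_norm_eq_one (by simp)
      (by simp [EuclideanSpace.inner_single_left, hj.symm])]
    simp
  rw [← hu₀, map_zero] at hunit
  exact zero_ne_one ((map_zero (_ : Cn n →L[ℝ] ℝ)).symm.trans hunit)

variable (Φ : Diffeomorph 𝓘(ℝ, Cn n) 𝓘(ℝ, Cn n) (HomSpace n) (CP n) ∞)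

theorem contMDiff_homMap (hΦ : ⇑Φ = homMap n) :
    ContMDiff 𝓘(ℝ, Cn n) 𝓘(ℝ, Cn n) ∞ (homMap n) :=
  hΦ ▸ Φ.contMDiff

theorem mdifferentiable_homMap (hΦ : ⇑Φ = homMap n) :
    MDifferentiable 𝓘(ℝ, Cn n) 𝓘(ℝ, Cn n) (homMap n) :=
  (contMDiff_homMap Φ hΦ).mdifferentiable (by simp)

theorem contMDiff_smul_homSpace (hΦ : ⇑Φ = homMap n) (a : SU n) :
    ContMDiff 𝓘(ℝ, Cn n) 𝓘(ℝ, Cn n) ∞ (fun c : HomSpace n => a • c) := by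
  have h : (fun c : HomSpace n => a • c) = Φ.symm ∘ actCP a ∘ Φ := by
    funext c
    refine homMap_injective ((homMap_smul a c).trans ?_)
    rw [← hΦ]
    exact (Φ.apply_symm_apply _).symm
  rw [h]
  exact Φ.symm.contMDiff.comp ((contMDiff_actCP a).comp Φ.contMDiff)

theorem isInvariantMetric_homMetric (hΦ : ⇑Φ = homMap n) :
    IsInvariantMetric n (homMetric n) := by
  intro a
  rw [homMetric, ← pullback_comp (mdifferentiable_homMap Φ hΦ)
      ((contMDiff_smul_homSpace Φ hΦ a).mdifferentiable (by simp)),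
    show homMap n ∘ (fun c : HomSpace n => a • c) = actCP a ∘ homMap n from
      funext (homMap_smul a),
    pullback_comp ((contMDiff_actCP a).mdifferentiable (by simp)) (mdifferentiable_homMap Φ hΦ),
    pullback_actCP]

theorem dhom_bijective (hΦ : ⇑Φ = homMap n) (c : HomSpace n) :
    Function.Bijective (dhom c) := by
  rw [dhom, ← hΦ]
  exact (Φ.mfderivToContinuousLinearEquiv (by simp) c).bijective

theorem homMetric_pos (hΦ : ⇑Φ = homMap n) (c : HomSpace n) {u : Cn n} (hu : u ≠ 0) :
    0 < (homMetric n c : Cn n →L[ℝ] Cn n →L[ℝ] ℝ) u u := by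
  rw [homMetric_apply]
  exact fubiniStudy_pos (homMap n c) fun h => hu ((dhom_bijective Φ hΦ c).1 (by rw [h, map_zero]))

theorem isSmoothMetric_homMetric (hΦ : ⇑Φ = homMap n)
    [IsManifold 𝓘(ℝ, Cn n) ∞ (HomSpace n)] : IsSmoothMetric (homMetric n) :=
  isSmoothMetric_of_coordMetric _ homMetric_symm (fun c _ hu => homMetric_pos Φ hΦ c hu) fun _ =>
    contDiffAt_coordMetric_pullback (contMDiff_homMap Φ hΦ)
      (contDiff_of_eq_coordHerm (coordMetric_fubiniStudy _)).contDiffAt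

theorem dhom_dtranslation (hΦ : ⇑Φ = homMap n) (a : SU n) (c : HomSpace n) (u : Cn n) :
    dhom (a • c) (dtranslation a c u) =
      (mfderiv 𝓘(ℝ, Cn n) 𝓘(ℝ, Cn n) (actCP a) (homMap n c) : Cn n →L[ℝ] Cn n) (dhom c u) := by
  have hleft := (mdifferentiable_homMap Φ hΦ (a • c)).hasMFDerivAt.comp c
    ((contMDiff_smul_homSpace Φ hΦ a c).mdifferentiableAt (by simp)).hasMFDerivAt
  have hright := ((contMDiff_actCP a (homMap n c)).mdifferentiableAt (by simp)).hasMFDerivAt.comp c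
    (mdifferentiable_homMap Φ hΦ c).hasMFDerivAt
  exact DFunLike.congr_fun (hasMFDerivAt_unique hleft
    (hright.congr_of_eventuallyEq (.of_forall (homMap_smul a)))) u

theorem exists_smul_eq_of_homMetric_eq_one (hΦ : ⇑Φ = homMap n)
    {j : Fin (n + 1)} (hj : j ≠ 0) {u₀ : Cn n}
    (hu₀ : dhom ((1 : SU n) : HomSpace n) u₀ =
      dproj (EuclideanSpace.single 0 1) (EuclideanSpace.single j 1))
    (c : HomSpace n) (u : Cn n) (hu : (homMetric n c : Cn n →L[ℝ] Cn n →L[ℝ] ℝ) u u = 1) :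
    ∃ a : SU n, a • ((1 : SU n) : HomSpace n) = c ∧
      dtranslation a ((1 : SU n) : HomSpace n) u₀ = u := by
  obtain ⟨z, v, hz, hv, hzv, hzc, hvu⟩ := exists_horizontal_lift hu
  obtain ⟨a, r, hr, ha0, haj⟩ := exists_act_single_eq_smul_pair hj hz hv hzv
  have hz0 : z ≠ 0 := norm_ne_zero_iff.1 (by simp [hz])
  have he0 : (EuclideanSpace.single 0 1 : Cn (n + 1)) ≠ 0 := by simp
  have hac : a • ((1 : SU n) : HomSpace n) = c := homMap_injective (by
    rw [homMap_smul, homMap_one, actCP_proj a he0, ha0, proj_smul hr hz0, hzc])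
  subst hac
  refine ⟨a, rfl, (dhom_bijective Φ hΦ (a • ((1 : SU n) : HomSpace n))).1 ?_⟩
  rw [dhom_dtranslation Φ hΦ, hu₀, homMap_one, mfderiv_actCP_dproj a he0, ha0, haj,
    dproj_smul hr hz0, hvu]

theorem exists_homMetric_eq_smul (hΦ : ⇑Φ = homMap n)
    [IsManifold 𝓘(ℝ, Cn n) ∞ (HomSpace n)] (hn : 1 ≤ n)
    {h : TensorField (Cn n) (HomSpace n)} (hh : IsSmoothMetric h)
    (hinv : IsInvariantMetric n h) : ∃ μ : ℝ, 0 < μ ∧ homMetric n = fun c => μ • h c := by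
  have hj : Fin.last n ≠ 0 := Fin.ne_of_val_ne (by simpa using Nat.one_le_iff_ne_zero.1 hn)
  obtain ⟨u₀, hu₀⟩ := (dhom_bijective Φ hΦ ((1 : SU n) : HomSpace n)).2
    (dproj (EuclideanSpace.single 0 1) (EuclideanSpace.single (Fin.last n) 1))
  obtain ⟨h', rfl⟩ := hh
  let o : HomSpace n := ((1 : SU n) : HomSpace n)
  let m : ℝ := (h'.inner o : Cn n →L[ℝ] Cn n →L[ℝ] ℝ) u₀ u₀
  have hm : 0 < m := h'.pos o u₀ (ne_zero_of_dhom_one_eq hj hu₀)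
  have hunit (c : HomSpace n) (u : Cn n)
      (hu : (homMetric n c : Cn n →L[ℝ] Cn n →L[ℝ] ℝ) u u = 1) :
      (h'.inner c : Cn n →L[ℝ] Cn n →L[ℝ] ℝ) u u = m := by
    obtain ⟨a, rfl, rfl⟩ := exists_smul_eq_of_homMetric_eq_one Φ hΦ hj hu₀ c u hu
    exact apply_dtranslation_of_isInvariantMetric hinv a o u₀ u₀
  have hself (c : HomSpace n) (u : Cn n) : (h'.inner c : Cn n →L[ℝ] Cn n →L[ℝ] ℝ) u u =
      m * (homMetric n c : Cn n →L[ℝ] Cn n →L[ℝ] ℝ) u u :=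
    apply_self_eq_mul_of_unit (fun _ hu => homMetric_pos Φ hΦ c hu) (hunit c) u
  refine ⟨m⁻¹, inv_pos.2 hm, funext fun c => ?_⟩
  refine eq_of_symm_of_apply_self_eq (E := Cn n) (A := homMetric n c) (B := m⁻¹ • h'.inner c)
    (homMetric_symm c) (fun u v => congrArg (m⁻¹ * ·) (h'.symm c u v)) fun u => ?_
  refine Eq.trans ?_ (congrArg (m⁻¹ * ·) (hself c u)).symm
  exact (inv_mul_cancel_left₀ hm.ne' _).symm

end InvariantMetric

end FubiniStudy

theorem mainTheorem3 :
    (∀ n : ℕ, IsSubmersionMetric n (fubiniStudy n)) ∧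
    (∀ n : ℕ, 2 ≤ n →
      T2Space (CP n) ∧ SecondCountableTopology (CP n) ∧
      IsKahler (fubiniStudy n) ∧
      (∀ p : CP n, IsChernConnection (fubiniStudy n) p (leviCivita (fubiniStudy n) p)) ∧
      (∃ c : ℝ, 0 < c ∧ IsEinstein (fubiniStudy n) c) ∧
      (∀ (p : CP n) (u w : TangentSpace 𝓘(ℝ, Cn n) p),
        fubiniStudy n p u u = 1 → fubiniStudy n p w w = 1 →
        fubiniStudy n p u w = 0 → fubiniStudy n p (complexStructure p u) w = 0 →
        ∀ s : ℝ, sectional (fubiniStudy n) p u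
          (Real.cos s • w + Real.sin s • complexStructure p u) = 1 + 3 * Real.sin s ^ 2) ∧
      (¬ ∃ c : ℝ, HasConstantSectionalCurvature (fubiniStudy n) c) ∧
      ¬ IsLocallyConformallyFlat (fubiniStudy n) ∧
      IsOrientable (Cn n) (CP n)) ∧
    ((∃ Φ : Diffeomorph 𝓘(ℝ, Cn 1) 𝓘(ℝ, EuclideanSpace ℝ (Fin 2)) (CP 1)
        (Metric.sphere (0 : EuclideanSpace ℝ (Fin 3)) 1) ∞,
        pullback Φ roundMetric = fun p => (4 : ℝ) • fubiniStudy 1 p) ∧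
      HasConstantSectionalCurvature (fubiniStudy 1) 4 ∧
      IsLocallyConformallyFlat (fubiniStudy 1)) ∧
    (∀ n : ℕ, 1 ≤ n →
      (∃ _ : ChartedSpace (Cn n) (HomSpace n), IsHomogeneousStructure n) ∧
      ∀ (_ : ChartedSpace (Cn n) (HomSpace n)) (_ : IsManifold 𝓘(ℝ, Cn n) ∞ (HomSpace n)),
        IsHomogeneousStructure n →
        (∃ Φ : Diffeomorph 𝓘(ℝ, Cn n) 𝓘(ℝ, Cn n) (HomSpace n) (CP n) ∞, ⇑Φ = homMap n) ∧
        (∃ h : TensorField (Cn n) (HomSpace n), IsSmoothMetric h ∧ IsInvariantMetric n h) ∧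
        ∀ h : TensorField (Cn n) (HomSpace n), IsSmoothMetric h → IsInvariantMetric n h →
          ∃ μ : ℝ, 0 < μ ∧ pullback (homMap n) (fubiniStudy n) = fun c => μ • h c) := by
  refine ⟨isSubmersionMetric_fubiniStudy, fun n hn => ?_, ?_, fun n hn => ?_⟩
  · exact ⟨inferInstance, inferInstance, isKahler_fubiniStudy n, isChernConnection_fubiniStudy,
      ⟨2 * (n + 1), by positivity, isEinstein_fubiniStudy n⟩, sectional_angle,
      not_hasConstantSectionalCurvature hn, not_isLocallyConformallyFlat hn,
      isOrientable_of_complex (CP n)⟩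
  · exact ⟨exists_isometry_sphere, hasConstantSectionalCurvature_CP_one,
      isLocallyConformallyFlat_CP_one⟩
  · refine ⟨exists_isHomogeneousStructure n, fun _ _ hs => ?_⟩
    obtain ⟨Φ, hΦ⟩ := exists_diffeomorph_homMap hs
    exact ⟨⟨Φ, hΦ⟩, ⟨homMetric n, isSmoothMetric_homMetric Φ hΦ, isInvariantMetric_homMetric Φ hΦ⟩,
      fun h hh hinv => exists_homMetric_eq_smul Φ hΦ hn hh hinv⟩
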